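/- Notation. Let $d\ge 1$, $p,q\in(1,\infty)$. For $f$ on $\mathbb R^{d+1}=\{(t,x):t\in\mathbb R,\,x\in\mathbb R^d\}$ put $\|f\|_{L_{p,q}}=\big(\int_{\mathbb R}\big(\int_{\mathbb R^d}|f(t,x)|^p\,dx\big)^{q/p}dt\big)^{1/q}$, and for a set $C$ of positive finite measure let $⨍\|f\|_{L_{p,q}(C)}:=\|fI_C\|_{L_{p,q}}/\|I_C\|_{L_{p,q}}$. Let $C_\rho(t,x)=[t,t+\rho^2)\times B_\rho(x)$, where $B_\rho(x)$ is the open ball in $\mathbb R^d$. For $\beta\ge 0$ the parabolic Morrey space $E_{p,q,\beta}$ consists of all $f\in L_{p,q,\mathrm{loc}}$ with $$\|f\|_{E_{p,q,\beta}}:=\sup_{0<\rho\le 1}\ \sup_{(t,x)\in\mathbb R^{d+1}}\rho^\beta\,⨍\|f\|_{L_{p,q}(C_\rho(t,x))}<\infty .$$ The elliptic Morrey space $E_{r,\beta}=E_{r,\beta}(\mathbb R^d)$ consists of all $g\in L_{r,\mathrm{loc}}(\mathbb R^d)$ with $\|g\|_{E_{r,\beta}}:=\sup_{0<\rho\le1,\,x\in\mathbb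 R^d}\rho^\beta\big(|B_\rho|^{-1}\int_{B_\rho(x)}|g|^r\,dy\big)^{1/r}<\infty$. Let $E^{1,2}_{p,q,\beta}$ be the set of $u$ such that $u$ and its weak derivatives $\partial_tu$, $Du$, $D^2u$ ($D$ = derivatives in $x$) belong to $E_{p,q,\beta}$, normed by the sum of the $E_{p,q,\beta}$-norms of $u,\partial_tu,Du,D^2u$; write $\|\partial_tu,D^2u\|_{E_{p,q,\beta}}=\|\partial_tu\|_{E_{p,q,\beta}}+\|D^2u\|_{E_{p,q,\beta}}$. Put $D^0u=u$, $D^1u=Du$. For $\zeta\in C_0^\infty(\mathbb R^{d+1})$ nonnegative with unit integral and support in $C_1(-1,0)=[-1,0)\times B_1(0)$ let $u^{(\varepsilon)}=u*\zeta_\varepsilon$, $\zeta_\varepsilon(t,x)=\varepsilon^{-d-2}\zeta(t/\varepsilon^2,x/\varepsilon)$. The trace $D^\gamma u(0,\cdot)$ is the limit, in $L_r(B)$ for every ball $B\subset\mathbb R^d$, of $D^\gamma u^{(\varepsilon)}(0,\cdot)$ as $\varepsilon\downarrow0$. Theorem. Let $p,q\in(1,\infty)$, $\gamma\in\{0,1\}$,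 $r\in[p,\infty)$ and $\mu<2$, and assume that $$2-\gamma<\beta\le\frac dp+\frac2q<2-\gamma+\frac dr,\qquad \kappa:=\gamma+\frac dp+\frac2q-\frac dr\le\mu .$$ Then for every $u\in E^{1,2}_{p,q,\beta}$ the trace $D^\gamma u(0,\cdot)$ is uniquely defined (the limit exists, it does not depend on $\zeta$, and it is unique up to a null set) and belongs to $E_{r,\beta+\gamma-\mu}$ and to $E_{r,\beta+\gamma-2}$. Moreover, for every $\varepsilon\in(0,1]$, $$\|D^\gamma u(0,\cdot)\|_{E_{r,\beta+\gamma-\mu}}\le N\varepsilon\,\|\partial_tu,D^2u\|_{E_{p,q,\beta}}+N\varepsilon^{-\mu/(2-\mu)}\|u\|_{E_{p,q,\beta}},$$ and $$\|D^\gamma u(0,\cdot)\|_{E_{r,\beta+\gamma-2}}\le N\,\|u\|_{E^{1,2}_{p,q,\beta}},$$ where the constants $N$ depend only on $d,p,q,\beta,\mu$. -/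

import Mathlib

open MeasureTheory Set Filter Topology
open scoped ENNReal NNReal ContDiff

namespace ParabolicMorrey

/-- The spatial domain `ℝ^d` with its Euclidean norm. -/
abbrev E (d : ℕ) : Type := EuclideanSpace ℝ (Fin d)

/-- Points `z = (t, x)` of `ℝ^{d+1} = ℝ × ℝ^d`. -/
abbrev Z (d : ℕ) : Type := ℝ × E d

/-- The parabolic cylinder `C_ρ(t, x) = [t, t + ρ²) × B_ρ(x)`. -/
def cylinder {d : ℕ} (ρ : ℝ) (z : Z d) : Set (Z d) :=
  Ico z.1 (z.1 + ρ ^ 2) ×ˢ Metric.ball z.2 ρ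

section Spaces

variable {d : ℕ} {F : Type*} [NormedAddCommGroup F]

/-- The mixed norm of `L_{p,q} = L_q(ℝ, L_p(ℝ^d))` (first `L_p` in `x`, then `L_q` in `t`). -/
noncomputable def lpqNorm (p q : ℝ) (f : Z d → F) : ℝ≥0∞ :=
  (∫⁻ t : ℝ, (∫⁻ x : E d, ‖f (t, x)‖ₑ ^ p) ^ (q / p)) ^ (1 / q)

/-- The normalized mixed norm `‖f‖_{L_{p,q}(Γ)} / ‖1‖_{L_{p,q}(Γ)}`. -/
noncomputable def avgNorm (p q : ℝ) (Γ : Set (Z d)) (f : Z d → F) : ℝ≥0∞ :=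
  lpqNorm p q (Γ.indicator f) / lpqNorm p q (Γ.indicator (fun _ => (1 : ℝ)))

/-- `f ∈ L_{p,q,loc}`: `f 1_A ∈ L_{p,q}` for every bounded (Borel) set `A`. -/
def MemLpqLoc (p q : ℝ) (f : Z d → F) : Prop :=
  AEStronglyMeasurable f volume ∧
    ∀ A : Set (Z d), Bornology.IsBounded A → MeasurableSet A → lpqNorm p q (A.indicator f) < ⊤

/-- The parabolic Morrey norm
`‖f‖_{E_{p,q,β}} = sup_{0 < ρ ≤ 1, C ∈ 𝐂_ρ} ρ^β ‖f‖_{L_{p,q}(C)} / ‖1‖_{L_{p,q}(C)}`. -/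
noncomputable def morreyNorm (p q β : ℝ) (f : Z d → F) : ℝ≥0∞ :=
  ⨆ (ρ : ℝ) (_ : 0 < ρ ∧ ρ ≤ 1) (z : Z d), ENNReal.ofReal (ρ ^ β) * avgNorm p q (cylinder ρ z) f

/-- Membership in the parabolic Morrey space `E_{p,q,β}`. -/
def MemMorrey (p q β : ℝ) (f : Z d → F) : Prop :=
  MemLpqLoc p q f ∧ morreyNorm p q β f < ⊤

/-- The elliptic Morrey norm
`‖g‖_{E_{r,β}} = sup_{0 < ρ ≤ 1, x} ρ^β (|B_ρ|⁻¹ ∫_{B_ρ(x)} |g|^r dy)^{1/r}`; it is the value of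
the parabolic Morrey norm at a function of `(t, x)` that does not depend on `t`. -/
noncomputable def ellipticMorreyNorm (r β : ℝ) (g : E d → F) : ℝ≥0∞ :=
  ⨆ (ρ : ℝ) (_ : 0 < ρ ∧ ρ ≤ 1) (x : E d),
    ENNReal.ofReal (ρ ^ β) * (⨍⁻ y in Metric.ball x ρ, ‖g y‖ₑ ^ r ∂volume) ^ (1 / r)

/-- `g ∈ L_{r,loc}(ℝ^d)`, in terms of balls. -/
def MemLrLoc (r : ℝ) (g : E d → F) : Prop :=
  ∀ (x : E d) (R : ℝ), MemLp g (ENNReal.ofReal r) (volume.restrict (Metric.ball x R))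

/-- Membership in the elliptic Morrey space `E_{r,β}(ℝ^d)`. -/
def MemEllipticMorrey (r β : ℝ) (g : E d → F) : Prop :=
  MemLrLoc r g ∧ ellipticMorreyNorm r β g < ⊤

end Spaces

variable {d : ℕ}

/-- `v` is the weak (Sobolev) derivative of `u` on `ℝ^{d+1}` in the direction `e`. -/
def HasWeakDeriv (u v : Z d → ℝ) (e : Z d) : Prop :=
  LocallyIntegrable u volume ∧ LocallyIntegrable v volume ∧
    ∀ φ : Z d → ℝ, ContDiff ℝ ∞ φ → HasCompactSupport φ →
      ∫ z, u z * fderiv ℝ φ z e = - ∫ z, v z * φ z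

/-- The unit vector of the time axis. -/
def timeDir (d : ℕ) : Z d := (1, 0)

/-- The unit vector of the `i`-th spatial axis. -/
noncomputable def spaceDir (i : Fin d) : Z d := (0, EuclideanSpace.single i 1)

/-- `u ∈ E^{1,2}_{p,q,β}`, with weak derivatives `ut = ∂_t u`, `Du = (D_i u)_i` and
`D2u = (D_{ij} u)_{i,j}` (which are determined by `u` up to null sets). -/
structure MemMorrey12 (p q β : ℝ) (u ut : Z d → ℝ) (Du : Z d → E d)
    (D2u : Z d → EuclideanSpace ℝ (Fin d × Fin d)) : Prop where
  mem : MemMorrey p q β u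
  mem_ut : MemMorrey p q β ut
  mem_Du : MemMorrey p q β Du
  mem_D2u : MemMorrey p q β D2u
  weak_ut : HasWeakDeriv u ut (timeDir d)
  weak_Du : ∀ i, HasWeakDeriv u (fun z => Du z i) (spaceDir i)
  weak_D2u : ∀ i j, HasWeakDeriv (fun z => Du z i) (fun z => D2u z (i, j)) (spaceDir j)

/-- The norm of `E^{1,2}_{p,q,β}`. -/
noncomputable def morrey12Norm (p q β : ℝ) (u ut : Z d → ℝ) (Du : Z d → E d)
    (D2u : Z d → EuclideanSpace ℝ (Fin d × Fin d)) : ℝ≥0∞ :=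
  morreyNorm p q β u + morreyNorm p q β Du + morreyNorm p q β D2u + morreyNorm p q β ut

/-- Admissible mollifying kernels: nonnegative, smooth, of unit integral, with compact support
in `C_1(-1, 0) = [-1, 0) × B_1`. -/
structure IsMollifier (ζ : Z d → ℝ) : Prop where
  smooth : ContDiff ℝ ∞ ζ
  compact : HasCompactSupport ζ
  nonneg : ∀ z, 0 ≤ ζ z
  integral_eq_one : ∫ z, ζ z = 1
  support : tsupport ζ ⊆ cylinder 1 (-1, 0)

/-- `ζ_ε(t, x) = ε^{-d-2} ζ(t / ε², x / ε)`. -/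
noncomputable def scaledKernel (ζ : Z d → ℝ) (ε : ℝ) : Z d → ℝ :=
  fun z => (ε ^ (d + 2))⁻¹ * ζ (z.1 / ε ^ 2, ε⁻¹ • z.2)

/-- `u^{(ε)} = u * ζ_ε`, the convolution on `ℝ^{d+1}`. -/
noncomputable def mollify (ζ : Z d → ℝ) (ε : ℝ) (u : Z d → ℝ) : Z d → ℝ :=
  convolution u (scaledKernel ζ ε) (ContinuousLinearMap.mul ℝ ℝ) volume

/-- The values of `D^γ` at a point of `ℝ^d`: for `γ = 0` this space is `ℝ`, for `γ = 1` it is the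
dual of `ℝ^d`, both with their usual norms. -/
abbrev DVal (d γ : ℕ) : Type := ContinuousMultilinearMap ℝ (fun _ : Fin γ => E d) ℝ

/-- `g` is the trace `D^γ u(0, ·)` computed with the kernel `ζ`: the limit in `L_r(B)`, for every
ball `B`, of the spatial derivative `D^γ u^{(ε)}(0, ·)` as `ε ↓ 0`. -/
def IsTrace (γ : ℕ) (r : ℝ) (ζ : Z d → ℝ) (u : Z d → ℝ) (g : E d → DVal d γ) : Prop :=
  MemLrLoc r g ∧
    ∀ (x : E d) (R : ℝ),
      Tendsto (fun ε : ℝ =>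
        eLpNorm (fun y => iteratedFDeriv ℝ γ (fun x' : E d => mollify ζ ε u (0, x')) y - g y)
          (ENNReal.ofReal r) (volume.restrict (Metric.ball x R))) (𝓝[>] 0) (𝓝 0)

end ParabolicMorrey

/-!
Write `κ = γ + d/p + 2/q - d/r`. Everything rests on estimates for the mollifications
`U_δ = D^γ u^{(δ)}(0, ·)` in terms of `cylMass f δ x`, the integral of `|f|` over a parabolic cylinder
of size comparable to `δ` at `(0, x)`.

* Pointwise, `|U_δ| ≤ C δ^{-(d+2+γ)} cylMass u δ` since the mollifier is bounded together with its
  derivative. A difference `U_ε - U_δ` with `ε` comparable to `δ` is the pairing of `u` with a kernel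
  that is orthogonal to `1` and to the linear functions of `x`, if both mollifiers have vanishing
  first moments or if `γ = 1`. By a Poincaré inequality (`enorm_integral_mul_le_of_contDiff` for
  smooth functions, `enorm_conv_le_of_moments` for `u`) it is therefore controlled by `∂_t u` and
  `D²u` and gains a factor `δ²` (`IsMollifier.enorm_sliceDeriv_sub_le`).
* By Minkowski's and Hölder's inequalities, as `r ≥ p`, the average of `(cylMass f δ)^r` over a ball of
  radius `ρ` is controlled by the parabolic Morrey norm of `f` (`laverage_cylMass_le`).
* Hence the normalized `L_r` norms over `B_ρ` of `U_δ` and of `U_δ - U_{δ/2}` are at most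
  `C δ^{-κ} max(ρ, δ)^{κ-γ-β} ‖u‖` and `C δ^{2-κ} max(ρ, δ)^{κ-γ-β} ‖∂_t u, D²u‖`, with `C` depending
  only on `d` (`IsMollifier.exists_eLpNorm_ballMeasure_le`).

As `κ < 2`, the dyadic sequence `U_{2^{-k}}` for one centered mollifier converges geometrically in
`L_r` on balls. A general mollifier differs from it, at the same scale, by a quantity that tends to
zero; for `γ = 0` a nonzero first moment costs the additional term `δ |D u^{(δ)}(0, ·)|`, which tends
to zero since `d/p + 2/q - d/r < 2` (`MemMorrey12.exists_trace`).

The two norm estimates result from telescoping, that is, from bounding the trace by `U_δ` and the sum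
of all dyadic increments below `δ`. For the interpolation inequality one multiplies by
`ρ^{β+γ-μ} ≤ max(ρ, δ)^{β+γ-μ}`, so that `κ ≤ μ` turns the two bounds into `δ^{-μ}` and `δ^{2-μ}`, and
takes `δ` comparable to `ε^{1/(2-μ)}` (`exists_interpolation`). For the exponent `β + γ - 2` one starts
at `δ = 1/3`; the terms decay geometrically on both sides of `δ = ρ`, because `β + γ > 2` and `κ < 2`
(`exists_ellipticMorreyNorm_trace_le`).
-/

namespace ParabolicMorrey

/-! ### Minkowski's integral inequality and mixed norms -/

section Minkowski

variable {α β : Type*} [MeasurableSpace α] [MeasurableSpace β] {μ : Measure α} {ν : Measure β}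

/-- If `∫ g ^ p ≤ (∫ g ^ p) ^ (1 - 1 / p) * C` and `∫ g ^ p` is finite, then `‖g‖_p ≤ C`. -/
theorem rpow_le_of_le_mul {a C : ℝ≥0∞} {p : ℝ} (hp : 1 < p) (ha : a ≠ ⊤)
    (h : a ≤ a ^ (1 - 1 / p) * C) : a ^ (1 / p) ≤ C := by
  have hp0 : 0 < p := by linarith
  rcases eq_or_ne a 0 with rfl | h0
  · rw [ENNReal.zero_rpow_of_pos (by positivity)]; exact zero_le
  have h1 : a = a ^ (1 - 1 / p) * a ^ (1 / p) := by
    rw [← ENNReal.rpow_add _ _ h0 ha]; simp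
  have h2 : a ^ (1 - 1 / p) ≠ 0 := by
    simp [ENNReal.rpow_eq_zero_iff, h0, ha]
  have h3 : a ^ (1 - 1 / p) ≠ ⊤ := by
    have : 1 / p < 1 := by rw [div_lt_one hp0]; exact hp
    exact ENNReal.rpow_ne_top_of_nonneg (by linarith) ha
  have h' : a ^ (1 - 1 / p) * a ^ (1 / p) ≤ a ^ (1 - 1 / p) * C := h1 ▸ h
  exact (ENNReal.mul_le_mul_iff_right h2 h3).1 h'

/-- **Minkowski's integral inequality** on a space of finite measure. The bounded truncations of
`∫ F t x dt` have finite norm, which makes it possible to divide in the usual duality argument. -/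
theorem lintegral_rpow_lintegral_le [SFinite μ] [IsFiniteMeasure ν] {p : ℝ} (hp : 1 < p)
    {F : α × β → ℝ≥0∞} (hF : Measurable F) :
    (∫⁻ x, (∫⁻ t, F (t, x) ∂μ) ^ p ∂ν) ^ (1 / p) ≤ ∫⁻ t, (∫⁻ x, F (t, x) ^ p ∂ν) ^ (1 / p) ∂μ := by
  have hp0 : 0 < p := by linarith
  set G : β → ℝ≥0∞ := fun x => ∫⁻ t, F (t, x) ∂μ with hG
  have hGm : Measurable G := hF.lintegral_prod_left'
  set C := ∫⁻ t, (∫⁻ x, F (t, x) ^ p ∂ν) ^ (1 / p) ∂μ with hC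
  have key : ∀ n : ℕ, (∫⁻ x, (min (G x) n) ^ p ∂ν) ^ (1 / p) ≤ C := by
    intro n
    set g : β → ℝ≥0∞ := fun x => min (G x) n with hg
    have hgm : Measurable g := hGm.min measurable_const
    have hfin : ∫⁻ x, g x ^ p ∂ν ≠ ⊤ := by
      refine ne_top_of_le_ne_top (b := ∫⁻ _x, (n : ℝ≥0∞) ^ p ∂ν) ?_
        (lintegral_mono fun x => ENNReal.rpow_le_rpow (min_le_right _ _) hp0.le)
      rw [lintegral_const]
      exact ENNReal.mul_ne_top (ENNReal.rpow_ne_top_of_nonneg hp0.le (by simp)) (measure_ne_top _ _)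
    apply rpow_le_of_le_mul hp hfin
    have hpq : (p.conjExponent).HolderConjugate p := (Real.HolderConjugate.conjExponent hp).symm
    have hexp : (p - 1) * p.conjExponent = p := by
      rw [Real.conjExponent]; field_simp [show p - 1 ≠ 0 by linarith]
    have hinv : 1 / p.conjExponent = 1 - 1 / p := by
      rw [Real.conjExponent]; field_simp
    calc ∫⁻ x, g x ^ p ∂ν ≤ ∫⁻ x, g x ^ (p - 1) * G x ∂ν := by
          refine lintegral_mono fun x => ?_
          have : g x ^ p = g x ^ (p - 1) * g x := by
            conv_lhs => rw [show p = (p - 1) + 1 by ring]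
            rw [ENNReal.rpow_add_of_nonneg _ _ (by linarith) zero_le_one, ENNReal.rpow_one]
          simp only [this]
          gcongr
          exact min_le_left _ _
      _ = ∫⁻ x, ∫⁻ t, g x ^ (p - 1) * F (t, x) ∂μ ∂ν := by
          refine lintegral_congr fun x => ?_
          exact (lintegral_const_mul _
            (show Measurable fun t => F (t, x) from
              hF.comp (measurable_id.prodMk measurable_const))).symm
      _ = ∫⁻ t, ∫⁻ x, g x ^ (p - 1) * F (t, x) ∂ν ∂μ := by
          rw [lintegral_lintegral_swap]
          exact (((hgm.comp measurable_fst).pow_const _).mul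
            (hF.comp measurable_swap)).aemeasurable
      _ ≤ ∫⁻ t, (∫⁻ x, g x ^ p ∂ν) ^ (1 - 1 / p) * (∫⁻ x, F (t, x) ^ p ∂ν) ^ (1 / p) ∂μ := by
          refine lintegral_mono fun t => ?_
          have := ENNReal.lintegral_mul_le_Lp_mul_Lq ν hpq (f := fun x => g x ^ (p - 1))
            (g := fun x => F (t, x)) (hgm.pow_const _).aemeasurable
            (hF.comp (measurable_const.prodMk measurable_id)).aemeasurable
          simp only [← ENNReal.rpow_mul, hexp, hinv] at this
          exact this
      _ = (∫⁻ x, g x ^ p ∂ν) ^ (1 - 1 / p) * C := by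
          rw [lintegral_const_mul]
          exact (Measurable.lintegral_prod_right' (hF.pow_const p)).pow_const _
  have hlim : ∫⁻ x, G x ^ p ∂ν = ⨆ n : ℕ, ∫⁻ x, (min (G x) n) ^ p ∂ν := by
    rw [← lintegral_iSup]
    · refine lintegral_congr fun x => ?_
      have h1 : (⨆ n : ℕ, min (G x) n) = G x := by
        rw [← inf_iSup_eq (G x), ENNReal.iSup_natCast, inf_top_eq]
      conv_lhs => rw [← h1]
      exact (ENNReal.orderIsoRpow p hp0).map_iSup _
    · exact fun n => (hGm.min measurable_const).pow_const _
    · intro m n hmn x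
      exact ENNReal.rpow_le_rpow (min_le_min le_rfl (by exact_mod_cast hmn)) hp0.le
  have hlim' : (∫⁻ x, G x ^ p ∂ν) ^ (1 / p) = ⨆ n : ℕ, (∫⁻ x, (min (G x) n) ^ p ∂ν) ^ (1 / p) := by
    rw [hlim]
    exact (ENNReal.orderIsoRpow (1 / p) (by positivity)).map_iSup _
  rw [hlim']
  exact iSup_le key

/-- Hölder's inequality against the constant function. -/
theorem lintegral_le_measure_rpow_mul {p : ℝ} (hp : 1 < p) {f : β → ℝ≥0∞}
    (hf : AEMeasurable f ν) :
    ∫⁻ x, f x ∂ν ≤ ν univ ^ (1 - 1 / p) * (∫⁻ x, f x ^ p ∂ν) ^ (1 / p) := by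
  have hinv : 1 / p.conjExponent = 1 - 1 / p := by
    rw [Real.conjExponent]; field_simp
  have := ENNReal.lintegral_mul_le_Lp_mul_Lq ν (Real.HolderConjugate.conjExponent hp).symm
    (f := fun _ => 1) (g := f) aemeasurable_const hf
  simpa [hinv] using this

end Minkowski

section Mixed

variable {d : ℕ} {F : Type*} [NormedAddCommGroup F]

/-- The mixed norm of a nonnegative function over the box `I × B`. -/
noncomputable def boxNorm (p q : ℝ) (I : Set ℝ) (B : Set (E d)) (G : Z d → ℝ≥0∞) : ℝ≥0∞ :=
  (∫⁻ t in I, (∫⁻ x in B, G (t, x) ^ p) ^ (q / p)) ^ (1 / q)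

theorem lpqNorm_indicator_prod {p q : ℝ} (hp : 0 < p) (hq : 0 < q) {I : Set ℝ} {B : Set (E d)}
    (hI : MeasurableSet I) (hB : MeasurableSet B) (f : Z d → F) :
    lpqNorm p q ((I ×ˢ B).indicator f) = boxNorm p q I B (fun z => ‖f z‖ₑ) := by
  unfold lpqNorm boxNorm
  rw [← lintegral_indicator hI]
  congr 1
  refine lintegral_congr fun t => ?_
  by_cases ht : t ∈ I
  · rw [indicator_of_mem ht, ← lintegral_indicator hB]
    congr 1
    refine lintegral_congr fun x => ?_
    by_cases hx : x ∈ B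
    · rw [indicator_of_mem hx, indicator_of_mem (show (t, x) ∈ I ×ˢ B from ⟨ht, hx⟩)]
    · rw [indicator_of_notMem hx, indicator_of_notMem (fun h => hx h.2)]
      simp [hp]
  · rw [indicator_of_notMem ht]
    have : ∀ x, ‖(I ×ˢ B).indicator f (t, x)‖ₑ ^ p = 0 := by
      intro x
      rw [indicator_of_notMem (fun h => ht h.1)]
      simp [hp]
    simp only [this, lintegral_zero]
    exact ENNReal.zero_rpow_of_pos (by positivity)

theorem exists_measurable_enorm {f : Z d → F} (hf : AEStronglyMeasurable f volume) :
    ∃ G : Z d → ℝ≥0∞, Measurable G ∧ (fun z => ‖f z‖ₑ) =ᵐ[volume] G :=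
  ⟨hf.enorm.mk _, hf.enorm.measurable_mk, hf.enorm.ae_eq_mk⟩

theorem boxNorm_congr {p q : ℝ} {I : Set ℝ} {B : Set (E d)} {G H : Z d → ℝ≥0∞}
    (h : G =ᵐ[volume] H) : boxNorm p q I B G = boxNorm p q I B H := by
  unfold boxNorm
  congr 1
  refine lintegral_congr_ae (ae_restrict_of_ae ?_)
  have h' : ∀ᵐ t : ℝ, ∀ᵐ x : E d, G (t, x) = H (t, x) := Measure.ae_ae_of_ae_prod h
  filter_upwards [h'] with t ht
  congr 1
  refine lintegral_congr_ae (ae_restrict_of_ae ?_)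
  filter_upwards [ht] with x hx
  rw [hx]

theorem boxNorm_const {p q : ℝ} (hp : 0 < p) (hq : 0 < q) {I : Set ℝ} {B : Set (E d)} :
    boxNorm p q I B (fun _ => 1) = volume I ^ (1 / q) * volume B ^ (1 / p) := by
  unfold boxNorm
  simp only [ENNReal.one_rpow, lintegral_const, Measure.restrict_apply, MeasurableSet.univ,
    univ_inter, one_mul]
  rw [ENNReal.mul_rpow_of_nonneg _ _ (by positivity), ← ENNReal.rpow_mul, mul_comm]
  congr 2
  field_simp

/-- Minkowski's inequality in `x` and Hölder's inequality in `t`. -/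
theorem lintegral_time_rpow_le {p q : ℝ} (hp : 1 < p) (hq : 1 < q) {I : Set ℝ} {B : Set (E d)}
    (hB : volume B ≠ ⊤) {G : Z d → ℝ≥0∞} (hG : Measurable G) :
    (∫⁻ x in B, (∫⁻ t in I, G (t, x)) ^ p) ^ (1 / p) ≤
      volume I ^ (1 - 1 / q) * boxNorm p q I B G := by
  have : IsFiniteMeasure (volume.restrict B) := ⟨by simpa using hB.lt_top⟩
  refine (lintegral_rpow_lintegral_le (μ := volume.restrict I) hp hG).trans ?_
  have hm : AEMeasurable (fun t : ℝ => (∫⁻ x in B, G (t, x) ^ p) ^ (1 / p)) (volume.restrict I) :=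
    ((Measurable.lintegral_prod_right' (hG.pow_const p)).pow_const _).aemeasurable
  refine (lintegral_le_measure_rpow_mul hq hm).trans (le_of_eq ?_)
  unfold boxNorm
  simp only [Measure.restrict_apply, MeasurableSet.univ, univ_inter, ← ENNReal.rpow_mul]
  congr 3
  ext t
  congr 1
  ring

/-- `L_r` bound for integrals over moving balls: the function
`x ↦ ∫_{I × B_s(x)} G` is bounded in `L_r(A)` by the mixed norm of `G` over any box `I × B` that
contains all the boxes `I × B_s(x)`, `x ∈ A`. For `r ≥ p` one splits off `r - p` powers of the
uniform bound of the local `L_p` norm and integrates the remaining `p` powers. -/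
theorem lintegral_rpow_movingBall_le {p q r : ℝ} (hp : 1 < p) (hq : 1 < q) (hr : p ≤ r)
    {I : Set ℝ} {A B : Set (E d)} (hA : MeasurableSet A)
    (hBf : volume B ≠ ⊤) {s : ℝ} (hs : ∀ x ∈ A, Metric.ball x s ⊆ B)
    {G : Z d → ℝ≥0∞} (hG : Measurable G) :
    (∫⁻ x in A, (∫⁻ y in Metric.ball x s, ∫⁻ t in I, G (t, y)) ^ r) ^ (1 / r) ≤
      volume (Metric.ball (0 : E d) s) ^ (1 - 1 / p + 1 / r) *
        (volume I ^ (1 - 1 / q) * boxNorm p q I B G) := by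
  have hp0 : 0 < p := by linarith
  have hr0 : 0 < r := by linarith
  set b := volume (Metric.ball (0 : E d) s) with hb
  have hvol : ∀ x : E d, volume (Metric.ball x s) = b := fun x =>
    Measure.addHaar_ball_center volume x s
  set H : E d → ℝ≥0∞ := fun y => ∫⁻ t in I, G (t, y) with hH
  have hHm : Measurable H := hG.lintegral_prod_left'
  set T := ∫⁻ y in B, H y ^ p with hT
  have hmain : ∫⁻ x in A, (∫⁻ y in Metric.ball x s, H y) ^ r ≤
      b ^ (r * (1 - 1 / p) + 1) * T ^ (r / p) := by
    have h1 : ∀ x ∈ A, (∫⁻ y in Metric.ball x s, H y) ^ r ≤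
        (b ^ (r * (1 - 1 / p)) * T ^ (r / p - 1)) * ∫⁻ y in Metric.ball x s, H y ^ p := by
      intro x hx
      have h2 := lintegral_le_measure_rpow_mul (ν := volume.restrict (Metric.ball x s)) hp
        hHm.aemeasurable
      simp only [Measure.restrict_apply, MeasurableSet.univ, univ_inter, hvol] at h2
      set V := ∫⁻ y in Metric.ball x s, H y ^ p with hV
      have hVT : V ≤ T := lintegral_mono_set (hs x hx)
      calc (∫⁻ y in Metric.ball x s, H y) ^ r ≤ (b ^ (1 - 1 / p) * V ^ (1 / p)) ^ r :=
            ENNReal.rpow_le_rpow h2 hr0.le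
        _ = b ^ (r * (1 - 1 / p)) * V ^ (r / p) := by
            rw [ENNReal.mul_rpow_of_nonneg _ _ hr0.le, ← ENNReal.rpow_mul, ← ENNReal.rpow_mul]
            congr 2 <;> ring
        _ = b ^ (r * (1 - 1 / p)) * (V ^ (r / p - 1) * V) := by
            congr 1
            have : 0 ≤ r / p - 1 := by rw [sub_nonneg, one_le_div hp0]; exact hr
            conv_lhs => rw [show r / p = (r / p - 1) + 1 by ring]
            rw [ENNReal.rpow_add_of_nonneg _ _ this zero_le_one, ENNReal.rpow_one]
        _ ≤ b ^ (r * (1 - 1 / p)) * (T ^ (r / p - 1) * V) := by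
            have : 0 ≤ r / p - 1 := by rw [sub_nonneg, one_le_div hp0]; exact hr
            gcongr
        _ = _ := by ring
    have hmeas : Measurable fun w : E d × E d =>
        (Metric.ball w.1 s).indicator (fun y => H y ^ p) w.2 := by
      have : (fun w : E d × E d => (Metric.ball w.1 s).indicator (fun y => H y ^ p) w.2) =
          {w : E d × E d | dist w.2 w.1 < s}.indicator (fun w => H w.2 ^ p) := by
        ext w; simp [indicator, Metric.mem_ball]
      rw [this]
      refine ((hHm.comp measurable_snd).pow_const p).indicator ?_
      exact measurableSet_lt (measurable_snd.dist measurable_fst) measurable_const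
    have h3 : ∫⁻ x in A, ∫⁻ y in Metric.ball x s, H y ^ p ≤ b * T := by
      calc ∫⁻ x in A, ∫⁻ y in Metric.ball x s, H y ^ p
          = ∫⁻ x in A, ∫⁻ y in B, (Metric.ball x s).indicator (fun y => H y ^ p) y := by
            refine setLIntegral_congr_fun hA fun x hx => ?_
            rw [lintegral_indicator Metric.isOpen_ball.measurableSet,
              Measure.restrict_restrict Metric.isOpen_ball.measurableSet,
              inter_eq_left.2 (hs x hx)]
        _ = ∫⁻ y in B, ∫⁻ x in A, (Metric.ball x s).indicator (fun y => H y ^ p) y := by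
            rw [lintegral_lintegral_swap]
            exact hmeas.aemeasurable
        _ ≤ ∫⁻ y in B, b * H y ^ p := by
            refine lintegral_mono fun y => ?_
            calc ∫⁻ x in A, (Metric.ball x s).indicator (fun y => H y ^ p) y
                ≤ ∫⁻ x, (Metric.ball x s).indicator (fun y => H y ^ p) y :=
                  setLIntegral_le_lintegral _ _
              _ = ∫⁻ x, (Metric.ball y s).indicator (fun _ => H y ^ p) x := by
                  refine lintegral_congr fun x => ?_
                  simp [indicator, Metric.mem_ball, dist_comm]
              _ = b * H y ^ p := by
                  rw [lintegral_indicator_const Metric.isOpen_ball.measurableSet, hvol, mul_comm]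
        _ = b * T := by rw [lintegral_const_mul _ (hHm.pow_const p)]
    calc ∫⁻ x in A, (∫⁻ y in Metric.ball x s, H y) ^ r
        ≤ ∫⁻ x in A, (b ^ (r * (1 - 1 / p)) * T ^ (r / p - 1)) *
            ∫⁻ y in Metric.ball x s, H y ^ p := setLIntegral_mono' hA h1
      _ = (b ^ (r * (1 - 1 / p)) * T ^ (r / p - 1)) *
            ∫⁻ x in A, ∫⁻ y in Metric.ball x s, H y ^ p := by
          rw [lintegral_const_mul]
          have : Measurable fun x => ∫⁻ y, (Metric.ball x s).indicator (fun y => H y ^ p) y :=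
            hmeas.lintegral_prod_right'
          simpa only [lintegral_indicator Metric.isOpen_ball.measurableSet] using this
      _ ≤ (b ^ (r * (1 - 1 / p)) * T ^ (r / p - 1)) * (b * T) := by gcongr
      _ = (b ^ (r * (1 - 1 / p)) * b ^ (1 : ℝ)) * (T ^ (r / p - 1) * T ^ (1 : ℝ)) := by
          rw [ENNReal.rpow_one, ENNReal.rpow_one]; ring
      _ = _ := by
          rw [← ENNReal.rpow_add_of_nonneg, ← ENNReal.rpow_add_of_nonneg]
          · congr 2; ring
          · rw [sub_nonneg, one_le_div hp0]; exact hr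
          · exact zero_le_one
          · have : 1 / p < 1 := by rw [div_lt_one hp0]; exact hp
            exact mul_nonneg hr0.le (by linarith)
          · exact zero_le_one
  calc (∫⁻ x in A, (∫⁻ y in Metric.ball x s, H y) ^ r) ^ (1 / r)
      ≤ (b ^ (r * (1 - 1 / p) + 1) * T ^ (r / p)) ^ (1 / r) :=
        ENNReal.rpow_le_rpow hmain (by positivity)
    _ = b ^ (1 - 1 / p + 1 / r) * T ^ (1 / p) := by
        rw [ENNReal.mul_rpow_of_nonneg _ _ (by positivity), ← ENNReal.rpow_mul, ← ENNReal.rpow_mul]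
        congr 2 <;> field_simp
    _ ≤ _ := by
        gcongr
        exact lintegral_time_rpow_le hp hq hBf hG

/-- Hölder's inequality for the mixed norm over a box. -/
theorem lintegral_box_le {p q : ℝ} (hp : 1 < p) (hq : 1 < q) {I : Set ℝ} {B : Set (E d)}
    (hBf : volume B ≠ ⊤) {G : Z d → ℝ≥0∞} (hG : Measurable G) :
    ∫⁻ y in B, ∫⁻ t in I, G (t, y) ≤
      volume B ^ (1 - 1 / p) * (volume I ^ (1 - 1 / q) * boxNorm p q I B G) := by
  have h := lintegral_le_measure_rpow_mul (ν := volume.restrict B) hp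
    (f := fun y => ∫⁻ t in I, G (t, y)) hG.lintegral_prod_left'.aemeasurable
  simp only [Measure.restrict_apply, MeasurableSet.univ, univ_inter] at h
  refine h.trans ?_
  gcongr
  exact lintegral_time_rpow_le hp hq hBf hG

end Mixed

/-! ### Integrals over moving cylinders and Morrey norms -/

section CylMass

variable {d : ℕ} {F : Type*} [NormedAddCommGroup F]

/-- The volume of the unit ball of `ℝ^d`. -/
noncomputable def unitVol (d : ℕ) : ℝ≥0∞ := volume (Metric.ball (0 : E d) 1)

theorem unitVol_ne_zero (d : ℕ) : unitVol d ≠ 0 :=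
  (Metric.measure_ball_pos volume (0 : E d) one_pos).ne'

theorem unitVol_ne_top (d : ℕ) : unitVol d ≠ ⊤ := measure_ball_lt_top.ne

theorem volume_ball_eq (x : E d) {s : ℝ} (hs : 0 < s) :
    volume (Metric.ball x s) = ENNReal.ofReal s ^ (d : ℝ) * unitVol d := by
  rw [Measure.addHaar_ball_of_pos volume x hs, unitVol, finrank_euclideanSpace, Fintype.card_fin,
    ENNReal.rpow_natCast, ENNReal.ofReal_pow hs.le]

theorem volume_Ico_sq (t : ℝ) {s : ℝ} (hs : 0 < s) :
    volume (Ico t (t + s ^ 2)) = ENNReal.ofReal s ^ (2 : ℝ) := by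
  rw [Real.volume_Ico, add_sub_cancel_left, ENNReal.ofReal_pow hs.le]
  exact (ENNReal.rpow_natCast _ 2).symm

/-- The integral of `‖f‖` over the cylinder `[-4δ², 5δ²) × B_{3δ}(x)`, which is large enough for
all estimates at scale `δ` near the point `(0, x)`. -/
noncomputable def cylMass (f : Z d → F) (δ : ℝ) (x : E d) : ℝ≥0∞ :=
  ∫⁻ z in cylinder (3 * δ) (-(4 * δ ^ 2), x), ‖f z‖ₑ

theorem measurableSet_cylinder (ρ : ℝ) (z : Z d) : MeasurableSet (cylinder ρ z) :=
  measurableSet_Ico.prod Metric.isOpen_ball.measurableSet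

theorem cylMass_eq {f : Z d → F} {G : Z d → ℝ≥0∞} (hG : Measurable G)
    (h : (fun z => ‖f z‖ₑ) =ᵐ[volume] G) (δ : ℝ) (x : E d) :
    cylMass f δ x = ∫⁻ y in Metric.ball x (3 * δ),
      ∫⁻ t in Ico (-(4 * δ ^ 2)) (-(4 * δ ^ 2) + (3 * δ) ^ 2), G (t, y) := by
  unfold cylMass cylinder
  rw [lintegral_congr_ae (ae_restrict_of_ae h), Measure.volume_eq_prod,
    setLIntegral_prod _ hG.aemeasurable, lintegral_lintegral_swap]
  exact hG.aemeasurable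

theorem lpqNorm_cylinder_le {p q β : ℝ} (hp : 1 < p) (hq : 1 < q) (f : Z d → F) {ρ : ℝ}
    (hρ : 0 < ρ) (hρ1 : ρ ≤ 1) (z : Z d) :
    lpqNorm p q ((cylinder ρ z).indicator f) ≤
      ENNReal.ofReal ρ ^ (d / p + 2 / q - β) * unitVol d ^ (1 / p) * morreyNorm p q β f := by
  have hp0 : 0 < p := by linarith
  have hq0 : 0 < q := by linarith
  set R := ENNReal.ofReal ρ with hR
  have hR0 : R ≠ 0 := by simpa [hR] using hρ
  have hRt : R ≠ ⊤ := ENNReal.ofReal_ne_top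
  have hV : lpqNorm p q ((cylinder ρ z).indicator (fun _ => (1 : ℝ))) =
      R ^ (d / p + 2 / q) * unitVol d ^ (1 / p) := by
    unfold cylinder
    rw [lpqNorm_indicator_prod hp0 hq0 measurableSet_Ico Metric.isOpen_ball.measurableSet]
    simp only [enorm_one]
    rw [boxNorm_const hp0 hq0, volume_ball_eq _ hρ, volume_Ico_sq _ hρ,
      ENNReal.mul_rpow_of_nonneg _ _ (by positivity), ← ENNReal.rpow_mul, ← ENNReal.rpow_mul,
      ← mul_assoc, ← ENNReal.rpow_add _ _ hR0 hRt]
    congr 2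
    ring
  have hV0 : R ^ (d / p + 2 / q) * unitVol d ^ (1 / p) ≠ 0 :=
    mul_ne_zero (by simp [ENNReal.rpow_eq_zero_iff, hR0, hRt])
      (by simp [ENNReal.rpow_eq_zero_iff, unitVol_ne_zero, unitVol_ne_top])
  have hVt : R ^ (d / p + 2 / q) * unitVol d ^ (1 / p) ≠ ⊤ :=
    ENNReal.mul_ne_top (ENNReal.rpow_ne_top_of_nonneg (by positivity) hRt)
      (ENNReal.rpow_ne_top_of_nonneg (by positivity) (unitVol_ne_top d))
  have h1 : R ^ β * avgNorm p q (cylinder ρ z) f ≤ morreyNorm p q β f := by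
    rw [hR, ENNReal.ofReal_rpow_of_pos hρ]
    unfold morreyNorm
    exact le_iSup_of_le ρ (le_iSup_of_le ⟨hρ, hρ1⟩ (le_iSup_of_le z le_rfl))
  unfold avgNorm at h1
  rw [hV] at h1
  set L := lpqNorm p q ((cylinder ρ z).indicator f)
  calc L = (L / (R ^ (d / p + 2 / q) * unitVol d ^ (1 / p))) *
        (R ^ (d / p + 2 / q) * unitVol d ^ (1 / p)) := (ENNReal.div_mul_cancel hV0 hVt).symm
    _ = R ^ (d / p + 2 / q - β) * unitVol d ^ (1 / p) *
        (R ^ β * (L / (R ^ (d / p + 2 / q) * unitVol d ^ (1 / p)))) := by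
        have e : R ^ (d / p + 2 / q) = R ^ (d / p + 2 / q - β) * R ^ β := by
          rw [← ENNReal.rpow_add _ _ hR0 hRt, sub_add_cancel]
        set X := L / (R ^ (d / p + 2 / q) * unitVol d ^ (1 / p))
        rw [e]
        ring
    _ ≤ _ := by gcongr

theorem cylMass_le {p q β : ℝ} (hp : 1 < p) (hq : 1 < q) {f : Z d → F}
    (hf : AEStronglyMeasurable f volume) {δ : ℝ} (hδ : 0 < δ) (hδ1 : 3 * δ ≤ 1) (x : E d) :
    cylMass f δ x ≤ unitVol d * ENNReal.ofReal (3 * δ) ^ (d + 2 - β) * morreyNorm p q β f := by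
  have hp0 : 0 < p := by linarith
  have hq0 : 0 < q := by linarith
  obtain ⟨G, hG, hfG⟩ := exists_measurable_enorm hf
  have h3 : 0 < 3 * δ := by linarith
  rw [cylMass_eq hG hfG]
  have h1 := lintegral_box_le hp hq (I := Ico (-(4 * δ ^ 2)) (-(4 * δ ^ 2) + (3 * δ) ^ 2))
    (B := Metric.ball x (3 * δ)) measure_ball_lt_top.ne hG
  have h2 := lpqNorm_cylinder_le (β := β) hp hq f h3 hδ1 (-(4 * δ ^ 2), x)
  rw [cylinder, lpqNorm_indicator_prod hp0 hq0 measurableSet_Ico Metric.isOpen_ball.measurableSet,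
    boxNorm_congr hfG] at h2
  rw [volume_ball_eq x h3, volume_Ico_sq _ h3] at h1
  set R := ENNReal.ofReal (3 * δ) with hR
  have hR0 : R ≠ 0 := by simpa [hR] using hδ
  have hRt : R ≠ ⊤ := ENNReal.ofReal_ne_top
  have hp1 : 1 / p < 1 := by rw [div_lt_one hp0]; exact hp
  refine h1.trans ((mul_le_mul' le_rfl (mul_le_mul' le_rfl h2)).trans (le_of_eq ?_))
  rw [ENNReal.mul_rpow_of_nonneg _ _ (by linarith : 0 ≤ 1 - 1 / p), ← ENNReal.rpow_mul,
    ← ENNReal.rpow_mul]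
  calc _ = (R ^ ((d : ℝ) * (1 - 1 / p)) * R ^ ((2 : ℝ) * (1 - 1 / q)) * R ^ (d / p + 2 / q - β)) *
        (unitVol d ^ (1 - 1 / p) * unitVol d ^ (1 / p)) * morreyNorm p q β f := by ring
    _ = _ := by
        rw [← ENNReal.rpow_add _ _ hR0 hRt, ← ENNReal.rpow_add _ _ hR0 hRt,
          ← ENNReal.rpow_add _ _ (unitVol_ne_zero d) (unitVol_ne_top d),
          sub_add_cancel, ENNReal.rpow_one, mul_comm (unitVol d)]
        congr 3
        field_simp
        ring

/-- `L_r` bound for `cylMass f δ` over an arbitrary bounded set `A`, by the mixed norm of `f` over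
a cylinder containing all the cylinders that occur. -/
theorem lintegral_cylMass_rpow_le {p q r : ℝ} (hp : 1 < p) (hq : 1 < q) (hr : p ≤ r) {f : Z d → F}
    (hf : AEStronglyMeasurable f volume) {δ : ℝ} (hδ : 0 < δ) {A B : Set (E d)} {I : Set ℝ}
    (hI : MeasurableSet I) (hA : MeasurableSet A) (hB : MeasurableSet B) (hBf : volume B ≠ ⊤)
    (hAB : ∀ x ∈ A, Metric.ball x (3 * δ) ⊆ B)
    (hIδ : Ico (-(4 * δ ^ 2)) (-(4 * δ ^ 2) + (3 * δ) ^ 2) ⊆ I) :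
    (∫⁻ x in A, cylMass f δ x ^ r) ^ (1 / r) ≤
      unitVol d ^ (1 - 1 / p + 1 / r) *
        ENNReal.ofReal (3 * δ) ^ (d + 2 - (d / p + 2 / q - d / r)) *
          lpqNorm p q ((I ×ˢ B).indicator f) := by
  have hp0 : 0 < p := by linarith
  have hq0 : 0 < q := by linarith
  have hr0 : 0 < r := by linarith
  have h3 : 0 < 3 * δ := by linarith
  obtain ⟨G, hG, hfG⟩ := exists_measurable_enorm hf
  simp only [cylMass_eq hG hfG]
  have h1 := lintegral_rpow_movingBall_le hp hq hr hA hBf hAB hG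
    (I := Ico (-(4 * δ ^ 2)) (-(4 * δ ^ 2) + (3 * δ) ^ 2))
  have h2 : boxNorm p q (Ico (-(4 * δ ^ 2)) (-(4 * δ ^ 2) + (3 * δ) ^ 2)) B G ≤
      lpqNorm p q ((I ×ˢ B).indicator f) := by
    rw [lpqNorm_indicator_prod hp0 hq0 hI hB, boxNorm_congr hfG]
    unfold boxNorm
    exact ENNReal.rpow_le_rpow (lintegral_mono_set hIδ) (by positivity)
  rw [volume_ball_eq 0 h3, volume_Ico_sq _ h3] at h1
  set R := ENNReal.ofReal (3 * δ) with hR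
  have hR0 : R ≠ 0 := by simpa [hR] using hδ
  have hRt : R ≠ ⊤ := ENNReal.ofReal_ne_top
  have hp1 : 1 / p < 1 := by rw [div_lt_one hp0]; exact hp
  refine h1.trans ((mul_le_mul' le_rfl (mul_le_mul' le_rfl h2)).trans (le_of_eq ?_))
  have hr1 : 0 < 1 / r := by positivity
  rw [ENNReal.mul_rpow_of_nonneg _ _ (by linarith : 0 ≤ 1 - 1 / p + 1 / r), ← ENNReal.rpow_mul,
    ← ENNReal.rpow_mul]
  calc _ = unitVol d ^ (1 - 1 / p + 1 / r) * (R ^ ((d : ℝ) * (1 - 1 / p + 1 / r)) *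
        R ^ ((2 : ℝ) * (1 - 1 / q))) * lpqNorm p q ((I ×ˢ B).indicator f) := by ring
    _ = _ := by
        rw [← ENNReal.rpow_add _ _ hR0 hRt]
        congr 3
        field_simp
        ring

theorem laverage_rpow_le_of_le {r : ℝ} (hr : 0 < r) {x : E d} {ρ : ℝ} {h : E d → ℝ≥0∞}
    {c : ℝ≥0∞} (hc : ∀ y, h y ≤ c) :
    (⨍⁻ y in Metric.ball x ρ, h y ^ r ∂volume) ^ (1 / r) ≤ c := by
  have h1 : ⨍⁻ y in Metric.ball x ρ, h y ^ r ∂volume ≤ c ^ r := by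
    rw [setLAverage_eq]
    refine ENNReal.div_le_of_le_mul ?_
    calc ∫⁻ y in Metric.ball x ρ, h y ^ r ≤ ∫⁻ _y in Metric.ball x ρ, c ^ r :=
          lintegral_mono fun y => ENNReal.rpow_le_rpow (hc y) hr.le
      _ = c ^ r * volume (Metric.ball x ρ) := by simp
  calc _ ≤ (c ^ r) ^ (1 / r) := ENNReal.rpow_le_rpow h1 (by positivity)
    _ = c := by rw [← ENNReal.rpow_mul, mul_one_div_cancel hr.ne', ENNReal.rpow_one]

/-- The basic estimate for averages of `cylMass f δ` over balls of radius `ρ`, both for `ρ ≤ δ`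
(where the average is bounded by the supremum) and for `δ ≤ ρ`. The constant does not depend
on `r`. -/
theorem laverage_cylMass_le {p q r β : ℝ} (hp : 1 < p) (hq : 1 < q) (hr : p ≤ r) (hβ : 0 ≤ β)
    {f : Z d → F} (hf : AEStronglyMeasurable f volume) {δ ρ : ℝ} (hδ : 0 < δ) (hδ1 : 3 * δ ≤ 1)
    (hρ : 0 < ρ) (hρ1 : ρ ≤ 1 / 4) (x : E d) :
    (⨍⁻ y in Metric.ball x ρ, cylMass f δ y ^ r ∂volume) ^ (1 / r) ≤
      unitVol d * 12 ^ ((d : ℝ) + 2) *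
        ENNReal.ofReal δ ^ (d + 2 - (d / p + 2 / q - d / r)) *
        ENNReal.ofReal (max ρ δ) ^ (d / p + 2 / q - d / r - β) * morreyNorm p q β f := by
  have hp0 : 0 < p := by linarith
  have hq0 : 0 < q := by linarith
  have hr0 : 0 < r := by linarith
  set D := ENNReal.ofReal δ with hD
  have hD0 : D ≠ 0 := by simpa [hD] using hδ
  have hDt : D ≠ ⊤ := ENNReal.ofReal_ne_top
  have h3D : ENNReal.ofReal (3 * δ) = 3 * D := by
    rw [ENNReal.ofReal_mul (by norm_num)]; simp [hD]
  have hd : (0 : ℝ) ≤ d := Nat.cast_nonneg d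
  have hκ : 0 ≤ d / p + 2 / q - d / r := by
    have : d / r ≤ d / p := div_le_div_of_nonneg_left hd hp0 hr
    have : 0 < 2 / q := by positivity
    linarith
  have h12 : (12 : ℝ≥0∞) ^ ((d : ℝ) + 2) = 3 ^ ((d : ℝ) + 2) * 4 ^ ((d : ℝ) + 2) := by
    rw [← ENNReal.mul_rpow_of_nonneg _ _ (by positivity)]; norm_num
  rcases le_total ρ δ with h | h
  · rw [max_eq_right h]
    refine (laverage_rpow_le_of_le hr0 fun y => cylMass_le (β := β) hp hq hf hδ hδ1 y).trans ?_
    rw [h3D, ENNReal.mul_rpow_of_ne_top (by simp) hDt]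
    calc unitVol d * (3 ^ ((d : ℝ) + 2 - β) * D ^ ((d : ℝ) + 2 - β)) * morreyNorm p q β f
        = unitVol d * (3 ^ ((d : ℝ) + 2 - β) * 1) * (D ^ (d + 2 - (d / p + 2 / q - d / r)) *
          D ^ (d / p + 2 / q - d / r - β)) * morreyNorm p q β f := by
          rw [← ENNReal.rpow_add _ _ hD0 hDt]
          rw [show d + 2 - (d / p + 2 / q - d / r) + (d / p + 2 / q - d / r - β) = d + 2 - β by ring]
          ring
      _ ≤ unitVol d * (3 ^ ((d : ℝ) + 2) * 4 ^ ((d : ℝ) + 2)) *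
          (D ^ (d + 2 - (d / p + 2 / q - d / r)) *
          D ^ (d / p + 2 / q - d / r - β)) * morreyNorm p q β f := by
          gcongr
          · norm_num
          · linarith
          · exact ENNReal.one_le_rpow (by norm_num) (by positivity)
      _ = _ := by rw [h12]; ring
  · rw [max_eq_left h]
    -- all cylinders that occur lie in one cylinder of radius `4 * ρ ≤ 1`
    set R := ENNReal.ofReal ρ with hR
    have hR0 : R ≠ 0 := by simpa [hR] using hρ
    have hRt : R ≠ ⊤ := ENNReal.ofReal_ne_top
    have h4R : ENNReal.ofReal (4 * ρ) = 4 * R := by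
      rw [ENNReal.ofReal_mul (by norm_num)]; simp [hR]
    have h4 : 0 < 4 * ρ := by linarith
    have h1 := lintegral_cylMass_rpow_le hp hq hr hf hδ
      (A := Metric.ball x ρ) (B := Metric.ball x (4 * ρ))
      (I := Ico (-(4 * δ ^ 2)) (-(4 * δ ^ 2) + (4 * ρ) ^ 2)) measurableSet_Ico
      Metric.isOpen_ball.measurableSet Metric.isOpen_ball.measurableSet measure_ball_lt_top.ne
      (fun y hy => Metric.ball_subset_ball' (by
        rw [Metric.mem_ball] at hy; linarith))
      (Ico_subset_Ico_right (by nlinarith))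
    have h2 := lpqNorm_cylinder_le (β := β) hp hq f h4 (by linarith) (-(4 * δ ^ 2), x)
    rw [cylinder] at h2
    rw [setLAverage_eq, ENNReal.div_rpow_of_nonneg _ _ (by positivity), volume_ball_eq x hρ]
    have hVt : (R ^ (d : ℝ) * unitVol d) ^ (1 / r) ≠ ⊤ :=
      ENNReal.rpow_ne_top_of_nonneg (by positivity) (ENNReal.mul_ne_top
        (ENNReal.rpow_ne_top_of_nonneg (by positivity) hRt) (unitVol_ne_top d))
    refine ENNReal.div_le_of_le_mul (h1.trans ((mul_le_mul' le_rfl h2).trans ?_))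
    rw [h3D, h4R, ENNReal.mul_rpow_of_ne_top (by simp) hDt, ENNReal.mul_rpow_of_ne_top (by simp) hRt,
      ENNReal.mul_rpow_of_nonneg _ _ (by positivity : 0 ≤ 1 / r), ← ENNReal.rpow_mul, h12]
    have e1 : unitVol d ^ (1 - 1 / p + 1 / r) * unitVol d ^ (1 / p) =
        unitVol d * unitVol d ^ (1 / r) := by
      rw [← ENNReal.rpow_add _ _ (unitVol_ne_zero d) (unitVol_ne_top d)]
      conv_rhs => rw [← ENNReal.rpow_one (unitVol d), ← ENNReal.rpow_mul,
        ← ENNReal.rpow_add _ _ (unitVol_ne_zero d) (unitVol_ne_top d)]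
      congr 1
      ring
    have e2 : R ^ (d / p + 2 / q - β) =
        R ^ (d / p + 2 / q - d / r - β) * R ^ ((d : ℝ) * (1 / r)) := by
      rw [← ENNReal.rpow_add _ _ hR0 hRt]
      congr 1
      ring
    have hq2 : 2 / q ≤ 2 := by rw [div_le_iff₀ hq0]; linarith
    have hp2 : d / p ≤ (d : ℝ) := div_le_self hd hp.le
    set κ := d / p + 2 / q - d / r
    calc _ = (unitVol d ^ (1 - 1 / p + 1 / r) * unitVol d ^ (1 / p)) *
          (3 ^ ((d : ℝ) + 2 - κ) * 4 ^ (d / p + 2 / q - β)) * D ^ ((d : ℝ) + 2 - κ) *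
          R ^ (d / p + 2 / q - β) * morreyNorm p q β f := by ring
      _ ≤ (unitVol d ^ (1 - 1 / p + 1 / r) * unitVol d ^ (1 / p)) *
          (3 ^ ((d : ℝ) + 2) * 4 ^ ((d : ℝ) + 2)) * D ^ ((d : ℝ) + 2 - κ) *
          R ^ (d / p + 2 / q - β) * morreyNorm p q β f := by
          gcongr
          · norm_num
          · linarith
          · norm_num
          · linarith
      _ = _ := by rw [e1, e2]; ring

/-- Averages over balls of radius `ρ` are controlled by averages over balls of radius `ρ / 4`: for
`z ∈ B_ρ(x)` the set of the `y ∈ B_ρ(x)` with `z ∈ B_{ρ/4}(y)` contains a ball of radius `ρ / 8`. -/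
theorem laverage_rpow_le_quarter {r : ℝ} (hr : 1 ≤ r) {ρ : ℝ} (hρ : 0 < ρ) (x : E d)
    {h : E d → ℝ≥0∞} (hm : Measurable h) {c : ℝ≥0∞}
    (hc : ∀ y, (⨍⁻ w in Metric.ball y (ρ / 4), h w ^ r ∂volume) ^ (1 / r) ≤ c) :
    (⨍⁻ w in Metric.ball x ρ, h w ^ r ∂volume) ^ (1 / r) ≤ 2 ^ d * c := by
  have hr0 : 0 < r := by linarith
  have hmb : ∀ (y : E d) s, MeasurableSet (Metric.ball y s) :=
    fun y s => Metric.isOpen_ball.measurableSet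
  have hvol : ∀ (y : E d) s, volume (Metric.ball y s) = volume (Metric.ball (0 : E d) s) :=
    fun y s => Measure.addHaar_ball_center volume y s
  have hc' : ∀ y, ∫⁻ w in Metric.ball y (ρ / 4), h w ^ r ≤
      c ^ r * volume (Metric.ball (0 : E d) (ρ / 4)) := by
    intro y
    have h1 : ⨍⁻ w in Metric.ball y (ρ / 4), h w ^ r ∂volume ≤ c ^ r := by
      have := ENNReal.rpow_le_rpow (hc y) hr0.le
      rwa [← ENNReal.rpow_mul, one_div_mul_cancel hr0.ne', ENNReal.rpow_one] at this
    rw [setLAverage_eq, hvol, ENNReal.div_le_iff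
      (Metric.measure_ball_pos volume _ (by positivity)).ne' measure_ball_lt_top.ne] at h1
    exact h1
  have hmeas : Measurable fun w : E d × E d =>
      (Metric.ball w.1 (ρ / 4)).indicator (fun y => h y ^ r) w.2 := by
    have : (fun w : E d × E d => (Metric.ball w.1 (ρ / 4)).indicator (fun y => h y ^ r) w.2) =
        {w : E d × E d | dist w.2 w.1 < ρ / 4}.indicator (fun w => h w.2 ^ r) := by
      ext w; simp [indicator, Metric.mem_ball]
    rw [this]
    refine ((hm.comp measurable_snd).pow_const r).indicator ?_
    exact measurableSet_lt (measurable_snd.dist measurable_fst) measurable_const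
  have hinner : ∀ z ∈ Metric.ball x ρ, volume (Metric.ball (0 : E d) (ρ / 8)) * h z ^ r ≤
      ∫⁻ y in Metric.ball x ρ, (Metric.ball y (ρ / 4)).indicator (fun y => h y ^ r) z := by
    intro z hz
    have hsub : Metric.ball (z + (1 / 8 : ℝ) • (x - z)) (ρ / 8) ⊆
        Metric.ball x ρ ∩ Metric.ball z (ρ / 4) := by
      rw [Metric.mem_ball, dist_comm, dist_eq_norm] at hz
      refine subset_inter (Metric.ball_subset_ball' ?_) (Metric.ball_subset_ball' ?_)
      · have : z + (1 / 8 : ℝ) • (x - z) - x = (-(7 / 8) : ℝ) • (x - z) := by module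
        rw [dist_eq_norm, this, norm_smul, Real.norm_eq_abs, abs_neg, abs_of_pos (by norm_num)]
        linarith
      · rw [dist_eq_norm, add_sub_cancel_left, norm_smul, Real.norm_of_nonneg (by norm_num)]
        linarith
    calc volume (Metric.ball (0 : E d) (ρ / 8)) * h z ^ r
        ≤ volume (Metric.ball x ρ ∩ Metric.ball z (ρ / 4)) * h z ^ r :=
          mul_le_mul' ((hvol _ _).symm.le.trans (measure_mono hsub)) le_rfl
      _ = ∫⁻ _y in Metric.ball x ρ ∩ Metric.ball z (ρ / 4), h z ^ r := by
          rw [lintegral_const, Measure.restrict_apply_univ, mul_comm]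
      _ = ∫⁻ y in Metric.ball x ρ, (Metric.ball z (ρ / 4)).indicator (fun _ => h z ^ r) y := by
          rw [lintegral_indicator (hmb _ _), Measure.restrict_restrict (hmb _ _), inter_comm]
      _ = _ := by
          refine lintegral_congr fun y => ?_
          simp [indicator, Metric.mem_ball, dist_comm]
  have hmul : volume (Metric.ball (0 : E d) (ρ / 8)) * ∫⁻ z in Metric.ball x ρ, h z ^ r ≤
      c ^ r * volume (Metric.ball (0 : E d) (ρ / 4)) * volume (Metric.ball x ρ) := by
    calc volume (Metric.ball (0 : E d) (ρ / 8)) * ∫⁻ z in Metric.ball x ρ, h z ^ r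
        = ∫⁻ z in Metric.ball x ρ, volume (Metric.ball (0 : E d) (ρ / 8)) * h z ^ r :=
          (lintegral_const_mul _ (hm.pow_const r)).symm
      _ ≤ ∫⁻ z in Metric.ball x ρ, ∫⁻ y in Metric.ball x ρ,
            (Metric.ball y (ρ / 4)).indicator (fun y => h y ^ r) z :=
          setLIntegral_mono' (hmb _ _) hinner
      _ = ∫⁻ y in Metric.ball x ρ, ∫⁻ z in Metric.ball x ρ,
            (Metric.ball y (ρ / 4)).indicator (fun y => h y ^ r) z := by
          rw [lintegral_lintegral_swap]
          exact (hmeas.comp measurable_swap).aemeasurable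
      _ ≤ ∫⁻ _y in Metric.ball x ρ, c ^ r * volume (Metric.ball (0 : E d) (ρ / 4)) := by
          refine lintegral_mono fun y => ?_
          refine (setLIntegral_le_lintegral _ _).trans ?_
          rw [lintegral_indicator (hmb _ _)]
          exact hc' y
      _ = _ := by rw [lintegral_const, Measure.restrict_apply_univ]
  have hquarter : volume (Metric.ball (0 : E d) (ρ / 4)) =
      2 ^ d * volume (Metric.ball (0 : E d) (ρ / 8)) := by
    rw [volume_ball_eq 0 (by positivity), volume_ball_eq 0 (by positivity),
      show ρ / 4 = 2 * (ρ / 8) by ring, ENNReal.ofReal_mul (by norm_num),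
      ENNReal.mul_rpow_of_nonneg _ _ (Nat.cast_nonneg d), ENNReal.rpow_natCast]
    simp only [ENNReal.ofReal_ofNat, mul_assoc]
  have hfin : ⨍⁻ w in Metric.ball x ρ, h w ^ r ∂volume ≤ 2 ^ d * c ^ r := by
    rw [setLAverage_eq, ENNReal.div_le_iff
      (Metric.measure_ball_pos volume _ hρ).ne' measure_ball_lt_top.ne]
    rw [hquarter] at hmul
    refine (ENNReal.mul_le_mul_iff_right (a := volume (Metric.ball (0 : E d) (ρ / 8)))
      (Metric.measure_ball_pos volume _ (by positivity)).ne' measure_ball_lt_top.ne).1 ?_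
    refine hmul.trans (le_of_eq ?_)
    ring
  calc _ ≤ ((2 : ℝ≥0∞) ^ d * c ^ r) ^ (1 / r) := ENNReal.rpow_le_rpow hfin (by positivity)
    _ = ((2 : ℝ≥0∞) ^ d) ^ (1 / r) * c := by
        rw [ENNReal.mul_rpow_of_nonneg _ _ (by positivity), ← ENNReal.rpow_mul,
          mul_one_div_cancel hr0.ne', ENNReal.rpow_one]
    _ ≤ ((2 : ℝ≥0∞) ^ d) ^ (1 : ℝ) * c := by
        gcongr
        · exact one_le_pow₀ (by norm_num)
        · rw [div_le_one hr0]; exact hr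
    _ = 2 ^ d * c := by rw [ENNReal.rpow_one]

end CylMass

/-! ### A Poincaré inequality for smooth functions -/

section Poincare

theorem enorm_sub_le_lintegral {φ φ' : ℝ → ℝ} (h : ∀ t, HasDerivAt φ (φ' t) t)
    (hc : Continuous φ') {J : Set ℝ} {a b : ℝ} (hJ : uIoc a b ⊆ J) :
    ‖φ b - φ a‖ₑ ≤ ∫⁻ t in J, ‖φ' t‖ₑ := by
  rw [← intervalIntegral.integral_eq_sub_of_hasDerivAt (fun t _ => h t)
    (hc.intervalIntegrable _ _)]
  have : ‖∫ t in a..b, φ' t‖ₑ = ‖∫ t in uIoc a b, φ' t‖ₑ := by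
    rw [← ofReal_norm, ← ofReal_norm,
      intervalIntegral.norm_integral_eq_norm_integral_uIoc]
  rw [this]
  exact (enorm_integral_le_lintegral_enorm _).trans (lintegral_mono_set hJ)

theorem enorm_taylor_le_lintegral {φ φ' φ'' : ℝ → ℝ} (h : ∀ t, HasDerivAt φ (φ' t) t)
    (h' : ∀ t, HasDerivAt φ' (φ'' t) t) (hc : Continuous φ'') :
    ‖φ 1 - φ 0 - φ' 0‖ₑ ≤ ∫⁻ t in Icc (0 : ℝ) 1, ‖φ'' t‖ₑ := by
  obtain ⟨ξ, hξ, he⟩ := exists_hasDerivAt_eq_slope φ φ' (zero_lt_one' ℝ)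
    (fun t _ => (h t).continuousAt.continuousWithinAt) (fun t _ => h t)
  rw [sub_zero, div_one] at he
  rw [← he]
  refine enorm_sub_le_lintegral h' hc ?_
  rw [uIoc_of_le hξ.1.le]
  exact fun t ht => ⟨ht.1.le, ht.2.trans hξ.2.le⟩

variable {d : ℕ}

theorem lintegral_comp_add_smul (c : E d) {θ : ℝ} (hθ : 0 < θ) {h : E d → ℝ≥0∞}
    (hm : Measurable h) :
    ∫⁻ y, h (c + θ • y) = ENNReal.ofReal ((θ ^ d)⁻¹) * ∫⁻ y, h y := by
  have h1 : ∫⁻ y, h (c + θ • y) = ∫⁻ y, h (c + y) ∂(Measure.map (θ • ·) volume) := by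
    exact (lintegral_map (f := fun y => h (c + y)) (hm.comp (measurable_const_add c))
      (measurable_const_smul θ)).symm
  rw [h1, Measure.map_addHaar_smul volume hθ.ne', lintegral_smul_measure, finrank_euclideanSpace,
    Fintype.card_fin, abs_of_pos (by positivity), lintegral_add_left_eq_self, smul_eq_mul]

/-- Integrating a function over the points of all segments with endpoints in a convex set costs
at most a factor `2 ^ d`: at each time one of the two endpoints moves the point with speed at
least `1 / 2`. -/
theorem lintegral_segments_le {B : Set (E d)} (hB : Convex ℝ B) (hBm : MeasurableSet B)
    {h : E d → ℝ≥0∞} (hm : Measurable h) {θ : ℝ} (hθ : θ ∈ Icc (0 : ℝ) 1) :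
    ∫⁻ y₀ in B, ∫⁻ y in B, h (y₀ + θ • (y - y₀)) ≤ 2 ^ d * volume B * ∫⁻ y in B, h y := by
  have key : ∀ (s : ℝ), 1 / 2 ≤ s → s ≤ 1 → ∀ c ∈ B,
      ∫⁻ y in B, h ((1 - s) • c + s • y) ≤ 2 ^ d * ∫⁻ y in B, h y := by
    intro s hs hs1 c hc
    calc ∫⁻ y in B, h ((1 - s) • c + s • y)
        ≤ ∫⁻ y in B, B.indicator h ((1 - s) • c + s • y) := by
          refine setLIntegral_mono' hBm fun y hy => ?_
          rw [indicator_of_mem]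
          exact hB hc hy (by linarith) (by linarith) (by ring)
      _ ≤ ∫⁻ y, B.indicator h ((1 - s) • c + s • y) := setLIntegral_le_lintegral _ _
      _ = ENNReal.ofReal ((s ^ d)⁻¹) * ∫⁻ y in B, h y := by
          rw [lintegral_comp_add_smul _ (by linarith) (hm.indicator hBm), lintegral_indicator hBm]
      _ ≤ _ := by
          gcongr
          rw [show (2 : ℝ≥0∞) ^ d = ENNReal.ofReal (2 ^ d) by
            rw [ENNReal.ofReal_pow (by norm_num)]; simp]
          apply ENNReal.ofReal_le_ofReal
          rw [← inv_pow]
          refine pow_le_pow_left₀ (by positivity) ?_ _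
          rw [inv_le_comm₀ (by linarith) (by norm_num)]
          linarith
  have hfin : ∀ g : E d → ℝ≥0∞, (∀ c ∈ B, g c ≤ 2 ^ d * ∫⁻ y in B, h y) →
      ∫⁻ c in B, g c ≤ 2 ^ d * volume B * ∫⁻ y in B, h y := by
    intro g hg
    calc ∫⁻ c in B, g c ≤ ∫⁻ _c in B, 2 ^ d * ∫⁻ y in B, h y := setLIntegral_mono' hBm hg
      _ = _ := by rw [lintegral_const, Measure.restrict_apply_univ]; ring
  rcases le_total (1 / 2) θ with h2 | h2
  · refine hfin _ fun c hc => ?_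
    have := key θ h2 hθ.2 c hc
    convert this using 4 with y
    module
  · rw [lintegral_lintegral_swap]
    · refine hfin _ fun c hc => ?_
      have := key (1 - θ) (by linarith) (by linarith [hθ.1]) c hc
      convert this using 4 with y
      module
    · refine (hm.comp ?_).aemeasurable
      fun_prop

/-- A kernel `K` supported in the cylinder `I × B_s(x)` and orthogonal to `1` and to the linear
functions of the space variable pairs with a smooth function `v` through `∂_t v` and `D²v` only. One
subtracts from `v` its Taylor polynomial at a point `z₀` and averages over `z₀`. -/
theorem enorm_integral_mul_le_of_contDiff {v : Z d → ℝ} (hv : ContDiff ℝ 2 v) {a b s M : ℝ}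
    (hab : a < b) (hs : 0 < s) (x : E d) {K : Z d → ℝ} (hK : Continuous K)
    (hKc : HasCompactSupport K) (hKM : ∀ z, |K z| ≤ M)
    (hKs : ∀ z, z ∉ Ico a b ×ˢ Metric.ball x s → K z = 0)
    (hK0 : ∫ z, K z = 0) (hK1 : ∀ L : E d →L[ℝ] ℝ, ∫ z, K z * L z.2 = 0)
    {H : Z d → ℝ≥0∞} (hHm : Measurable H)
    (hH : ∀ z e, ‖fderiv ℝ (fun w => fderiv ℝ v w (0, e)) z (0, e)‖ₑ ≤ ‖e‖ₑ ^ 2 * H z) :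
    ‖∫ z, v z * K z‖ₑ ≤ ENNReal.ofReal M *
      (ENNReal.ofReal (b - a) * (∫⁻ z in Ico a b ×ˢ Metric.ball x s, ‖fderiv ℝ v z (1, 0)‖ₑ) +
        2 ^ d * ENNReal.ofReal (2 * s) ^ 2 * ∫⁻ z in Ico a b ×ˢ Metric.ball x s, H z) := by
  set I := Ico a b with hI
  set B := Metric.ball x s with hB
  have hIm : MeasurableSet I := measurableSet_Ico
  have hBm : MeasurableSet B := Metric.isOpen_ball.measurableSet
  have hBc : Convex ℝ B := convex_ball x s
  set W : Z d → ℝ≥0∞ := fun z => ‖fderiv ℝ v z (1, 0)‖ₑ with hW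
  have hfd : Continuous (fderiv ℝ v) := hv.continuous_fderiv (by norm_num)
  have hWm : Measurable W := (hfd.clm_apply continuous_const).enorm.measurable
  have hvd : ∀ z, HasFDerivAt v (fderiv ℝ v z) z := fun z =>
    (hv.differentiable (by norm_num) z).hasFDerivAt
  have hvd2 : ∀ e : E d, ContDiff ℝ 1 (fun w => fderiv ℝ v w (0, e)) := fun e =>
    (hv.fderiv_right (m := 1) (by norm_num)).clm_apply contDiff_const
  -- the remainder splits into an increment in time and a Taylor remainder in space
  set T : E d → ℝ≥0∞ := fun y => ∫⁻ τ in I, W (τ, y) with hT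
  set S : Z d → E d → ℝ≥0∞ := fun z₀ y =>
    ∫⁻ θ in Icc (0 : ℝ) 1, H (z₀.1, z₀.2 + θ • (y - z₀.2)) with hS
  have hR : ∀ z₀ ∈ I ×ˢ B, ∀ z ∈ I ×ˢ B,
      ‖v z - v z₀ - fderiv ℝ v z₀ (0, z.2 - z₀.2)‖ₑ ≤
        T z.2 + ENNReal.ofReal (2 * s) ^ 2 * S z₀ z.2 := by
    rintro ⟨s₀, y₀⟩ hz₀ ⟨t, y⟩ hz
    have e1 : v (t, y) - v (s₀, y₀) - fderiv ℝ v (s₀, y₀) (0, y - y₀) =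
        (v (t, y) - v (s₀, y)) + (v (s₀, y) - v (s₀, y₀) - fderiv ℝ v (s₀, y₀) (0, y - y₀)) := by
      ring
    simp only [e1]
    refine (enorm_add_le _ _).trans (add_le_add ?_ ?_)
    · refine enorm_sub_le_lintegral (φ := fun τ => v (τ, y))
        (φ' := fun τ => fderiv ℝ v (τ, y) (1, 0)) (fun τ => ?_) ?_ ?_
      · have h1 : HasDerivAt (fun τ : ℝ => ((τ, y) : Z d)) (1, 0) τ :=
          (hasDerivAt_id τ).prodMk (hasDerivAt_const τ y)
        exact (hvd (τ, y)).comp_hasDerivAt τ h1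
      · exact (hfd.comp (by fun_prop)).clm_apply continuous_const
      · intro τ hτ
        rcases mem_uIoc.1 hτ with h | h
        · exact ⟨hz₀.1.1.trans h.1.le, h.2.trans_lt hz.1.2⟩
        · exact ⟨hz.1.1.trans h.1.le, h.2.trans_lt hz₀.1.2⟩
    · set e := y - y₀ with he
      have hline : ∀ θ : ℝ, HasDerivAt (fun θ : ℝ => ((s₀, y₀ + θ • e) : Z d)) (0, e) θ := by
        intro θ
        have := ((hasDerivAt_id θ).smul_const e).const_add y₀
        simp only [id, one_smul] at this
        exact (hasDerivAt_const θ s₀).prodMk this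
      have hTay := enorm_taylor_le_lintegral (φ := fun θ => v (s₀, y₀ + θ • e))
        (φ' := fun θ => fderiv ℝ v (s₀, y₀ + θ • e) (0, e))
        (φ'' := fun θ => fderiv ℝ (fun w => fderiv ℝ v w (0, e)) (s₀, y₀ + θ • e) (0, e))
        (fun θ => (hvd _).comp_hasDerivAt θ (hline θ))
        (fun θ => (((hvd2 e).differentiable (by norm_num) _).hasFDerivAt).comp_hasDerivAt θ
          (hline θ))
        ((((hvd2 e).continuous_fderiv (by norm_num)).comp (by fun_prop)).clm_apply
          continuous_const)
      simp only [one_smul, zero_smul, add_zero] at hTay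
      rw [he, add_sub_cancel] at hTay
      refine hTay.trans ?_
      rw [hS, ← lintegral_const_mul]
      · refine lintegral_mono fun θ => (hH _ _).trans ?_
        gcongr
        rw [← ofReal_norm]
        apply ENNReal.ofReal_le_ofReal
        have h1 := hz₀.2
        have h2 := hz.2
        rw [hB, Metric.mem_ball] at h1 h2
        rw [← dist_eq_norm]
        linarith [dist_triangle_right y y₀ x]
      · refine hHm.comp ?_
        fun_prop
  -- pairing with the kernel removes the Taylor polynomial
  have hpair : ∀ z₀ ∈ I ×ˢ B, ‖∫ z, v z * K z‖ₑ ≤ ENNReal.ofReal M *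
      ∫⁻ z in I ×ˢ B, (T z.2 + ENNReal.ofReal (2 * s) ^ 2 * S z₀ z.2) := by
    intro z₀ hz₀
    set L : E d →L[ℝ] ℝ := (fderiv ℝ v z₀).comp (ContinuousLinearMap.inr ℝ ℝ (E d)) with hL
    have hLe : ∀ y, fderiv ℝ v z₀ (0, y) = L y := fun y => by simp [hL]
    have i0 : Integrable K := hK.integrable_of_hasCompactSupport hKc
    have i1 : Integrable fun z => v z * K z :=
      (hv.continuous.mul hK).integrable_of_hasCompactSupport hKc.mul_left
    have i2 : Integrable fun z : Z d => K z * L z.2 :=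
      (hK.mul (L.continuous.comp continuous_snd)).integrable_of_hasCompactSupport hKc.mul_right
    have heq : ∫ z, v z * K z =
        ∫ z, (v z - v z₀ - fderiv ℝ v z₀ (0, z.2 - z₀.2)) * K z := by
      have : ∀ z, (v z - v z₀ - fderiv ℝ v z₀ (0, z.2 - z₀.2)) * K z =
          v z * K z - ((v z₀ - L z₀.2) * K z + K z * L z.2) := by
        intro z
        rw [hLe, map_sub]
        ring
      simp only [this]
      have i3 : Integrable fun z : Z d => (v z₀ - L z₀.2) * K z := i0.const_mul _
      have i4 : Integrable fun z : Z d => (v z₀ - L z₀.2) * K z + K z * L z.2 := i3.add i2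
      rw [integral_sub i1 i4, integral_add i3 i2, integral_const_mul, hK0, hK1]
      simp
    rw [heq]
    refine (enorm_integral_le_lintegral_enorm _).trans ?_
    rw [← lintegral_const_mul' _ _ ENNReal.ofReal_ne_top, ← lintegral_indicator (hIm.prod hBm)]
    refine lintegral_mono fun z => ?_
    by_cases hz : z ∈ I ×ˢ B
    · rw [indicator_of_mem hz, enorm_mul, mul_comm]
      refine mul_le_mul' ?_ (hR z₀ hz₀ z hz)
      rw [← ofReal_norm]
      exact ENNReal.ofReal_le_ofReal (hKM z)
    · rw [hKs z hz]
      simp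
  -- averaging over the base point
  have hvI : volume I = ENNReal.ofReal (b - a) := Real.volume_Ico
  have hQ : volume (I ×ˢ B) = ENNReal.ofReal (b - a) * volume B := by
    rw [Measure.volume_eq_prod, Measure.prod_prod, hvI]
  have hI0 : ENNReal.ofReal (b - a) ≠ 0 := by simpa using hab
  have hB0 : volume B ≠ 0 := (Metric.measure_ball_pos volume x hs).ne'
  have hBt : volume B ≠ ⊤ := measure_ball_lt_top.ne
  have hTm : Measurable T := hWm.lintegral_prod_left'
  have hTm2 : Measurable fun z : Z d => T z.2 := hTm.comp measurable_snd
  have hSm : Measurable fun w : Z d × E d => S w.1 w.2 := by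
    have : Measurable fun w : (Z d × E d) × ℝ =>
        H (w.1.1.1, w.1.1.2 + w.2 • (w.1.2 - w.1.1.2)) := hHm.comp (by fun_prop)
    exact this.lintegral_prod_right'
  have hTint : ∫⁻ z in I ×ˢ B, T z.2 = ENNReal.ofReal (b - a) * ∫⁻ z in I ×ˢ B, W z := by
    rw [Measure.volume_eq_prod, setLIntegral_prod _ hTm2.aemeasurable,
      setLIntegral_prod _ hWm.aemeasurable]
    dsimp only
    rw [lintegral_const, Measure.restrict_apply_univ, hvI,
      mul_comm, lintegral_lintegral_swap]
    exact (hWm.comp measurable_swap).aemeasurable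
  have hSint : ∫⁻ z₀ in I ×ˢ B, ∫⁻ z in I ×ˢ B, S z₀ z.2 ≤
      volume (I ×ˢ B) * (2 ^ d * ∫⁻ z in I ×ˢ B, H z) := by
    have h1 : ∀ z₀ : Z d, ∫⁻ z in I ×ˢ B, S z₀ z.2 =
        ENNReal.ofReal (b - a) * ∫⁻ y in B, S z₀ y := by
      intro z₀
      have : Measurable fun z : Z d => S z₀ z.2 :=
        hSm.comp (measurable_const.prodMk measurable_snd)
      rw [Measure.volume_eq_prod, setLIntegral_prod _ this.aemeasurable]
      dsimp only
      rw [lintegral_const, Measure.restrict_apply_univ, hvI, mul_comm]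
    have h2 : Measurable fun z₀ : Z d => ∫⁻ y in B, S z₀ y := hSm.lintegral_prod_right'
    simp only [h1]
    rw [lintegral_const_mul _ h2, Measure.volume_eq_prod, setLIntegral_prod _ h2.aemeasurable,
      setLIntegral_prod _ hHm.aemeasurable, ← Measure.volume_eq_prod, hQ, mul_assoc]
    refine mul_le_mul' le_rfl ?_
    rw [← lintegral_const_mul, ← lintegral_const_mul]
    · refine lintegral_mono fun s₀ => ?_
      have hHs : Measurable fun y => H (s₀, y) := hHm.comp (measurable_const.prodMk measurable_id)
      calc ∫⁻ y₀ in B, ∫⁻ y in B, S (s₀, y₀) y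
          = ∫⁻ θ in Icc (0 : ℝ) 1, ∫⁻ y₀ in B, ∫⁻ y in B, H (s₀, y₀ + θ • (y - y₀)) := by
            have h3 : ∀ y₀, ∫⁻ y in B, S (s₀, y₀) y =
                ∫⁻ θ in Icc (0 : ℝ) 1, ∫⁻ y in B, H (s₀, y₀ + θ • (y - y₀)) := by
              intro y₀
              rw [lintegral_lintegral_swap]
              refine (hHs.comp ?_).aemeasurable
              fun_prop
            simp only [h3]
            rw [lintegral_lintegral_swap]
            have : Measurable fun w : (E d × ℝ) × E d =>
                H (s₀, w.1.1 + w.1.2 • (w.2 - w.1.1)) := hHs.comp (by fun_prop)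
            exact this.lintegral_prod_right'.aemeasurable
        _ ≤ ∫⁻ _θ in Icc (0 : ℝ) 1, 2 ^ d * volume B * ∫⁻ y in B, H (s₀, y) :=
            setLIntegral_mono' measurableSet_Icc fun θ hθ => lintegral_segments_le hBc hBm hHs hθ
        _ = _ := by
            rw [lintegral_const, Measure.restrict_apply_univ, Real.volume_Icc]
            simp only [sub_zero, ENNReal.ofReal_one, mul_one]
            ring
    · exact (Measurable.lintegral_prod_right' hHm).const_mul _
    · exact Measurable.lintegral_prod_right' hHm
  set Y := ‖∫ z, v z * K z‖ₑ with hY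
  have hfinal : volume (I ×ˢ B) * Y ≤ volume (I ×ˢ B) * (ENNReal.ofReal M *
      (ENNReal.ofReal (b - a) * (∫⁻ z in I ×ˢ B, W z) +
        2 ^ d * ENNReal.ofReal (2 * s) ^ 2 * ∫⁻ z in I ×ˢ B, H z)) := by
    calc volume (I ×ˢ B) * Y = ∫⁻ _z₀ in I ×ˢ B, Y := by
          rw [lintegral_const, Measure.restrict_apply_univ, mul_comm]
      _ ≤ ∫⁻ z₀ in I ×ˢ B, ENNReal.ofReal M *
            ∫⁻ z in I ×ˢ B, (T z.2 + ENNReal.ofReal (2 * s) ^ 2 * S z₀ z.2) :=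
          setLIntegral_mono' (hIm.prod hBm) hpair
      _ = ENNReal.ofReal M * ∫⁻ z₀ in I ×ˢ B, (∫⁻ z in I ×ˢ B, T z.2) +
            ENNReal.ofReal (2 * s) ^ 2 * ∫⁻ z in I ×ˢ B, S z₀ z.2 := by
          rw [lintegral_const_mul' _ _ ENNReal.ofReal_ne_top]
          congr 1
          refine lintegral_congr fun z₀ => ?_
          rw [lintegral_add_left hTm2, lintegral_const_mul']
          exact ENNReal.pow_ne_top ENNReal.ofReal_ne_top
      _ = ENNReal.ofReal M * (volume (I ×ˢ B) * (∫⁻ z in I ×ˢ B, T z.2) +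
            ENNReal.ofReal (2 * s) ^ 2 * ∫⁻ z₀ in I ×ˢ B, ∫⁻ z in I ×ˢ B, S z₀ z.2) := by
          rw [lintegral_add_left measurable_const, lintegral_const, Measure.restrict_apply_univ,
            lintegral_const_mul', mul_comm (∫⁻ z in I ×ˢ B, T z.2)]
          exact ENNReal.pow_ne_top ENNReal.ofReal_ne_top
      _ ≤ ENNReal.ofReal M * (volume (I ×ˢ B) * (ENNReal.ofReal (b - a) * ∫⁻ z in I ×ˢ B, W z) +
            ENNReal.ofReal (2 * s) ^ 2 * (volume (I ×ˢ B) * (2 ^ d * ∫⁻ z in I ×ˢ B, H z))) := by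
          rw [hTint]
          gcongr
      _ = _ := by ring
  refine (ENNReal.mul_le_mul_iff_right ?_ ?_).1 hfinal
  · rw [hQ]; exact mul_ne_zero hI0 hB0
  · rw [hQ]; exact ENNReal.mul_ne_top ENNReal.ofReal_ne_top hBt

end Poincare

/-! ### Convolutions and weak derivatives -/

section Conv

variable {d : ℕ}

instance isAddHaarMeasure_volume : (volume : Measure (Z d)).IsAddHaarMeasure :=
  inferInstanceAs ((volume : Measure ℝ).prod (volume : Measure (E d))).IsAddHaarMeasure

/-- The convolution of real functions on `ℝ^{d+1}`, as in `mollify`. -/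
noncomputable abbrev conv (u k : Z d → ℝ) : Z d → ℝ :=
  convolution u k (ContinuousLinearMap.mul ℝ ℝ) volume

theorem conv_apply (u k : Z d → ℝ) (z : Z d) : conv u k z = ∫ w, u w * k (z - w) := rfl

theorem conv_integrable {u k : Z d → ℝ} (hu : LocallyIntegrable u) (hk : Continuous k)
    (hkc : HasCompactSupport k) (z : Z d) : Integrable fun w => u w * k (z - w) :=
  (hkc.convolutionExists_right (ContinuousLinearMap.mul ℝ ℝ) hu hk z).integrable

theorem contDiff_conv {u k : Z d → ℝ} (hu : LocallyIntegrable u) (hk : ContDiff ℝ ∞ k)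
    (hkc : HasCompactSupport k) : ContDiff ℝ ∞ (conv u k) :=
  hkc.contDiff_convolution_right _ hu hk

theorem continuous_conv {u k : Z d → ℝ} (hu : LocallyIntegrable u) (hk : Continuous k)
    (hkc : HasCompactSupport k) : Continuous (conv u k) :=
  hkc.continuous_convolution_right _ hu hk

theorem hasCompactSupport_fderiv_apply {k : Z d → ℝ} (hkc : HasCompactSupport k) (e : Z d) :
    HasCompactSupport fun w => fderiv ℝ k w e :=
  (hkc.fderiv (𝕜 := ℝ)).comp_left (g := fun A : Z d →L[ℝ] ℝ => A e) rfl

theorem contDiff_fderiv_apply {k : Z d → ℝ} (hk : ContDiff ℝ ∞ k) (e : Z d) :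
    ContDiff ℝ ∞ fun w => fderiv ℝ k w e :=
  (hk.fderiv_right (m := ∞) le_rfl).clm_apply contDiff_const

theorem fderiv_conv {u k : Z d → ℝ} (hu : LocallyIntegrable u) (hk : ContDiff ℝ ∞ k)
    (hkc : HasCompactSupport k) (z e : Z d) :
    fderiv ℝ (conv u k) z e = conv u (fun w => fderiv ℝ k w e) z := by
  rw [(hkc.hasFDerivAt_convolution_right (ContinuousLinearMap.mul ℝ ℝ) hu
    (hk.of_le (by simp)) z).fderiv]
  exact convolution_precompR_apply _ hu (hkc.fderiv (𝕜 := ℝ))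
    (hk.continuous_fderiv (by simp)) z e

/-- A derivative of the kernel can be moved to the function. -/
theorem HasWeakDeriv.conv_fderiv {u v : Z d → ℝ} {e : Z d} (h : HasWeakDeriv u v e)
    {k : Z d → ℝ} (hk : ContDiff ℝ ∞ k) (hkc : HasCompactSupport k) (z : Z d) :
    conv u (fun w => fderiv ℝ k w e) z = conv v k z := by
  have hφ : ContDiff ℝ ∞ fun w => k (z - w) := hk.comp (contDiff_const.sub contDiff_id)
  have hφc : HasCompactSupport fun w => k (z - w) :=
    hkc.comp_homeomorph (Homeomorph.subLeft z)
  have hφ' : ∀ w, fderiv ℝ (fun w => k (z - w)) w e = -fderiv ℝ k (z - w) e := by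
    intro w
    have h1 : HasFDerivAt (fun w => z - w) (-ContinuousLinearMap.id ℝ (Z d)) w := by
      exact (hasFDerivAt_id w).const_sub z
    have h2 := ((hk.differentiable (by simp) (z - w)).hasFDerivAt).comp w h1
    have h3 : fderiv ℝ (fun w => k (z - w)) w =
        (fderiv ℝ k (z - w)).comp (-ContinuousLinearMap.id ℝ (Z d)) := h2.fderiv
    rw [h3]
    simp
  have := h.2.2 _ hφ hφc
  simp only [hφ', mul_neg, integral_neg, neg_inj] at this
  exact this

theorem lintegral_enorm_conv_le {f η : Z d → ℝ} (hf : AEStronglyMeasurable f volume)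
    (hη : Continuous η) (hη1 : ∫⁻ w, ‖η w‖ₑ = 1) {Q Q' : Set (Z d)} (hQ : MeasurableSet Q)
    (hQ' : MeasurableSet Q') (h : ∀ z ∈ Q, ∀ w, η w ≠ 0 → z - w ∈ Q') :
    ∫⁻ z in Q, ‖conv f η z‖ₑ ≤ ∫⁻ z in Q', ‖f z‖ₑ := by
  have hm : AEMeasurable (fun p : Z d × Z d => ‖f p.2 * η (p.1 - p.2)‖ₑ)
      ((volume.restrict Q).prod volume) := by
    refine (AEStronglyMeasurable.mul ?_ ?_).enorm
    · exact hf.comp_snd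
    · exact (hη.comp (continuous_fst.sub continuous_snd)).aestronglyMeasurable
  calc ∫⁻ z in Q, ‖conv f η z‖ₑ ≤ ∫⁻ z in Q, ∫⁻ w, ‖f w * η (z - w)‖ₑ :=
        lintegral_mono fun z => enorm_integral_le_lintegral_enorm _
    _ = ∫⁻ w, ∫⁻ z in Q, ‖f w * η (z - w)‖ₑ := lintegral_lintegral_swap hm
    _ ≤ ∫⁻ w, Q'.indicator (fun w => ‖f w‖ₑ) w := by
        refine lintegral_mono fun w => ?_
        by_cases hw : w ∈ Q'
        · rw [indicator_of_mem hw]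
          simp only [enorm_mul]
          rw [lintegral_const_mul' _ _ enorm_ne_top]
          calc ‖f w‖ₑ * ∫⁻ z in Q, ‖η (z - w)‖ₑ ≤ ‖f w‖ₑ * ∫⁻ z, ‖η (z - w)‖ₑ := by
                gcongr; exact Measure.restrict_le_self
            _ = ‖f w‖ₑ := by
                rw [lintegral_sub_right_eq_self (fun z => ‖η z‖ₑ) w, hη1, mul_one]
        · rw [indicator_of_notMem hw, nonpos_iff_eq_zero, ← nonpos_iff_eq_zero]
          calc ∫⁻ z in Q, ‖f w * η (z - w)‖ₑ = ∫⁻ z in Q, 0 := by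
                refine setLIntegral_congr_fun hQ fun z hz => ?_
                have : η (z - w) = 0 := by
                  by_contra h0
                  exact hw (by simpa using h z hz _ h0)
                simp [this]
            _ ≤ 0 := by simp
    _ = _ := lintegral_indicator hQ' _

theorem tendsto_integral_conv_mul {u K : Z d → ℝ} (hu : LocallyIntegrable u) (hK : Continuous K)
    (hKc : HasCompactSupport K) {φ : ℕ → ContDiffBump (0 : Z d)}
    (hφ : Tendsto (fun n => (φ n).rOut) atTop (𝓝 0)) :
    Tendsto (fun n => ∫ z, conv u ((φ n).normed volume) z * K z) atTop (𝓝 (∫ z, u z * K z)) := by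
  set K' : Z d → ℝ := fun z => K (-z) with hK'
  have hK'c : HasCompactSupport K' := hKc.comp_homeomorph (Homeomorph.neg (Z d))
  have hK'cont : Continuous K' := hK.comp continuous_neg
  have h0 : ∀ f : Z d → ℝ, ∫ z, f z * K z = conv f K' 0 := by
    intro f
    rw [conv_apply]
    simp [hK']
  simp only [h0]
  have hlim := ContDiffBump.convolution_tendsto_right_of_continuous (μ := volume) hφ
    (continuous_conv hu hK'cont hK'c) 0
  refine hlim.congr fun n => ?_
  set η := (φ n).normed volume with hη
  have hηc : HasCompactSupport η := (φ n).hasCompactSupport_normed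
  have hηcont : Continuous η := (φ n).continuous_normed
  have e1 : conv u η = conv η u := by
    rw [conv, ← convolution_flip]
    congr 1
    ext
    simp
  have hun : LocallyIntegrable fun z => ‖u z‖ := fun z => (hu z).norm
  rw [e1]
  exact (convolution_assoc (ContinuousLinearMap.mul ℝ ℝ) (ContinuousLinearMap.mul ℝ ℝ)
    (ContinuousLinearMap.lsmul ℝ ℝ) (ContinuousLinearMap.mul ℝ ℝ)
    (fun a b c => by simp [mul_assoc])
    hηcont.aestronglyMeasurable hu.aestronglyMeasurable hK'cont.aestronglyMeasurable
    (Eventually.of_forall fun y => hηc.convolutionExists_left _ hηcont hu y)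
    (Eventually.of_forall fun y => hK'c.norm.convolutionExists_right _ hun hK'cont.norm y)
    (hηc.norm.convolutionExists_left _ hηcont.norm
      ((hK'c.norm.continuous_convolution_right _ hun hK'cont.norm).locallyIntegrable) 0)).symm

theorem enorm_apply_le {ι : Type*} [Fintype ι] (v : EuclideanSpace ℝ ι) (i : ι) :
    ‖v i‖ₑ ≤ ‖v‖ₑ := by
  rw [← ofReal_norm, ← ofReal_norm]
  exact ENNReal.ofReal_le_ofReal (PiLp.norm_apply_le v i)

theorem eq_sum_spaceDir (e : E d) : ((0, e) : Z d) = ∑ i, e i • spaceDir i := by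
  have h1 : e = ∑ i, e i • EuclideanSpace.single i (1 : ℝ) := by
    ext j
    simp [Finset.sum_apply, Pi.single_apply]
  have h2 : ∀ i, e i • (spaceDir i : Z d) = (0, e i • EuclideanSpace.single i (1 : ℝ)) := by
    intro i; simp [spaceDir]
  simp only [h2]
  ext1
  · simp [Prod.fst_sum]
  · rw [Prod.snd_sum]; exact h1

/-- The second spatial derivatives of a mollification, in terms of the weak derivatives. -/
theorem enorm_fderiv_fderiv_conv_le {u : Z d → ℝ} {Du : Z d → E d}
    {D2u : Z d → EuclideanSpace ℝ (Fin d × Fin d)} (hu : LocallyIntegrable u)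
    (hDu : ∀ i, HasWeakDeriv u (fun z => Du z i) (spaceDir i))
    (hD2u : ∀ i j, HasWeakDeriv (fun z => Du z i) (fun z => D2u z (i, j)) (spaceDir j))
    {η : Z d → ℝ} (hη : ContDiff ℝ ∞ η) (hηc : HasCompactSupport η) (z : Z d) (e : E d) :
    ‖fderiv ℝ (fun w => fderiv ℝ (conv u η) w (0, e)) z (0, e)‖ₑ ≤
      ‖e‖ₑ ^ 2 * ∑ ij : Fin d × Fin d, ‖conv (fun w => D2u w ij) η z‖ₑ := by
  have h1 : ∀ w, fderiv ℝ (conv u η) w (0, e) = ∑ i, e i * conv (fun w => Du w i) η w := by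
    intro w
    rw [eq_sum_spaceDir, map_sum]
    refine Finset.sum_congr rfl fun i _ => ?_
    rw [map_smul, smul_eq_mul, fderiv_conv hu hη hηc, (hDu i).conv_fderiv hη hηc]
  have h2 : ∀ i, fderiv ℝ (conv (fun w => Du w i) η) z (0, e) =
      ∑ j, e j * conv (fun w => D2u w (i, j)) η z := by
    intro i
    rw [eq_sum_spaceDir, map_sum]
    refine Finset.sum_congr rfl fun j _ => ?_
    rw [map_smul, smul_eq_mul, fderiv_conv (hDu i).2.1 hη hηc, (hD2u i j).conv_fderiv hη hηc]
  have h3 : fderiv ℝ (fun w => fderiv ℝ (conv u η) w (0, e)) z (0, e) =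
      ∑ ij : Fin d × Fin d, e ij.1 * e ij.2 * conv (fun w => D2u w ij) η z := by
    simp only [h1]
    have hd : ∀ i, DifferentiableAt ℝ (conv (fun w => Du w i) η) z := fun i =>
      (contDiff_conv (hDu i).2.1 hη hηc).differentiable (by simp) z
    rw [fderiv_fun_sum fun i _ => (hd i).const_mul _]
    rw [_root_.sum_apply, Fintype.sum_prod_type]
    refine Finset.sum_congr rfl fun i _ => ?_
    rw [fderiv_const_mul (hd i), _root_.smul_apply, h2, smul_eq_mul, Finset.mul_sum]
    exact Finset.sum_congr rfl fun j _ => by ring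
  rw [h3, Finset.mul_sum]
  refine (enorm_sum_le _ _).trans (Finset.sum_le_sum fun ij _ => ?_)
  rw [enorm_mul, enorm_mul, sq]
  gcongr
  · exact enorm_apply_le e _
  · exact enorm_apply_le e _

/-- The Poincaré inequality in its final form: a kernel at scale `δ` that is orthogonal to `1` and
to the linear functions of `x` gains a factor `δ²` against `∂_t u` and `D²u`. -/
theorem enorm_conv_le_of_moments {u ut : Z d → ℝ} {Du : Z d → E d}
    {D2u : Z d → EuclideanSpace ℝ (Fin d × Fin d)}
    (hut : HasWeakDeriv u ut (timeDir d))
    (hDu : ∀ i, HasWeakDeriv u (fun z => Du z i) (spaceDir i))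
    (hD2u : ∀ i j, HasWeakDeriv (fun z => Du z i) (fun z => D2u z (i, j)) (spaceDir j))
    {k : Z d → ℝ} (hk : Continuous k) (hkc : HasCompactSupport k) {M : ℝ} (hM : ∀ z, |k z| ≤ M)
    {δ : ℝ} (hδ : 0 < δ) (hks : ∀ z, k z ≠ 0 → -δ ^ 2 ≤ z.1 ∧ z.1 ≤ 0 ∧ ‖z.2‖ ≤ δ)
    (hk0 : ∫ z, k z = 0) (hk1 : ∀ L : E d →L[ℝ] ℝ, ∫ z, k z * L z.2 = 0) (x : E d) :
    ‖conv u k (0, x)‖ₑ ≤ 16 * 2 ^ d * (d ^ 2 + 1) * (ENNReal.ofReal M * ENNReal.ofReal δ ^ 2) *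
      (cylMass ut δ x + cylMass D2u δ x) := by
  set K : Z d → ℝ := fun w => k ((0, x) - w) with hK
  have hKcont : Continuous K := hk.comp (by fun_prop)
  have hKc : HasCompactSupport K := hkc.comp_homeomorph (Homeomorph.subLeft ((0, x) : Z d))
  set Q : Set (Z d) := Ico 0 (2 * δ ^ 2) ×ˢ Metric.ball x (2 * δ) with hQ
  have hQm : MeasurableSet Q := measurableSet_Ico.prod Metric.isOpen_ball.measurableSet
  have hδ2 : 0 < δ ^ 2 := by positivity
  have hKs : ∀ z, z ∉ Q → K z = 0 := by
    intro z hz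
    by_contra h0
    obtain ⟨h1, h2, h3⟩ := hks _ h0
    simp only [Prod.fst_sub, Prod.snd_sub, zero_sub] at h1 h2 h3
    refine hz ⟨⟨by linarith, by linarith⟩, ?_⟩
    rw [Metric.mem_ball, dist_comm, dist_eq_norm]
    linarith
  have hK0 : ∫ z, K z = 0 := by
    rw [hK, integral_sub_left_eq_self (fun z => k z) volume ((0, x) : Z d), hk0]
  have hK1 : ∀ L : E d →L[ℝ] ℝ, ∫ z, K z * L z.2 = 0 := by
    intro L
    have h1 : ∫ z, K z * L z.2 = ∫ z, k z * L (x - z.2) := by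
      rw [← integral_sub_left_eq_self (fun z => K z * L z.2) volume ((0, x) : Z d)]
      simp [hK]
    have i1 : Integrable fun z : Z d => k z * L x :=
      (hk.integrable_of_hasCompactSupport hkc).mul_const _
    have i2 : Integrable fun z : Z d => k z * L z.2 :=
      (hk.mul (L.continuous.comp continuous_snd)).integrable_of_hasCompactSupport hkc.mul_right
    rw [h1]
    simp only [map_sub, mul_sub]
    rw [integral_sub i1 i2, integral_mul_const, hk0, hk1]
    simp
  -- it suffices to treat smooth approximations of `u`; their kernels have radius less than
  -- `min δ (δ ^ 2)`, so that shifts by points of the support of `η` map `Q` into the cylinder that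
  -- defines `cylMass`
  set h₀ := min δ (δ ^ 2) with hh₀
  have hh₀pos : 0 < h₀ := lt_min hδ hδ2
  let φ : ℕ → ContDiffBump (0 : Z d) := fun n =>
    ⟨h₀ / (n + 1) / 2, h₀ / (n + 1), by positivity, half_lt_self (by positivity)⟩
  have hφ : Tendsto (fun n => (φ n).rOut) atTop (𝓝 0) :=
    tendsto_const_div_atTop_nhds_zero_nat h₀ |>.comp (tendsto_add_atTop_nat 1) |>.congr
      fun n => by simp [φ]
  have hlim := (tendsto_integral_conv_mul hut.1 hKcont hKc hφ).enorm
  rw [show conv u k (0, x) = ∫ z, u z * K z from rfl]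
  refine le_of_tendsto hlim (Eventually.of_forall fun n => ?_)
  set η := (φ n).normed volume with hη
  have hηs : ContDiff ℝ ∞ η := (φ n).contDiff_normed
  have hηc : HasCompactSupport η := (φ n).hasCompactSupport_normed
  have hη1 : ∫⁻ w, ‖η w‖ₑ = 1 := by
    have h1 : ∀ w, ‖η w‖ₑ = ENNReal.ofReal (η w) := fun w =>
      Real.enorm_of_nonneg ((φ n).nonneg_normed w)
    simp only [h1]
    rw [← ofReal_integral_eq_lintegral_ofReal (φ n).integrable_normed
      (Eventually.of_forall (φ n).nonneg_normed), (φ n).integral_normed, ENNReal.ofReal_one]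
  have hshift : ∀ z ∈ Q, ∀ w, η w ≠ 0 → z - w ∈ cylinder (3 * δ) (-(4 * δ ^ 2), x) := by
    intro z hz w hw
    have h1 : w ∈ Metric.ball (0 : Z d) (φ n).rOut := by
      rw [← (φ n).support_normed_eq (μ := volume)]
      exact hw
    have h2 : ‖w‖ < h₀ := by
      rw [mem_ball_zero_iff] at h1
      refine h1.trans_le (div_le_self hh₀pos.le ?_)
      linarith [(Nat.cast_nonneg n : (0 : ℝ) ≤ n)]
    have h3 : |w.1| < δ ^ 2 :=
      ((norm_fst_le w).trans_lt h2).trans_le (min_le_right _ _)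
    have h4 : ‖w.2‖ < δ := ((norm_snd_le w).trans_lt h2).trans_le (min_le_left _ _)
    have h5 := abs_lt.1 h3
    have h6 := hz.2
    rw [Metric.mem_ball, dist_eq_norm] at h6
    refine ⟨⟨?_, ?_⟩, ?_⟩
    · have := hz.1.1
      simp only [Prod.fst_sub]
      linarith [h5.2]
    · have := hz.1.2
      simp only [Prod.fst_sub]
      nlinarith [h5.1]
    · rw [Metric.mem_ball, dist_eq_norm, Prod.snd_sub, sub_right_comm]
      exact (norm_sub_le _ _).trans_lt (by linarith)
  have hcylm := measurableSet_cylinder (3 * δ) ((-(4 * δ ^ 2), x) : Z d)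
  set H : Z d → ℝ≥0∞ := fun z => ∑ ij : Fin d × Fin d, ‖conv (fun w => D2u w ij) η z‖ₑ with hH
  have hHj : ∀ ij : Fin d × Fin d, Measurable fun z => ‖conv (fun w => D2u w ij) η z‖ₑ :=
    fun ij => (continuous_conv (hD2u ij.1 ij.2).2.1 hηs.continuous hηc).enorm.measurable
  have hHm : Measurable H := Finset.measurable_fun_sum _ fun ij _ => hHj ij
  have main := enorm_integral_mul_le_of_contDiff
    ((contDiff_conv hut.1 hηs hηc).of_le (by exact WithTop.coe_le_coe.2 le_top)) (a := 0) (b := 2 * δ ^ 2)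
    (s := 2 * δ) (by positivity) (by positivity) x hKcont hKc (fun z => hM _) hKs hK0 hK1 hHm
    (fun z e => enorm_fderiv_fderiv_conv_le hut.1 hDu hD2u hηs hηc z e)
  have hW : ∫⁻ z in Q, ‖fderiv ℝ (conv u η) z (1, 0)‖ₑ ≤ cylMass ut δ x := by
    have : ∀ z, fderiv ℝ (conv u η) z (1, 0) = conv ut η z := fun z => by
      rw [fderiv_conv hut.1 hηs hηc]
      exact hut.conv_fderiv hηs hηc z
    simp only [this]
    exact lintegral_enorm_conv_le hut.2.1.aestronglyMeasurable hηs.continuous hη1 hQm hcylm hshift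
  have hHint : ∫⁻ z in Q, H z ≤ d ^ 2 * cylMass D2u δ x := by
    rw [hH, lintegral_finsetSum _ fun ij _ => hHj ij]
    calc ∑ ij : Fin d × Fin d, ∫⁻ z in Q, ‖conv (fun w => D2u w ij) η z‖ₑ
        ≤ ∑ _ij : Fin d × Fin d, cylMass D2u δ x := by
          refine Finset.sum_le_sum fun ij _ => ?_
          refine (lintegral_enorm_conv_le (hD2u ij.1 ij.2).2.1.aestronglyMeasurable
            hηs.continuous hη1 hQm hcylm hshift).trans ?_
          exact lintegral_mono fun z => enorm_apply_le _ _
      _ = d ^ 2 * cylMass D2u δ x := by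
          rw [Finset.sum_const, nsmul_eq_mul]
          simp [sq]
  refine main.trans ?_
  have e1 : ENNReal.ofReal (2 * δ ^ 2 - 0) = 2 * ENNReal.ofReal δ ^ 2 := by
    rw [sub_zero, ENNReal.ofReal_mul (by norm_num), ENNReal.ofReal_pow hδ.le]; simp
  have e2 : ENNReal.ofReal (2 * (2 * δ)) ^ 2 = 16 * ENNReal.ofReal δ ^ 2 := by
    rw [show 2 * (2 * δ) = 4 * δ by ring, ENNReal.ofReal_mul (by norm_num), mul_pow]
    norm_num
  rw [e1, e2]
  set D := ENNReal.ofReal δ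
  calc _ ≤ ENNReal.ofReal M * (2 * D ^ 2 * cylMass ut δ x +
        2 ^ d * (16 * D ^ 2) * (d ^ 2 * cylMass D2u δ x)) := by gcongr
    _ ≤ ENNReal.ofReal M * ((16 * 2 ^ d * (d ^ 2 + 1)) * D ^ 2 * cylMass ut δ x +
        (16 * 2 ^ d * (d ^ 2 + 1)) * D ^ 2 * cylMass D2u δ x) := by
        have h2d : (1 : ℝ≥0∞) ≤ 2 ^ d := one_le_pow₀ (by norm_num)
        have c1 : (2 : ℝ≥0∞) ≤ 16 * 2 ^ d * (d ^ 2 + 1) := by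
          calc (2 : ℝ≥0∞) ≤ 16 * 1 * (0 + 1) := by norm_num
            _ ≤ _ := by gcongr; exact zero_le
        have c2 : (2 : ℝ≥0∞) ^ d * (16 * D ^ 2) * (d ^ 2 * cylMass D2u δ x) ≤
            (16 * 2 ^ d * (d ^ 2 + 1)) * D ^ 2 * cylMass D2u δ x := by
          calc _ = (16 * 2 ^ d * (d ^ 2 + 0)) * D ^ 2 * cylMass D2u δ x := by ring
            _ ≤ _ := by gcongr; exact zero_le
        gcongr
    _ = _ := by ring

end Conv

/-! ### Kernels and scaling -/

section Kernels

variable {d : ℕ}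

/-- The spatial derivative `D^γ (u * k)(0, ·)`. -/
noncomputable def sliceDeriv (γ : ℕ) (u k : Z d → ℝ) : E d → DVal d γ :=
  fun x => iteratedFDeriv ℝ γ (fun x' : E d => conv u k (0, x')) x

/-- Smooth kernels living at scale `δ`: the support lies in `[-δ², 0] × B_δ`, and `M` bounds the
spatial derivatives of order `γ` (only `γ = 0` and `γ = 1` are of interest). -/
structure IsKernel (γ : ℕ) (δ M : ℝ) (k : Z d → ℝ) : Prop where
  smooth : ContDiff ℝ ∞ k
  compact : HasCompactSupport k
  support : ∀ z, k z ≠ 0 → -δ ^ 2 ≤ z.1 ∧ z.1 ≤ 0 ∧ ‖z.2‖ ≤ δ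
  bound_zero : γ = 0 → ∀ z, |k z| ≤ M
  bound_one : γ = 1 → ∀ z e, |fderiv ℝ k z (0, e)| ≤ M * ‖e‖

theorem contDiff_conv_slice {u k : Z d → ℝ} (hu : LocallyIntegrable u) (hk : ContDiff ℝ ∞ k)
    (hkc : HasCompactSupport k) : ContDiff ℝ ∞ fun x' : E d => conv u k (0, x') :=
  (contDiff_conv hu hk hkc).comp (contDiff_const.prodMk contDiff_id)

theorem continuous_sliceDeriv {γ : ℕ} {u k : Z d → ℝ} (hu : LocallyIntegrable u)
    (hk : ContDiff ℝ ∞ k) (hkc : HasCompactSupport k) : Continuous (sliceDeriv γ u k) :=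
  (contDiff_conv_slice hu hk hkc).continuous_iteratedFDeriv (by exact_mod_cast le_top)

theorem sliceDeriv_sub {γ : ℕ} {u k k' : Z d → ℝ} (hu : LocallyIntegrable u)
    (hk : ContDiff ℝ ∞ k) (hkc : HasCompactSupport k) (hk' : ContDiff ℝ ∞ k')
    (hkc' : HasCompactSupport k') (x : E d) :
    sliceDeriv γ u (k - k') x = sliceDeriv γ u k x - sliceDeriv γ u k' x := by
  have h1 : (fun x' : E d => conv u (k - k') (0, x')) =
      (fun x' : E d => conv u k (0, x')) - fun x' : E d => conv u k' (0, x') := by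
    ext x'
    simp only [Pi.sub_apply, conv_apply, mul_sub]
    exact integral_sub (conv_integrable hu hk.continuous hkc _)
      (conv_integrable hu hk'.continuous hkc' _)
  unfold sliceDeriv
  rw [h1]
  exact iteratedFDeriv_sub_apply
    ((contDiff_conv_slice hu hk hkc).contDiffAt.of_le (by exact_mod_cast le_top))
    ((contDiff_conv_slice hu hk' hkc').contDiffAt.of_le (by exact_mod_cast le_top))

theorem enorm_sliceDeriv_zero (u k : Z d → ℝ) (x : E d) :
    ‖sliceDeriv 0 u k x‖ₑ = ‖conv u k (0, x)‖ₑ := by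
  rw [← ofReal_norm, ← ofReal_norm, sliceDeriv, norm_iteratedFDeriv_zero]

theorem fderiv_conv_slice {u k : Z d → ℝ} (hu : LocallyIntegrable u) (hk : ContDiff ℝ ∞ k)
    (hkc : HasCompactSupport k) (x e : E d) :
    fderiv ℝ (fun x' : E d => conv u k (0, x')) x e =
      conv u (fun w => fderiv ℝ k w (0, e)) (0, x) := by
  rw [← fderiv_conv hu hk hkc]
  have h1 : HasFDerivAt (fun x' : E d => ((0, x') : Z d)) (ContinuousLinearMap.inr ℝ ℝ (E d)) x :=
    (ContinuousLinearMap.inr ℝ ℝ (E d)).hasFDerivAt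
  have h2 := (((contDiff_conv hu hk hkc).differentiable (by simp) (0, x)).hasFDerivAt).comp x h1
  have h3 : fderiv ℝ (fun x' : E d => conv u k (0, x')) x =
    (fderiv ℝ (conv u k) (0, x)).comp (ContinuousLinearMap.inr ℝ ℝ (E d)) := h2.fderiv
  rw [h3]
  simp

theorem enorm_conv_fderiv_le {u k : Z d → ℝ} (hu : LocallyIntegrable u) (hk : ContDiff ℝ ∞ k)
    (hkc : HasCompactSupport k) (x e : E d) :
    ‖conv u (fun w => fderiv ℝ k w (0, e)) (0, x)‖ₑ ≤ ‖sliceDeriv 1 u k x‖ₑ * ‖e‖ₑ := by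
  rw [← fderiv_conv_slice hu hk hkc, ← ofReal_norm, ← ofReal_norm, ← ofReal_norm, sliceDeriv,
    norm_iteratedFDeriv_one, ← ENNReal.ofReal_mul (norm_nonneg _)]
  exact ENNReal.ofReal_le_ofReal (ContinuousLinearMap.le_opNorm _ _)

theorem enorm_sliceDeriv_one_le {u k : Z d → ℝ} (hu : LocallyIntegrable u) (hk : ContDiff ℝ ∞ k)
    (hkc : HasCompactSupport k) (x : E d) {c : ℝ≥0∞}
    (h : ∀ e : E d, ‖conv u (fun w => fderiv ℝ k w (0, e)) (0, x)‖ₑ ≤ c * ‖e‖ₑ) :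
    ‖sliceDeriv 1 u k x‖ₑ ≤ c := by
  rcases eq_or_ne c ⊤ with rfl | hc
  · exact le_top
  rw [← ofReal_norm, sliceDeriv, norm_iteratedFDeriv_one]
  refine ENNReal.ofReal_le_of_le_toReal
    (ContinuousLinearMap.opNorm_le_bound _ ENNReal.toReal_nonneg fun e => ?_)
  have h1 := ENNReal.toReal_mono (ENNReal.mul_ne_top hc enorm_ne_top) (h e)
  rw [ENNReal.toReal_mul, toReal_enorm, toReal_enorm, ← fderiv_conv_slice hu hk hkc] at h1
  exact h1

theorem enorm_conv_le {u k : Z d → ℝ} {M δ : ℝ} (hδ : 0 < δ) (hM : ∀ z, |k z| ≤ M)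
    (hks : ∀ z, k z ≠ 0 → -δ ^ 2 ≤ z.1 ∧ z.1 ≤ 0 ∧ ‖z.2‖ ≤ δ) (x : E d) :
    ‖conv u k (0, x)‖ₑ ≤ ENNReal.ofReal M * cylMass u δ x := by
  rw [conv_apply]
  refine (enorm_integral_le_lintegral_enorm _).trans ?_
  unfold cylMass
  rw [← lintegral_const_mul' _ _ ENNReal.ofReal_ne_top,
    ← lintegral_indicator (measurableSet_cylinder _ _)]
  refine lintegral_mono fun w => ?_
  by_cases hw : k ((0, x) - w) = 0
  · simp [hw]
  · have h1 := hks _ hw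
    simp only [Prod.fst_sub, Prod.snd_sub, zero_sub] at h1
    have hδ2 : 0 < δ ^ 2 := by positivity
    rw [indicator_of_mem]
    · rw [enorm_mul, mul_comm]
      gcongr
      rw [← ofReal_norm]
      exact ENNReal.ofReal_le_ofReal (hM _)
    · refine ⟨⟨?_, ?_⟩, ?_⟩
      · simp only; linarith [h1.2.1]
      · simp only; nlinarith [h1.1]
      · rw [Metric.mem_ball, dist_comm, dist_eq_norm]
        linarith [h1.2.2]

theorem support_fderiv_apply {k : Z d → ℝ} {δ : ℝ}
    (hks : ∀ z, k z ≠ 0 → -δ ^ 2 ≤ z.1 ∧ z.1 ≤ 0 ∧ ‖z.2‖ ≤ δ) (e z : Z d)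
    (hz : fderiv ℝ k z e ≠ 0) : -δ ^ 2 ≤ z.1 ∧ z.1 ≤ 0 ∧ ‖z.2‖ ≤ δ := by
  have hcl : IsClosed {z : Z d | -δ ^ 2 ≤ z.1 ∧ z.1 ≤ 0 ∧ ‖z.2‖ ≤ δ} :=
    (isClosed_le continuous_const continuous_fst).inter
      ((isClosed_le continuous_fst continuous_const).inter
        (isClosed_le continuous_snd.norm continuous_const))
  have h1 : tsupport k ⊆ {z : Z d | -δ ^ 2 ≤ z.1 ∧ z.1 ≤ 0 ∧ ‖z.2‖ ≤ δ} :=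
    closure_minimal (fun z hz => hks z hz) hcl
  refine h1 (support_fderiv_subset ℝ fun h0 => hz ?_)
  rw [h0]; rfl

theorem enorm_sliceDeriv_le {γ : ℕ} (hγ : γ = 0 ∨ γ = 1) {u k : Z d → ℝ}
    (hu : LocallyIntegrable u) {δ M : ℝ} (hδ : 0 < δ) (hk : IsKernel γ δ M k) (x : E d) :
    ‖sliceDeriv γ u k x‖ₑ ≤ ENNReal.ofReal M * cylMass u δ x := by
  rcases hγ with rfl | rfl
  · rw [enorm_sliceDeriv_zero]
    exact enorm_conv_le hδ (hk.bound_zero rfl) hk.support x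
  · refine enorm_sliceDeriv_one_le hu hk.smooth hk.compact x fun e => ?_
    refine (enorm_conv_le hδ (fun z => hk.bound_one rfl z e)
      (support_fderiv_apply hk.support (0, e)) x).trans (le_of_eq ?_)
    rw [ENNReal.ofReal_mul' (norm_nonneg _), ofReal_norm]
    ring

theorem integral_fderiv_apply_eq_zero {k : Z d → ℝ} (hk : ContDiff ℝ ∞ k)
    (hkc : HasCompactSupport k) (e : Z d) : ∫ z, fderiv ℝ k z e = 0 := by
  have hi : Integrable fun z => fderiv ℝ k z e :=
    (contDiff_fderiv_apply hk e).continuous.integrable_of_hasCompactSupport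
      (hasCompactSupport_fderiv_apply hkc e)
  have := integral_mul_fderiv_eq_neg_fderiv_mul_of_integrable (μ := (volume : Measure (Z d)))
    (f := fun _ : Z d => (1 : ℝ)) (g := k) (v := e) (by simp) (by simpa using hi)
    (by simpa using hk.continuous.integrable_of_hasCompactSupport hkc)
    (fun z _ => differentiableAt_const _) (fun z _ => hk.differentiable (by simp) z)
  simpa using this

theorem integral_fderiv_apply_mul {k : Z d → ℝ} (hk : ContDiff ℝ ∞ k)
    (hkc : HasCompactSupport k) (e : E d) (L : E d →L[ℝ] ℝ) :
    ∫ z, fderiv ℝ k z (0, e) * L z.2 = -(L e * ∫ z, k z) := by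
  set Λ : Z d →L[ℝ] ℝ := L.comp (ContinuousLinearMap.snd ℝ ℝ (E d)) with hΛ
  have hΛ' : ∀ z : Z d, L z.2 = Λ z := fun z => rfl
  have hΛd : ∀ z : Z d, fderiv ℝ (fun z => Λ z) z (0, e) = L e := fun z => by
    rw [Λ.fderiv]; simp [hΛ]
  have hi : Integrable fun z => Λ z * fderiv ℝ k z (0, e) :=
    (Λ.continuous.mul (contDiff_fderiv_apply hk _).continuous).integrable_of_hasCompactSupport
      (hasCompactSupport_fderiv_apply hkc _).mul_left
  have := integral_mul_fderiv_eq_neg_fderiv_mul_of_integrable (μ := (volume : Measure (Z d)))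
    (f := fun z => Λ z) (g := k) (v := ((0, e) : Z d))
    (by simp only [hΛd]; exact (hk.continuous.integrable_of_hasCompactSupport hkc).const_mul _) hi
    ((Λ.continuous.mul hk.continuous).integrable_of_hasCompactSupport hkc.mul_left)
    (fun z _ => Λ.differentiable z) (fun z _ => hk.differentiable (by simp) z)
  simp only [hΛd, integral_const_mul] at this
  rw [← this]
  exact integral_congr_ae (Eventually.of_forall fun z => mul_comm _ _)

/-- For `γ = 1` the first moments of the kernel do not matter, as those of its spatial derivatives
vanish as soon as the kernel has mean zero. -/
theorem enorm_sliceDeriv_le_of_moments {γ : ℕ} (hγ : γ = 0 ∨ γ = 1) {u ut : Z d → ℝ}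
    {Du : Z d → E d} {D2u : Z d → EuclideanSpace ℝ (Fin d × Fin d)}
    (hut : HasWeakDeriv u ut (timeDir d))
    (hDu : ∀ i, HasWeakDeriv u (fun z => Du z i) (spaceDir i))
    (hD2u : ∀ i j, HasWeakDeriv (fun z => Du z i) (fun z => D2u z (i, j)) (spaceDir j))
    {k : Z d → ℝ} {δ M : ℝ} (hδ : 0 < δ) (hk : IsKernel γ δ M k) (hk0 : ∫ z, k z = 0)
    (hk1 : γ = 0 → ∀ L : E d →L[ℝ] ℝ, ∫ z, k z * L z.2 = 0) (x : E d) :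
    ‖sliceDeriv γ u k x‖ₑ ≤ 16 * 2 ^ d * (d ^ 2 + 1) * (ENNReal.ofReal M * ENNReal.ofReal δ ^ 2) *
      (cylMass ut δ x + cylMass D2u δ x) := by
  rcases hγ with rfl | rfl
  · rw [enorm_sliceDeriv_zero]
    exact enorm_conv_le_of_moments hut hDu hD2u hk.smooth.continuous hk.compact
      (hk.bound_zero rfl) hδ hk.support hk0 (hk1 rfl) x
  · refine enorm_sliceDeriv_one_le hut.1 hk.smooth hk.compact x fun e => ?_
    refine (enorm_conv_le_of_moments hut hDu hD2u (contDiff_fderiv_apply hk.smooth _).continuous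
      (hasCompactSupport_fderiv_apply hk.compact _) (fun z => hk.bound_one rfl z e) hδ
      (support_fderiv_apply hk.support (0, e))
      (integral_fderiv_apply_eq_zero hk.smooth hk.compact _) (fun L => by
        rw [integral_fderiv_apply_mul hk.smooth hk.compact, hk0]; simp) x).trans (le_of_eq ?_)
    rw [ENNReal.ofReal_mul' (norm_nonneg _), ofReal_norm]
    ring

theorem IsKernel.sub {γ : ℕ} {δ M M' : ℝ} {k k' : Z d → ℝ} (hk : IsKernel γ δ M k)
    (hk' : IsKernel γ δ M' k') : IsKernel γ δ (M + M') (k - k') where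
  smooth := hk.smooth.sub hk'.smooth
  compact := hk.compact.sub hk'.compact
  support z hz := by
    by_cases h : k z = 0
    · exact hk'.support z fun h' => hz (by simp [h, h'])
    · exact hk.support z h
  bound_zero h z := (abs_sub _ _).trans (add_le_add (hk.bound_zero h z) (hk'.bound_zero h z))
  bound_one h z e := by
    rw [fderiv_sub (hk.smooth.differentiable (by simp) z) (hk'.smooth.differentiable (by simp) z),
      add_mul]
    exact (abs_sub _ _).trans (add_le_add (hk.bound_one h z e) (hk'.bound_one h z e))

/-! ### Parabolic scaling of mollifiers -/

theorem integral_comp_parabolic_scaling {f : Z d → ℝ} (hf : Continuous f)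
    (hfc : HasCompactSupport f) {ε : ℝ} (hε : 0 < ε) :
    ∫ z : Z d, f (z.1 / ε ^ 2, ε⁻¹ • z.2) = ε ^ (d + 2) * ∫ z, f z := by
  have hg : Continuous fun z : Z d => f (z.1 / ε ^ 2, ε⁻¹ • z.2) := hf.comp (by fun_prop)
  have hε2 : ε ^ 2 ≠ 0 := by positivity
  let Φ : Z d ≃ₜ Z d :=
    (Homeomorph.mulRight₀ (ε ^ 2)⁻¹ (inv_ne_zero hε2)).prodCongr
      (Homeomorph.smulOfNeZero ε⁻¹ (inv_ne_zero hε.ne'))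
  have hgc : HasCompactSupport fun z : Z d => f (z.1 / ε ^ 2, ε⁻¹ • z.2) := by
    have := hfc.comp_homeomorph Φ
    convert this using 2 with z
    change f _ = f (z.1 * (ε ^ 2)⁻¹, ε⁻¹ • z.2)
    rw [div_eq_mul_inv]
  have e1 : ∫ z : Z d, f (z.1 / ε ^ 2, ε⁻¹ • z.2) =
      ∫ t : ℝ, ∫ x : E d, f (t / ε ^ 2, ε⁻¹ • x) := by
    rw [Measure.volume_eq_prod]
    exact integral_prod _ (hg.integrable_of_hasCompactSupport hgc)
  have e2 : ∫ z : Z d, f z = ∫ t : ℝ, ∫ x : E d, f (t, x) := by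
    rw [Measure.volume_eq_prod]
    exact integral_prod _ (hf.integrable_of_hasCompactSupport hfc)
  rw [e1, e2]
  have e3 : ∀ t : ℝ, ∫ x : E d, f (t / ε ^ 2, ε⁻¹ • x) = ε ^ d * ∫ x : E d, f (t / ε ^ 2, x) := by
    intro t
    rw [Measure.integral_comp_smul volume (fun x => f (t / ε ^ 2, x)), finrank_euclideanSpace,
      Fintype.card_fin, inv_pow, inv_inv, abs_of_pos (by positivity), smul_eq_mul]
  simp only [e3]
  rw [integral_const_mul, Measure.integral_comp_div (fun t => ∫ x : E d, f (t, x)),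
    abs_of_pos (by positivity), smul_eq_mul]
  ring

theorem contDiff_scaledKernel {ζ : Z d → ℝ} (hζ : ContDiff ℝ ∞ ζ) (ε : ℝ) :
    ContDiff ℝ ∞ (scaledKernel ζ ε) := by
  unfold scaledKernel
  refine contDiff_const.mul (hζ.comp ?_)
  exact (contDiff_fst.div_const _).prodMk (contDiff_snd.const_smul _)

theorem IsMollifier.scaledKernel_support {ζ : Z d → ℝ} (hζ : IsMollifier ζ) {ε δ : ℝ}
    (hε : 0 < ε) (hεδ : ε ≤ δ) (z : Z d) (hz : scaledKernel ζ ε z ≠ 0) :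
    -δ ^ 2 ≤ z.1 ∧ z.1 ≤ 0 ∧ ‖z.2‖ ≤ δ := by
  have h1 : ζ (z.1 / ε ^ 2, ε⁻¹ • z.2) ≠ 0 := right_ne_zero_of_mul hz
  obtain ⟨⟨h2, h3⟩, h4⟩ := hζ.support (subset_tsupport _ h1)
  simp only [one_pow, neg_add_cancel] at h2 h3
  have hε2 : 0 < ε ^ 2 := by positivity
  have h5 : ε ^ 2 ≤ δ ^ 2 := by gcongr
  rw [le_div_iff₀ hε2] at h2
  rw [div_lt_iff₀ hε2] at h3
  rw [mem_ball_zero_iff, norm_smul, norm_inv, Real.norm_of_nonneg hε.le,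
    inv_mul_lt_iff₀ hε] at h4
  exact ⟨by linarith, by linarith, by linarith⟩

theorem IsMollifier.hasCompactSupport_scaledKernel {ζ : Z d → ℝ} (hζ : IsMollifier ζ) {ε : ℝ}
    (hε : 0 < ε) : HasCompactSupport (scaledKernel ζ ε) := by
  refine HasCompactSupport.of_support_subset_isCompact
    (isCompact_Icc.prod (isCompact_closedBall (0 : E d) ε)) (K := Icc (-ε ^ 2) 0 ×ˢ
      Metric.closedBall (0 : E d) ε) fun z hz => ?_
  obtain ⟨h1, h2, h3⟩ := hζ.scaledKernel_support hε le_rfl z hz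
  exact ⟨⟨h1, h2⟩, mem_closedBall_zero_iff.2 h3⟩

theorem IsMollifier.integral_scaledKernel {ζ : Z d → ℝ} (hζ : IsMollifier ζ) {ε : ℝ}
    (hε : 0 < ε) : ∫ z, scaledKernel ζ ε z = 1 := by
  unfold scaledKernel
  rw [integral_const_mul, integral_comp_parabolic_scaling hζ.smooth.continuous hζ.compact hε,
    hζ.integral_eq_one, mul_one]
  exact inv_mul_cancel₀ (by positivity)

theorem IsMollifier.integral_scaledKernel_mul {ζ : Z d → ℝ} (hζ : IsMollifier ζ) {ε : ℝ}
    (hε : 0 < ε) (L : E d →L[ℝ] ℝ) :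
    ∫ z, scaledKernel ζ ε z * L z.2 = ε * ∫ z, ζ z * L z.2 := by
  have h1 : ∀ z : Z d, scaledKernel ζ ε z * L z.2 =
      (ε * (ε ^ (d + 2))⁻¹) * (fun z : Z d => ζ z * L z.2) (z.1 / ε ^ 2, ε⁻¹ • z.2) := by
    intro z
    simp only [scaledKernel, map_smul, smul_eq_mul]
    field_simp
  have h2 := integral_comp_parabolic_scaling (f := fun z : Z d => ζ z * L z.2)
    (hζ.smooth.continuous.mul (L.continuous.comp continuous_snd)) hζ.compact.mul_right hε
  simp only [h1]
  rw [integral_const_mul, h2]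
  field_simp

/-- All mollifiers `ζ_ε` with `δ / 2 ≤ ε ≤ δ` are kernels at scale `δ`. -/
theorem IsMollifier.exists_isKernel {ζ : Z d → ℝ} (hζ : IsMollifier ζ) :
    ∃ C : ℝ, 0 ≤ C ∧ ∀ (γ : ℕ) (ε δ : ℝ), 0 < ε → ε ≤ δ → δ ≤ 2 * ε →
      IsKernel γ δ (C * (δ ^ (d + 2 + γ))⁻¹) (scaledKernel ζ ε) := by
  obtain ⟨C₀, hC₀⟩ := hζ.smooth.continuous.bounded_above_of_compact_support hζ.compact
  obtain ⟨C₁, hC₁⟩ := (hζ.smooth.continuous_fderiv (by simp)).bounded_above_of_compact_support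
    (hζ.compact.fderiv (𝕜 := ℝ))
  have hC₀' : 0 ≤ C₀ := (norm_nonneg _).trans (hC₀ 0)
  have hC₁' : 0 ≤ C₁ := (norm_nonneg _).trans (hC₁ 0)
  have hinv : ∀ (m : ℕ) (ε δ : ℝ), 0 < ε → ε ≤ δ → δ ≤ 2 * ε →
      (ε ^ m)⁻¹ ≤ 2 ^ m * (δ ^ m)⁻¹ := by
    intro m ε δ hε hεδ hδ
    have hδ0 : 0 < δ := hε.trans_le hεδ
    rw [← div_eq_mul_inv, le_div_iff₀ (by positivity), inv_mul_le_iff₀ (by positivity),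
      mul_comm, ← mul_pow]
    gcongr
  -- one constant for both orders of differentiation
  refine ⟨C₀ * 2 ^ (d + 2) + C₁ * 2 ^ (d + 3), by positivity, fun γ ε δ hε hεδ hδ => ?_⟩
  have hδ0 : 0 < δ := hε.trans_le hεδ
  refine ⟨contDiff_scaledKernel hζ.smooth ε, hζ.hasCompactSupport_scaledKernel hε,
    hζ.scaledKernel_support hε hεδ, ?_, ?_⟩
  · rintro rfl z
    rw [add_zero, scaledKernel, abs_mul, abs_of_pos (by positivity)]
    calc (ε ^ (d + 2))⁻¹ * |ζ (z.1 / ε ^ 2, ε⁻¹ • z.2)|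
        ≤ (2 ^ (d + 2) * (δ ^ (d + 2))⁻¹) * C₀ := by
          gcongr
          · exact hinv _ _ _ hε hεδ hδ
          · exact hC₀ _
      _ ≤ (2 ^ (d + 2) * (δ ^ (d + 2))⁻¹) * C₀ + C₁ * 2 ^ (d + 3) * (δ ^ (d + 2))⁻¹ :=
          le_add_of_nonneg_right (by positivity)
      _ = _ := by ring
  · rintro rfl z e
    set w : Z d := (z.1 / ε ^ 2, ε⁻¹ • z.2) with hw
    have h1 : fderiv ℝ (scaledKernel ζ ε) z (0, e) =
        (ε ^ (d + 2))⁻¹ * fderiv ℝ ζ w (0, ε⁻¹ • e) := by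
      have hA : HasFDerivAt (fun z : Z d => ((z.1 / ε ^ 2, ε⁻¹ • z.2) : Z d))
          (((ε ^ 2)⁻¹ • ContinuousLinearMap.fst ℝ ℝ (E d)).prod
            (ε⁻¹ • ContinuousLinearMap.snd ℝ ℝ (E d))) z := by
        refine HasFDerivAt.prodMk ?_ ?_
        · simp only [div_eq_inv_mul]
          exact (hasFDerivAt_fst (𝕜 := ℝ) (p := z)).const_mul _
        · exact (ε⁻¹ • ContinuousLinearMap.snd ℝ ℝ (E d)).hasFDerivAt
      have h2 := ((hζ.smooth.differentiable (by simp) w).hasFDerivAt.comp z hA).const_mul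
        ((ε ^ (d + 2))⁻¹)
      have h3 : fderiv ℝ (scaledKernel ζ ε) z = _ := h2.fderiv
      rw [h3]
      simp
    rw [h1, abs_mul, abs_of_pos (by positivity)]
    have h4 : |fderiv ℝ ζ w (0, ε⁻¹ • e)| ≤ C₁ * (ε⁻¹ * ‖e‖) := by
      refine ((fderiv ℝ ζ w).le_opNorm _).trans ?_
      have : ‖((0, ε⁻¹ • e) : Z d)‖ = ε⁻¹ * ‖e‖ := by
        rw [Prod.norm_mk, norm_zero, norm_smul, norm_inv, Real.norm_of_nonneg hε.le,
          max_eq_right (by positivity)]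
      rw [this]
      gcongr
      exact hC₁ _
    calc (ε ^ (d + 2))⁻¹ * |fderiv ℝ ζ w (0, ε⁻¹ • e)|
        ≤ (ε ^ (d + 2))⁻¹ * (C₁ * (ε⁻¹ * ‖e‖)) := by gcongr
      _ = (ε ^ (d + 3))⁻¹ * (C₁ * ‖e‖) := by field_simp; ring
      _ ≤ (2 ^ (d + 3) * (δ ^ (d + 3))⁻¹) * (C₁ * ‖e‖) := by
          gcongr
          exact hinv _ _ _ hε hεδ hδ
      _ ≤ (2 ^ (d + 3) * (δ ^ (d + 3))⁻¹) * (C₁ * ‖e‖) +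
          C₀ * 2 ^ (d + 2) * (δ ^ (d + 3))⁻¹ * ‖e‖ := le_add_of_nonneg_right (by positivity)
      _ = _ := by ring

/-- There is a mollifier that is even in `x`; its first moments in `x` vanish. -/
theorem exists_isMollifier (d : ℕ) : ∃ ζ : Z d → ℝ, IsMollifier ζ ∧
    ∀ L : E d →L[ℝ] ℝ, ∫ z, ζ z * L z.2 = 0 := by
  let χ : ContDiffBump (-(1 / 2) : ℝ) := ⟨1 / 8, 1 / 4, by norm_num, by norm_num⟩
  let ψ : ContDiffBump (0 : E d) := ⟨1 / 4, 1 / 2, by norm_num, by norm_num⟩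
  set a := χ.normed volume with ha
  set b := ψ.normed volume with hb
  refine ⟨fun z => a z.1 * b z.2, ⟨?_, ?_, ?_, ?_, ?_⟩, ?_⟩
  · exact (χ.contDiff_normed.comp contDiff_fst).mul (ψ.contDiff_normed.comp contDiff_snd)
  · refine HasCompactSupport.of_support_subset_isCompact
      (K := tsupport a ×ˢ tsupport b)
      (χ.hasCompactSupport_normed.isCompact.prod ψ.hasCompactSupport_normed.isCompact)
      fun z hz => ⟨subset_tsupport _ (left_ne_zero_of_mul hz),
        subset_tsupport _ (right_ne_zero_of_mul hz)⟩
  · exact fun z => mul_nonneg (χ.nonneg_normed _) (ψ.nonneg_normed _)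
  · rw [Measure.volume_eq_prod, integral_prod_mul, χ.integral_normed, ψ.integral_normed, mul_one]
  · refine (closure_minimal (t := tsupport a ×ˢ tsupport b) (fun z hz =>
      ⟨subset_tsupport _ (left_ne_zero_of_mul hz), subset_tsupport _ (right_ne_zero_of_mul hz)⟩)
      ((isClosed_tsupport _).prod (isClosed_tsupport _))).trans ?_
    rw [χ.tsupport_normed_eq, ψ.tsupport_normed_eq]
    rintro z ⟨h1, h2⟩
    rw [Metric.mem_closedBall, Real.dist_eq, abs_le] at h1
    rw [mem_closedBall_zero_iff] at h2
    have e1 : χ.rOut = 1 / 4 := rfl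
    have e2 : ψ.rOut = 1 / 2 := rfl
    rw [e1] at h1
    rw [e2] at h2
    refine ⟨⟨?_, ?_⟩, ?_⟩
    · simp only; linarith [h1.1]
    · simp only; linarith [h1.2]
    · rw [mem_ball_zero_iff]; linarith
  · intro L
    have h1 : ∫ x, b x * L x = 0 := by
      have h2 := integral_neg_eq_self (fun x => b x * L x) (volume : Measure (E d))
      have h3 : ∀ x, b (-x) * L (-x) = -(b x * L x) := by
        intro x
        rw [hb, ψ.normed_neg, map_neg, mul_neg]
      simp only [h3, integral_neg] at h2
      linarith
    have h2 : ∀ z : Z d, a z.1 * b z.2 * L z.2 = a z.1 * (fun x => b x * L x) z.2 :=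
      fun z => mul_assoc _ _ _
    simp only [h2]
    rw [Measure.volume_eq_prod, integral_prod_mul a fun x => b x * L x, h1, mul_zero]

end Kernels

/-! ### Comparison of mollifications at neighbouring scales -/

section Compare

variable {d : ℕ}

/-- The first moments of `ζ` in the space variable vanish. -/
def IsCentered (ζ : Z d → ℝ) : Prop := ∀ L : E d →L[ℝ] ℝ, ∫ z, ζ z * L z.2 = 0

theorem ofReal_mul_inv_pow {C δ : ℝ} (hC : 0 ≤ C) (hδ : 0 < δ) (m : ℕ) :
    ENNReal.ofReal (C * (δ ^ m)⁻¹) = ENNReal.ofReal C * ENNReal.ofReal δ ^ (-(m : ℝ)) := by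
  rw [ENNReal.ofReal_mul hC, ENNReal.ofReal_inv_of_pos (by positivity), ENNReal.ofReal_pow hδ.le,
    ENNReal.rpow_neg, ENNReal.rpow_natCast]

theorem ofReal_mul_inv_pow_mul_sq {C δ : ℝ} (hC : 0 ≤ C) (hδ : 0 < δ) (γ : ℕ) :
    ENNReal.ofReal (C * (δ ^ (d + 2 + γ))⁻¹) * ENNReal.ofReal δ ^ 2 =
      ENNReal.ofReal C * ENNReal.ofReal δ ^ (-(d + γ : ℝ)) := by
  have h0 : ENNReal.ofReal δ ≠ 0 := by simpa using hδ
  rw [ofReal_mul_inv_pow hC hδ, mul_assoc,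
    show ENNReal.ofReal δ ^ 2 = ENNReal.ofReal δ ^ (2 : ℝ) from (ENNReal.rpow_natCast _ 2).symm,
    ← ENNReal.rpow_add _ _ h0 ENNReal.ofReal_ne_top]
  congr 2
  push_cast
  ring

theorem IsMollifier.enorm_sliceDeriv_le {ζ : Z d → ℝ} (hζ : IsMollifier ζ) :
    ∃ C : ℝ≥0, ∀ γ : ℕ, γ = 0 ∨ γ = 1 → ∀ u : Z d → ℝ, LocallyIntegrable u →
      ∀ δ : ℝ, 0 < δ → ∀ x : E d, ‖sliceDeriv γ u (scaledKernel ζ δ) x‖ₑ ≤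
        C * ENNReal.ofReal δ ^ (-(d + 2 + γ : ℝ)) * cylMass u δ x := by
  obtain ⟨C, hC, h⟩ := hζ.exists_isKernel
  refine ⟨C.toNNReal, fun γ hγ u hu δ hδ x => ?_⟩
  refine (ParabolicMorrey.enorm_sliceDeriv_le hγ hu hδ (h γ δ δ hδ le_rfl (by linarith)) x).trans
    (le_of_eq ?_)
  rw [ofReal_mul_inv_pow hC hδ]
  congr 3
  push_cast
  ring

/-- Two mollifications at comparable scales differ only through `∂_t u` and `D²u`, if the order of
differentiation is `1` or if both kernels are centered. -/
theorem IsMollifier.enorm_sliceDeriv_sub_le {ζ ζ' : Z d → ℝ} (hζ : IsMollifier ζ)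
    (hζ' : IsMollifier ζ') :
    ∃ C : ℝ≥0, ∀ γ : ℕ, γ = 0 ∨ γ = 1 → (γ = 0 → IsCentered ζ ∧ IsCentered ζ') →
      ∀ (p q β : ℝ) (u ut : Z d → ℝ) (Du : Z d → E d)
        (D2u : Z d → EuclideanSpace ℝ (Fin d × Fin d)), MemMorrey12 p q β u ut Du D2u →
      ∀ ε ε' δ : ℝ, 0 < ε → ε ≤ δ → δ ≤ 2 * ε → 0 < ε' → ε' ≤ δ → δ ≤ 2 * ε' → ∀ x : E d,
        ‖sliceDeriv γ u (scaledKernel ζ ε) x - sliceDeriv γ u (scaledKernel ζ' ε') x‖ₑ ≤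
          C * ENNReal.ofReal δ ^ (-(d + γ : ℝ)) * (cylMass ut δ x + cylMass D2u δ x) := by
  obtain ⟨C, hC, h⟩ := hζ.exists_isKernel
  obtain ⟨C', hC', h'⟩ := hζ'.exists_isKernel
  refine ⟨16 * 2 ^ d * (d ^ 2 + 1) * (C + C').toNNReal,
    fun γ hγ hcen p q β u ut Du D2u hmem ε ε' δ h1 h2 h3 h1' h2' h3' x => ?_⟩
  have hδ : 0 < δ := h1.trans_le h2
  have hk := h γ ε δ h1 h2 h3
  have hk' := h' γ ε' δ h1' h2' h3'
  have hu := hmem.weak_ut.1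
  rw [← sliceDeriv_sub hu hk.smooth hk.compact hk'.smooth hk'.compact]
  have i : Integrable (scaledKernel ζ ε) :=
    hk.smooth.continuous.integrable_of_hasCompactSupport hk.compact
  have i' : Integrable (scaledKernel ζ' ε') :=
    hk'.smooth.continuous.integrable_of_hasCompactSupport hk'.compact
  refine (enorm_sliceDeriv_le_of_moments hγ hmem.weak_ut hmem.weak_Du hmem.weak_D2u hδ
    (hk.sub hk') ?_ ?_ x).trans (le_of_eq ?_)
  · simp only [Pi.sub_apply]
    rw [integral_sub i i', hζ.integral_scaledKernel h1, hζ'.integral_scaledKernel h1', sub_self]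
  · intro h0 L
    simp only [Pi.sub_apply, sub_mul]
    rw [integral_sub, hζ.integral_scaledKernel_mul h1, hζ'.integral_scaledKernel_mul h1',
      (hcen h0).1 L, (hcen h0).2 L]
    · simp
    · exact (hk.smooth.continuous.mul
        (L.continuous.comp continuous_snd)).integrable_of_hasCompactSupport hk.compact.mul_right
    · exact (hk'.smooth.continuous.mul
        (L.continuous.comp continuous_snd)).integrable_of_hasCompactSupport hk'.compact.mul_right
  · rw [← add_mul, ofReal_mul_inv_pow_mul_sq (add_nonneg hC hC') hδ]
    push_cast
    rw [← mul_assoc]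
    rfl

/-- Comparison with a kernel that is not centered. The first moment of the difference is removed by
adding a spatial derivative of the centered kernel, which contributes `δ D(u * ζ_δ)`. -/
theorem IsMollifier.enorm_sliceDeriv_zero_sub_le {ζ ζ' : Z d → ℝ} (hζ : IsMollifier ζ)
    (hζ' : IsMollifier ζ') (hcen : IsCentered ζ') :
    ∃ C : ℝ≥0, ∀ (p q β : ℝ) (u ut : Z d → ℝ) (Du : Z d → E d)
        (D2u : Z d → EuclideanSpace ℝ (Fin d × Fin d)), MemMorrey12 p q β u ut Du D2u →
      ∀ ε δ : ℝ, 0 < ε → ε ≤ δ → δ ≤ 2 * ε → ∀ x : E d,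
        ‖sliceDeriv 0 u (scaledKernel ζ ε) x - sliceDeriv 0 u (scaledKernel ζ' δ) x‖ₑ ≤
          C * ENNReal.ofReal δ ^ (-(d : ℝ)) * (cylMass ut δ x + cylMass D2u δ x) +
            ENNReal.ofReal δ * ‖sliceDeriv 1 u (scaledKernel ζ' δ) x‖ₑ := by
  obtain ⟨C, hC, h⟩ := hζ.exists_isKernel
  obtain ⟨C', hC', h'⟩ := hζ'.exists_isKernel
  refine ⟨16 * 2 ^ d * (d ^ 2 + 1) * (C + C' + C').toNNReal,
    fun p q β u ut Du D2u hmem ε δ h1 h2 h3 x => ?_⟩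
  have hδ : 0 < δ := h1.trans_le h2
  have hk := h 0 ε δ h1 h2 h3
  have hk' := h' 0 δ δ hδ le_rfl (by linarith)
  have hk1 := h' 1 δ δ hδ le_rfl (by linarith)
  have hu := hmem.weak_ut.1
  set k := scaledKernel ζ ε with hkdef
  set k' := scaledKernel ζ' δ with hk'def
  have i : Integrable k := hk.smooth.continuous.integrable_of_hasCompactSupport hk.compact
  have i' : Integrable k' := hk'.smooth.continuous.integrable_of_hasCompactSupport hk'.compact
  have iv : Integrable fun z : Z d => k z • z.2 :=
    (hk.smooth.continuous.smul continuous_snd).integrable_of_hasCompactSupport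
      hk.compact.smul_right
  -- the first moment of the kernel
  set c : E d := ∫ z, k z • z.2 with hc
  have hLc : ∀ L : E d →L[ℝ] ℝ, ∫ z, k z * L z.2 = L c := by
    intro L
    rw [hc, ← L.integral_comp_comm iv]
    simp
  have hknn : ∀ z, 0 ≤ k z := fun z =>
    mul_nonneg (inv_nonneg.2 (pow_nonneg h1.le _)) (hζ.nonneg _)
  have hcn : ‖c‖ ≤ δ := by
    calc ‖c‖ ≤ ∫ z, ‖k z • z.2‖ := norm_integral_le_integral_norm _
      _ ≤ ∫ z, δ * k z := by
          refine integral_mono iv.norm (i.const_mul δ) fun z => ?_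
          simp only [norm_smul, Real.norm_of_nonneg (hknn z)]
          by_cases hz : k z = 0
          · simp [hz]
          · rw [mul_comm]
            exact mul_le_mul_of_nonneg_right (hk.support z hz).2.2 (hknn z)
      _ = δ := by rw [integral_const_mul, hζ.integral_scaledKernel h1, mul_one]
  -- an integration by parts shows that `m` has first moment `-c`
  set m : Z d → ℝ := fun z => fderiv ℝ k' z (0, c) with hm
  have hms : ContDiff ℝ ∞ m := contDiff_fderiv_apply hk'.smooth _
  have hmc : HasCompactSupport m := hasCompactSupport_fderiv_apply hk'.compact _
  have im : Integrable m := hms.continuous.integrable_of_hasCompactSupport hmc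
  have hneg : IsKernel 0 δ (C' * (δ ^ (d + 2 + 0))⁻¹) (fun z => -m z) := by
    refine ⟨hms.neg, hmc.neg, fun z hz => support_fderiv_apply hk'.support (0, c) z
      (by simpa [hm] using hz), fun _ z => ?_, fun h => absurd h (by norm_num)⟩
    rw [abs_neg]
    refine (hk1.bound_one rfl z c).trans ?_
    calc C' * (δ ^ (d + 2 + 1))⁻¹ * ‖c‖ ≤ C' * (δ ^ (d + 2 + 1))⁻¹ * δ := by gcongr
      _ = C' * (δ ^ (d + 2 + 0))⁻¹ := by field_simp; ring
  have hK := (hk.sub hk').sub hneg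
  have hmain := enorm_sliceDeriv_le_of_moments (Or.inl rfl) hmem.weak_ut hmem.weak_Du
    hmem.weak_D2u hδ hK
    (by
      have ik : Integrable fun z : Z d => k z - k' z := i.sub i'
      simp only [Pi.sub_apply, sub_neg_eq_add]
      rw [integral_add ik im, integral_sub i i', hζ.integral_scaledKernel h1,
        hζ'.integral_scaledKernel hδ, integral_fderiv_apply_eq_zero hk'.smooth hk'.compact]
      simp)
    (by
      intro _ L
      have j : Integrable fun z : Z d => k z * L z.2 := (hk.smooth.continuous.mul
        (L.continuous.comp continuous_snd)).integrable_of_hasCompactSupport hk.compact.mul_right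
      have j' : Integrable fun z : Z d => k' z * L z.2 := (hk'.smooth.continuous.mul
        (L.continuous.comp continuous_snd)).integrable_of_hasCompactSupport hk'.compact.mul_right
      have jm : Integrable fun z : Z d => m z * L z.2 := (hms.continuous.mul
        (L.continuous.comp continuous_snd)).integrable_of_hasCompactSupport hmc.mul_right
      have jk : Integrable fun z : Z d => k z * L z.2 - k' z * L z.2 := j.sub j'
      simp only [Pi.sub_apply, sub_neg_eq_add, add_mul, sub_mul]
      rw [integral_add jk jm, integral_sub j j', hLc,
        hζ'.integral_scaledKernel_mul hδ, hcen L, integral_fderiv_apply_mul hk'.smooth hk'.compact,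
        hζ'.integral_scaledKernel hδ]
      simp) x
  have hdecomp : sliceDeriv 0 u k x - sliceDeriv 0 u k' x =
      sliceDeriv 0 u (k - k' - fun z => -m z) x + sliceDeriv 0 u (fun z => -m z) x := by
    rw [sliceDeriv_sub hu (hk.sub hk').smooth (hk.sub hk').compact hneg.smooth hneg.compact,
      sliceDeriv_sub hu hk.smooth hk.compact hk'.smooth hk'.compact]
    abel
  rw [hdecomp]
  have htri : ‖sliceDeriv 0 u (k - k' - fun z => -m z) x + sliceDeriv 0 u (fun z => -m z) x‖ₑ ≤
      ‖sliceDeriv 0 u (k - k' - fun z => -m z) x‖ₑ + ‖sliceDeriv 0 u (fun z => -m z) x‖ₑ := by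
    rw [← ofReal_norm, ← ofReal_norm, ← ofReal_norm, ← ENNReal.ofReal_add (norm_nonneg _)
      (norm_nonneg _)]
    exact ENNReal.ofReal_le_ofReal (norm_add_le _ _)
  refine htri.trans (add_le_add (hmain.trans (le_of_eq ?_)) ?_)
  · rw [← add_mul, ← add_mul, ofReal_mul_inv_pow_mul_sq (by positivity) hδ]
    push_cast
    rw [← mul_assoc, add_zero]
    rfl
  · rw [enorm_sliceDeriv_zero]
    have h4 : conv u (fun z => -m z) (0, x) = -conv u m (0, x) := by
      simp only [conv_apply, mul_neg, integral_neg]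
    rw [h4, enorm_neg]
    refine (enorm_conv_fderiv_le hu hk'.smooth hk'.compact x c).trans ?_
    rw [mul_comm]
    gcongr
    rw [← ofReal_norm]
    exact ENNReal.ofReal_le_ofReal hcn

/-! ### Bounds in `L_r` -/

theorem measurable_cylMass {F : Type*} [NormedAddCommGroup F] {f : Z d → F}
    (hf : AEStronglyMeasurable f volume) (δ : ℝ) : Measurable (cylMass f δ) := by
  obtain ⟨G, hG, hfG⟩ := exists_measurable_enorm hf
  have h1 : cylMass f δ = fun x => ∫⁻ y, (Metric.ball x (3 * δ)).indicator (fun y =>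
      ∫⁻ t in Ico (-(4 * δ ^ 2)) (-(4 * δ ^ 2) + (3 * δ) ^ 2), G (t, y)) y := by
    ext x
    rw [cylMass_eq hG hfG, lintegral_indicator Metric.isOpen_ball.measurableSet]
  rw [h1]
  set H : E d → ℝ≥0∞ := fun y =>
    ∫⁻ t in Ico (-(4 * δ ^ 2)) (-(4 * δ ^ 2) + (3 * δ) ^ 2), G (t, y)
  have hH : Measurable H := hG.lintegral_prod_left'
  have h2 : Measurable fun w : E d × E d => (Metric.ball w.1 (3 * δ)).indicator H w.2 := by
    have : (fun w : E d × E d => (Metric.ball w.1 (3 * δ)).indicator H w.2) =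
        {w : E d × E d | dist w.2 w.1 < 3 * δ}.indicator (fun w => H w.2) := by
      ext w; simp [indicator, Metric.mem_ball]
    rw [this]
    exact (hH.comp measurable_snd).indicator
      (measurableSet_lt (measurable_snd.dist measurable_fst) measurable_const)
  exact h2.lintegral_prod_right'

theorem eLpNorm_ofReal_eq {F : Type*} [NormedAddCommGroup F] {r : ℝ} (hr : 0 < r)
    (ν : Measure (E d)) (h : E d → F) :
    eLpNorm h (ENNReal.ofReal r) ν = (∫⁻ y, ‖h y‖ₑ ^ r ∂ν) ^ (1 / r) := by
  rw [eLpNorm_eq_lintegral_rpow_enorm_toReal (by simpa using hr) ENNReal.ofReal_ne_top,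
    ENNReal.toReal_ofReal hr.le]

theorem eLpNorm_le_mul_lintegral {F : Type*} [NormedAddCommGroup F] {r : ℝ} (hr : 1 ≤ r)
    (ν : Measure (E d)) {h : E d → F} {J : E d → ℝ≥0∞} (hJ : Measurable J) {c : ℝ≥0∞}
    (hle : ∀ y, ‖h y‖ₑ ≤ c * J y) :
    eLpNorm h (ENNReal.ofReal r) ν ≤ c * (∫⁻ y, J y ^ r ∂ν) ^ (1 / r) := by
  have hr0 : 0 < r := by linarith
  rw [eLpNorm_ofReal_eq hr0]
  calc (∫⁻ y, ‖h y‖ₑ ^ r ∂ν) ^ (1 / r) ≤ (∫⁻ y, c ^ r * J y ^ r ∂ν) ^ (1 / r) := by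
        refine ENNReal.rpow_le_rpow (lintegral_mono fun y => ?_) (by positivity)
        rw [← ENNReal.mul_rpow_of_nonneg _ _ hr0.le]
        exact ENNReal.rpow_le_rpow (hle y) hr0.le
    _ = _ := by
        rw [lintegral_const_mul _ (hJ.pow_const r), ENNReal.mul_rpow_of_nonneg _ _ (by positivity),
          ← ENNReal.rpow_mul, mul_one_div_cancel hr0.ne', ENNReal.rpow_one]

theorem eLpNorm_le_mul_lintegral_add {F : Type*} [NormedAddCommGroup F] {r : ℝ} (hr : 1 ≤ r)
    (ν : Measure (E d)) {h : E d → F} {J J' : E d → ℝ≥0∞} (hJ : Measurable J)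
    (hJ' : Measurable J') {c : ℝ≥0∞} (hle : ∀ y, ‖h y‖ₑ ≤ c * (J y + J' y)) :
    eLpNorm h (ENNReal.ofReal r) ν ≤
      c * ((∫⁻ y, J y ^ r ∂ν) ^ (1 / r) + (∫⁻ y, J' y ^ r ∂ν) ^ (1 / r)) := by
  refine (eLpNorm_le_mul_lintegral hr ν (hJ.add hJ') hle).trans ?_
  gcongr
  exact ENNReal.lintegral_Lp_add_le hJ.aemeasurable hJ'.aemeasurable hr

theorem exists_lintegral_cylMass_le {F : Type*} [NormedAddCommGroup F] {p q r : ℝ} (hp : 1 < p)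
    (hq : 1 < q) (hr : p ≤ r) {f : Z d → F} (hf : MemLpqLoc p q f) (x : E d) (R : ℝ) :
    ∃ C : ℝ≥0, ∀ δ : ℝ, 0 < δ → δ ≤ 1 →
      (∫⁻ y in Metric.ball x R, cylMass f δ y ^ r) ^ (1 / r) ≤
        C * ENNReal.ofReal δ ^ (d + 2 - (d / p + 2 / q - d / r)) := by
  set a : ℝ := d + 2 - (d / p + 2 / q - d / r) with ha
  set X : ℝ≥0∞ := lpqNorm p q ((Ico (-4 : ℝ) 5 ×ˢ Metric.ball x (R + 3)).indicator f) with hX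
  have hXt : X < ⊤ := hf.2 _ ((Metric.isBounded_Ico _ _).prod Metric.isBounded_ball)
    (measurableSet_Ico.prod Metric.isOpen_ball.measurableSet)
  have hp0 : 0 < p := by linarith
  have hr0 : 0 < r := by linarith
  have hp1 : 1 / p < 1 := by rw [div_lt_one hp0]; exact hp
  have hr1 : 0 < 1 / r := by positivity
  have hC : unitVol d ^ (1 - 1 / p + 1 / r) * 3 ^ a * X ≠ ⊤ := by
    refine ENNReal.mul_ne_top (ENNReal.mul_ne_top ?_ ?_) hXt.ne
    · exact ENNReal.rpow_ne_top_of_nonneg (by linarith) (unitVol_ne_top d)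
    · exact ENNReal.rpow_ne_top_of_ne_zero (by norm_num) (by norm_num)
  refine ⟨(unitVol d ^ (1 - 1 / p + 1 / r) * 3 ^ a * X).toNNReal, fun δ hδ hδ1 => ?_⟩
  rw [ENNReal.coe_toNNReal hC]
  have hδ2 : δ ^ 2 ≤ 1 := pow_le_one₀ hδ.le hδ1
  refine (lintegral_cylMass_rpow_le hp hq hr hf.1 hδ measurableSet_Ico
    Metric.isOpen_ball.measurableSet Metric.isOpen_ball.measurableSet measure_ball_lt_top.ne
    (I := Ico (-4 : ℝ) 5) (B := Metric.ball x (R + 3))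
    (fun y hy => Metric.ball_subset_ball' (by rw [Metric.mem_ball] at hy; linarith))
    (Ico_subset_Ico (by linarith) (by nlinarith))).trans (le_of_eq ?_)
  rw [ENNReal.ofReal_mul (by norm_num), ENNReal.mul_rpow_of_ne_top (by simp) ENNReal.ofReal_ne_top]
  simp only [ENNReal.ofReal_ofNat]
  ring

end Compare

/-! ### Existence and uniqueness of the trace -/

section Limits

variable {d : ℕ} {F : Type*} [NormedAddCommGroup F]

theorem eLpNorm_sub_le_sum_Ico {U : ℕ → E d → F} {ν : Measure (E d)} {s : ℝ≥0∞} (hs : 1 ≤ s)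
    (hU : ∀ k, AEStronglyMeasurable (U k) ν) {n m : ℕ} (hnm : n ≤ m) :
    eLpNorm (U m - U n) s ν ≤ ∑ j ∈ Finset.Ico n m, eLpNorm (U (j + 1) - U j) s ν := by
  induction m, hnm using Nat.le_induction with
  | base => simp
  | succ m hnm ih =>
    rw [Finset.sum_Ico_succ_top hnm, ← sub_add_sub_cancel (U (m + 1)) (U m) (U n), add_comm]
    exact (eLpNorm_add_le ((hU m).sub (hU n)) ((hU (m + 1)).sub (hU m)) hs).trans
      (add_le_add_left ih _)

theorem eLpNorm_le_add_eLpNorm_sub {U V : E d → F} {ν : Measure (E d)} {s : ℝ≥0∞} (hs : 1 ≤ s)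
    (hU : AEStronglyMeasurable U ν) (hV : AEStronglyMeasurable V ν) :
    eLpNorm U s ν ≤ eLpNorm V s ν + eLpNorm (U - V) s ν := by
  have e : U = V + (U - V) := by abel
  conv_lhs => rw [e]
  exact eLpNorm_add_le hV (hU.sub hV) hs

theorem sum_Ico_geometric_le (a C : ℝ≥0∞) (n m : ℕ) :
    ∑ j ∈ Finset.Ico n m, C * a ^ j ≤ C * (1 - a)⁻¹ * a ^ n := by
  rw [Finset.sum_Ico_eq_sum_range]
  calc ∑ k ∈ Finset.range (m - n), C * a ^ (n + k)
      = C * a ^ n * ∑ k ∈ Finset.range (m - n), a ^ k := by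
        rw [Finset.mul_sum]; exact Finset.sum_congr rfl fun k _ => by rw [pow_add]; ring
    _ ≤ C * a ^ n * (1 - a)⁻¹ := by
        gcongr
        rw [← ENNReal.tsum_geometric]
        exact ENNReal.sum_le_tsum _
    _ = _ := by ring

/-- A sequence of continuous functions with geometrically decaying increments in `L_s` on every
ball converges almost everywhere, and in `L_s` on every ball at a geometric rate. -/
theorem exists_limit_of_geometric [CompleteSpace F] {U : ℕ → E d → F} {s : ℝ≥0∞} (hs : 1 ≤ s)
    (hU : ∀ k, Continuous (U k)) {a : ℝ≥0∞} (ha : a < 1) (ha0 : a ≠ 0)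
    (hinc : ∀ (x : E d) (R : ℝ), ∃ C : ℝ≥0, ∀ k,
      eLpNorm (U (k + 1) - U k) s (volume.restrict (Metric.ball x R)) ≤ C * a ^ k) :
    ∃ g : E d → F, StronglyMeasurable g ∧ ∀ (x : E d) (R : ℝ),
      MemLp g s (volume.restrict (Metric.ball x R)) ∧
      ∃ C : ℝ≥0, ∀ k, eLpNorm (U k - g) s (volume.restrict (Metric.ball x R)) ≤ C * a ^ k := by
  have hUm : ∀ k (ν : Measure (E d)), AEStronglyMeasurable (U k) ν :=
    fun k ν => (hU k).aestronglyMeasurable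
  have h1a : (1 - a)⁻¹ ≠ ⊤ := ENNReal.inv_ne_top.2 (tsub_pos_of_lt ha).ne'
  have hcauchy : ∀ (x : E d) (R : ℝ), ∃ C : ℝ≥0, ∀ n m, n ≤ m →
      eLpNorm (U m - U n) s (volume.restrict (Metric.ball x R)) ≤ C * a ^ n := by
    intro x R
    obtain ⟨C, hC⟩ := hinc x R
    refine ⟨C * (1 - a)⁻¹.toNNReal, fun n m hnm => ?_⟩
    refine (eLpNorm_sub_le_sum_Ico hs (fun k => hUm k _) hnm).trans ?_
    refine (Finset.sum_le_sum fun j _ => hC j).trans ?_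
    rw [ENNReal.coe_mul, ENNReal.coe_toNNReal h1a]
    exact sum_Ico_geometric_le a C n m
  have hae : ∀ (x : E d) (R : ℝ), ∀ᵐ y ∂(volume.restrict (Metric.ball x R)),
      ∃ l, Tendsto (fun k => U k y) atTop (𝓝 l) := by
    intro x R
    obtain ⟨C, hC⟩ := hcauchy x R
    have hpos : ∀ N, 0 < a ^ N := fun N => pos_iff_ne_zero.2 (pow_ne_zero N ha0)
    have hfin : ∀ N, a ^ N ≠ ⊤ := fun N => ENNReal.pow_ne_top (ha.trans_le le_top).ne
    have hlt : ∀ N, (C : ℝ≥0∞) * a ^ N < (C + 1) * a ^ N := by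
      intro N
      rw [add_mul, one_mul]
      exact ENNReal.lt_add_right (ENNReal.mul_ne_top ENNReal.coe_ne_top (hfin N)) (hpos N).ne'
    refine Lp.ae_tendsto_of_cauchy_eLpNorm (fun k => hUm k _) hs (B := fun N => (C + 1) * a ^ N)
      ?_ ?_
    · rw [ENNReal.tsum_mul_left, ENNReal.tsum_geometric]
      exact ENNReal.mul_ne_top (by simp) h1a
    · intro N n m hn hm
      have hmono : ∀ i j, N ≤ i → i ≤ j →
          eLpNorm (U j - U i) s (volume.restrict (Metric.ball x R)) < (C + 1) * a ^ N := by
        intro i j hi hij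
        refine (hC i j hij).trans_lt ((mul_le_mul' le_rfl ?_).trans_lt (hlt N))
        exact pow_le_pow_right_of_le_one' ha.le hi
      rcases le_total n m with h | h
      · rw [eLpNorm_sub_comm]; exact hmono n m hn h
      · exact hmono m n hm h
  have hae' : ∀ᵐ y ∂(volume : Measure (E d)), ∃ l, Tendsto (fun k => U k y) atTop (𝓝 l) := by
    have h1 : ∀ n : ℕ, ∀ᵐ y ∂(volume : Measure (E d)), y ∈ Metric.ball (0 : E d) n →
        ∃ l, Tendsto (fun k => U k y) atTop (𝓝 l) := fun n =>
      (ae_restrict_iff' Metric.isOpen_ball.measurableSet).1 (hae 0 n)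
    filter_upwards [ae_all_iff.2 h1] with y hy
    obtain ⟨n, hn⟩ := exists_nat_gt ‖y‖
    exact hy n (mem_ball_zero_iff.2 hn)
  obtain ⟨g, hgm, hg⟩ := exists_stronglyMeasurable_limit_of_tendsto_ae (fun k => hUm k _) hae'
  refine ⟨g, hgm, fun x R => ?_⟩
  obtain ⟨C, hC⟩ := hcauchy x R
  have hrate : ∀ k, eLpNorm (U k - g) s (volume.restrict (Metric.ball x R)) ≤ C * a ^ k := by
    intro k
    rw [eLpNorm_sub_comm]
    refine (Lp.eLpNorm_lim_le_liminf_eLpNorm (f := fun m => U m - U k)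
      (fun m => (hUm m _).sub (hUm k _)) (g - U k) ?_).trans ?_
    · filter_upwards [ae_restrict_of_ae hg] with y hy
      exact hy.sub_const _
    · refine liminf_le_of_frequently_le' (Eventually.frequently ?_)
      filter_upwards [eventually_ge_atTop k] with m hm using hC k m hm
  refine ⟨?_, C, hrate⟩
  have h0 : MemLp (U 0) s (volume.restrict (Metric.ball x R)) := by
    obtain ⟨M, hM⟩ := (isCompact_closedBall x R).exists_bound_of_continuousOn (hU 0).continuousOn
    have : IsFiniteMeasure (volume.restrict (Metric.ball x R)) :=
      ⟨by simpa using measure_ball_lt_top⟩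
    refine MemLp.of_bound (hUm 0 _) M ?_
    filter_upwards [ae_restrict_mem Metric.isOpen_ball.measurableSet] with y hy
    exact hM y (Metric.ball_subset_closedBall hy)
  have h1 : MemLp (U 0 - g) s (volume.restrict (Metric.ball x R)) := by
    refine ⟨(hUm 0 _).sub hgm.aestronglyMeasurable, (hrate 0).trans_lt ?_⟩
    simp
  have := h0.sub h1
  rwa [sub_sub_cancel] at this

/-- A perturbed contraction. The rate `max a (3 / 4)` absorbs both the factor `1 / 2` and the
perturbation `C * a ^ k`. -/
theorem tendsto_zero_of_le_half_add {b : ℕ → ℝ≥0∞} (hb : b 0 ≠ ⊤) {a : ℝ≥0∞} (ha : a < 1)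
    {C : ℝ≥0} (h : ∀ k, b (k + 1) ≤ 2⁻¹ * b k + C * a ^ k) : Tendsto b atTop (𝓝 0) := by
  set m : ℝ≥0∞ := max a (3 / 4) with hm
  have h34 : (3 / 4 : ℝ≥0∞) < 1 := by
    rw [ENNReal.div_lt_iff] <;> norm_num
  have hm1 : m < 1 := max_lt ha h34
  have hsplit : (3 / 4 : ℝ≥0∞) = 2⁻¹ + 4⁻¹ := by
    rw [← ENNReal.toReal_eq_toReal_iff' (ENNReal.div_ne_top (by norm_num) (by norm_num))
      (by simp), ENNReal.toReal_add (by simp) (by simp)]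
    simp only [ENNReal.toReal_div, ENNReal.toReal_inv, ENNReal.toReal_ofNat]
    norm_num
  have key : ∀ k, b k ≤ (b 0 + 4 * C) * m ^ k := by
    intro k
    induction k with
    | zero => simp
    | succ k ih =>
      calc b (k + 1) ≤ 2⁻¹ * b k + C * a ^ k := h k
        _ ≤ 2⁻¹ * ((b 0 + 4 * C) * m ^ k) + C * m ^ k := by
            gcongr
            exact le_max_left _ _
        _ = 2⁻¹ * ((b 0 + 4 * C) * m ^ k) + 4⁻¹ * ((0 + 4 * C) * m ^ k) := by
            rw [zero_add, mul_assoc 4, ← mul_assoc 4⁻¹,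
              ENNReal.inv_mul_cancel (by norm_num) (by norm_num), one_mul]
        _ ≤ 2⁻¹ * ((b 0 + 4 * C) * m ^ k) + 4⁻¹ * ((b 0 + 4 * C) * m ^ k) := by
            gcongr
            exact zero_le
        _ = (3 / 4) * ((b 0 + 4 * C) * m ^ k) := by rw [hsplit]; ring
        _ ≤ m * ((b 0 + 4 * C) * m ^ k) := by
            gcongr
            exact le_max_right _ _
        _ = _ := by ring
  have hlim : Tendsto (fun k => (b 0 + 4 * C) * m ^ k) atTop (𝓝 ((b 0 + 4 * C) * 0)) :=
    ENNReal.Tendsto.const_mul (ENNReal.tendsto_pow_atTop_nhds_zero_of_lt_one hm1)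
      (Or.inr (ENNReal.add_ne_top.2 ⟨hb, ENNReal.mul_ne_top (by norm_num) (by simp)⟩))
  rw [mul_zero] at hlim
  exact tendsto_of_tendsto_of_tendsto_of_le_of_le tendsto_const_nhds hlim
    (fun _ => zero_le) key

/-- A bound by a null sequence on the dyadic intervals gives a limit along `ε ↓ 0`. -/
theorem tendsto_of_dyadic_bound {f : ℝ → ℝ≥0∞} {Ψ : ℕ → ℝ≥0∞} (hΨ : Tendsto Ψ atTop (𝓝 0))
    (h : ∀ (k : ℕ) (ε : ℝ), (1 / 2) ^ (k + 1) ≤ ε → ε ≤ (1 / 2) ^ k → f ε ≤ Ψ k) :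
    Tendsto f (𝓝[>] 0) (𝓝 0) := by
  rw [ENNReal.tendsto_nhds_zero] at hΨ ⊢
  intro η hη
  obtain ⟨K, hK⟩ := eventually_atTop.1 (hΨ η hη)
  have hpos : (0 : ℝ) < (1 / 2) ^ K := by positivity
  filter_upwards [Ioo_mem_nhdsGT hpos] with ε hε
  obtain ⟨k, hk1, hk2⟩ := exists_nat_pow_near_of_lt_one hε.1
    (hε.2.le.trans (pow_le_one₀ (by norm_num) (by norm_num)))
    (by norm_num : (0 : ℝ) < 1 / 2) (by norm_num)
  refine (h k ε hk1.le hk2).trans (hK k ?_)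
  have := (pow_lt_pow_iff_right_of_lt_one₀ (by norm_num : (0 : ℝ) < 1 / 2) (by norm_num)).1
    (hk1.trans hε.2)
  omega

end Limits

section Trace

variable {d : ℕ}

theorem eLpNorm_le_mul_lintegral_add_add {F : Type*} [NormedAddCommGroup F] {r : ℝ} (hr : 1 ≤ r)
    (ν : Measure (E d)) {h : E d → F} {J J' W : E d → ℝ≥0∞} (hJ : Measurable J)
    (hJ' : Measurable J') (hW : Measurable W) {c D : ℝ≥0∞}
    (hle : ∀ y, ‖h y‖ₑ ≤ c * (J y + J' y) + D * W y) :
    eLpNorm h (ENNReal.ofReal r) ν ≤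
      c * ((∫⁻ y, J y ^ r ∂ν) ^ (1 / r) + (∫⁻ y, J' y ^ r ∂ν) ^ (1 / r)) +
        D * (∫⁻ y, W y ^ r ∂ν) ^ (1 / r) := by
  have hr0 : 0 < r := by linarith
  have hmul : ∀ (b : ℝ≥0∞) {G : E d → ℝ≥0∞}, Measurable G →
      (∫⁻ y, (b * G y) ^ r ∂ν) ^ (1 / r) = b * (∫⁻ y, G y ^ r ∂ν) ^ (1 / r) := by
    intro b G hG
    simp only [ENNReal.mul_rpow_of_nonneg _ _ hr0.le]
    rw [lintegral_const_mul _ (hG.pow_const r), ENNReal.mul_rpow_of_nonneg _ _ (by positivity),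
      ← ENNReal.rpow_mul, mul_one_div_cancel hr0.ne', ENNReal.rpow_one]
  have h1 := eLpNorm_le_mul_lintegral_add hr ν ((hJ.add hJ').const_mul c) (hW.const_mul D)
    (c := 1) (h := h) (by simpa using hle)
  rw [one_mul, hmul c (hJ.add hJ'), hmul D hW] at h1
  refine h1.trans ?_
  gcongr
  exact ENNReal.lintegral_Lp_add_le hJ.aemeasurable hJ'.aemeasurable hr

theorem IsTrace.ae_eq {γ : ℕ} {r : ℝ} (hr : 1 ≤ r) {ζ u : Z d → ℝ} (hζ : IsMollifier ζ)
    (hu : LocallyIntegrable u) {g g' : E d → DVal d γ} (h : IsTrace γ r ζ u g)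
    (h' : IsTrace γ r ζ u g') : g' =ᵐ[volume] g := by
  have hs : 1 ≤ ENNReal.ofReal r := by
    rw [← ENNReal.ofReal_one]; exact ENNReal.ofReal_le_ofReal hr
  have hball : ∀ n : ℕ, g' =ᵐ[volume.restrict (Metric.ball (0 : E d) n)] g := by
    intro n
    set ν := volume.restrict (Metric.ball (0 : E d) n)
    have hgm := (h.1 0 n).1
    have hgm' := (h'.1 0 n).1
    have hle : ∀ᶠ ε : ℝ in 𝓝[>] 0, eLpNorm (g' - g) (ENNReal.ofReal r) ν ≤
        eLpNorm (fun y => sliceDeriv γ u (scaledKernel ζ ε) y - g y) (ENNReal.ofReal r) ν +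
        eLpNorm (fun y => sliceDeriv γ u (scaledKernel ζ ε) y - g' y) (ENNReal.ofReal r) ν := by
      filter_upwards [self_mem_nhdsWithin] with ε hε
      have hU : AEStronglyMeasurable (sliceDeriv γ u (scaledKernel ζ ε)) ν :=
        (continuous_sliceDeriv hu (contDiff_scaledKernel hζ.smooth ε)
          (hζ.hasCompactSupport_scaledKernel hε)).aestronglyMeasurable
      have e : g' - g = (sliceDeriv γ u (scaledKernel ζ ε) - g) -
          (sliceDeriv γ u (scaledKernel ζ ε) - g') := by abel
      rw [e]
      exact eLpNorm_sub_le (hU.sub hgm) (hU.sub hgm') hs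
    have hlim := (h.2 0 n).add (h'.2 0 n)
    rw [add_zero] at hlim
    have h0 : eLpNorm (g' - g) (ENNReal.ofReal r) ν ≤ 0 :=
      ge_of_tendsto hlim hle
    have := (eLpNorm_eq_zero_iff (hgm'.sub hgm) (by positivity)).1 (nonpos_iff_eq_zero.1 h0)
    filter_upwards [this] with y hy
    exact sub_eq_zero.1 hy
  have h1 : ∀ n : ℕ, ∀ᵐ y ∂(volume : Measure (E d)), y ∈ Metric.ball (0 : E d) n → g' y = g y :=
    fun n => (ae_restrict_iff' Metric.isOpen_ball.measurableSet).1 (hball n)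
  filter_upwards [ae_all_iff.2 h1] with y hy
  obtain ⟨n, hn⟩ := exists_nat_gt ‖y‖
  exact hy n (mem_ball_zero_iff.2 hn)

/-- The bound of `cylMass` in `L_r` over a ball, in the form in which it bounds the differences of
mollifications at scale `δ`: a factor `δ^{2 - κ}` with `κ = γ + d/p + 2/q - d/r` is gained. -/
theorem exists_lintegral_add_le_rpow {p q r : ℝ} (hp : 1 < p) (hq : 1 < q) (hr : p ≤ r)
    {f : Z d → ℝ} {f' : Z d → EuclideanSpace ℝ (Fin d × Fin d)} (hf : MemLpqLoc p q f)
    (hf' : MemLpqLoc p q f') (γ : ℕ) (C : ℝ≥0) (x : E d) (R : ℝ) :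
    ∃ C' : ℝ≥0, ∀ δ : ℝ, 0 < δ → δ ≤ 1 →
      C * ENNReal.ofReal δ ^ (-(d + γ : ℝ)) *
        ((∫⁻ y in Metric.ball x R, cylMass f δ y ^ r) ^ (1 / r) +
          (∫⁻ y in Metric.ball x R, cylMass f' δ y ^ r) ^ (1 / r)) ≤
        C' * ENNReal.ofReal δ ^ (2 - γ - (d / p + 2 / q - d / r)) := by
  obtain ⟨C₁, h₁⟩ := exists_lintegral_cylMass_le hp hq hr hf x R
  obtain ⟨C₂, h₂⟩ := exists_lintegral_cylMass_le hp hq hr hf' x R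
  refine ⟨C * (C₁ + C₂), fun δ hδ hδ1 => ?_⟩
  have h0 : ENNReal.ofReal δ ≠ 0 := by simpa using hδ
  refine (mul_le_mul' le_rfl (add_le_add (h₁ δ hδ hδ1) (h₂ δ hδ hδ1))).trans (le_of_eq ?_)
  rw [show (2 : ℝ) - γ - (d / p + 2 / q - d / r) =
    -(d + γ : ℝ) + (d + 2 - (d / p + 2 / q - d / r)) by ring,
    ENNReal.rpow_add _ _ h0 ENNReal.ofReal_ne_top]
  push_cast
  ring

theorem ofReal_half_pow_rpow (k : ℕ) (θ : ℝ) :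
    ENNReal.ofReal ((1 / 2) ^ k) ^ θ = (ENNReal.ofReal (1 / 2) ^ θ) ^ k := by
  rw [ENNReal.ofReal_pow (by norm_num), ← ENNReal.rpow_natCast, ← ENNReal.rpow_natCast,
    ← ENNReal.rpow_mul, ← ENNReal.rpow_mul, mul_comm]

theorem half_rpow_lt_one {θ : ℝ} (hθ : 0 < θ) : ENNReal.ofReal (1 / 2) ^ θ < 1 :=
  ENNReal.rpow_lt_one (by rw [ENNReal.ofReal_lt_one]; norm_num) hθ

theorem half_rpow_ne_zero {θ : ℝ} (hθ : 0 < θ) : ENNReal.ofReal (1 / 2) ^ θ ≠ 0 := by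
  rw [Ne, ENNReal.rpow_eq_zero_iff]
  simp [hθ.not_gt]

theorem tendsto_const_mul_pow {a : ℝ≥0∞} (ha : a < 1) (C : ℝ≥0) :
    Tendsto (fun k : ℕ => (C : ℝ≥0∞) * a ^ k) atTop (𝓝 0) := by
  have := ENNReal.Tendsto.const_mul (a := (C : ℝ≥0∞))
    (ENNReal.tendsto_pow_atTop_nhds_zero_of_lt_one ha) (Or.inr ENNReal.coe_ne_top)
  rwa [mul_zero] at this

theorem IsMollifier.continuous_sliceDeriv {ζ u : Z d → ℝ} (hζ : IsMollifier ζ)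
    (hu : LocallyIntegrable u) (γ : ℕ) {ε : ℝ} (hε : 0 < ε) :
    Continuous (sliceDeriv γ u (scaledKernel ζ ε)) :=
  ParabolicMorrey.continuous_sliceDeriv hu (contDiff_scaledKernel hζ.smooth ε)
    (hζ.hasCompactSupport_scaledKernel hε)

theorem eLpNorm_continuous_ball_ne_top {F : Type*} [NormedAddCommGroup F] {f : E d → F}
    (hf : Continuous f) (s : ℝ≥0∞) (x : E d) (R : ℝ) :
    eLpNorm f s (volume.restrict (Metric.ball x R)) ≠ ⊤ := by
  obtain ⟨M, hM⟩ := (isCompact_closedBall x R).exists_bound_of_continuousOn hf.continuousOn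
  have : IsFiniteMeasure (volume.restrict (Metric.ball x R)) :=
    ⟨by simpa using measure_ball_lt_top⟩
  refine (MemLp.of_bound hf.aestronglyMeasurable M ?_).2.ne
  filter_upwards [ae_restrict_mem Metric.isOpen_ball.measurableSet] with y hy
  exact hM y (Metric.ball_subset_closedBall hy)

theorem half_pow_pos (k : ℕ) : (0 : ℝ) < (1 / 2) ^ k := by positivity

theorem half_pow_le_one (k : ℕ) : ((1 : ℝ) / 2) ^ k ≤ 1 :=
  pow_le_one₀ (by norm_num) (by norm_num)

theorem half_pow_eq (k : ℕ) : ((1 : ℝ) / 2) ^ k = 2 * (1 / 2) ^ (k + 1) := by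
  rw [pow_succ]; ring

section

variable {p q β r : ℝ} {u ut : Z d → ℝ} {Du : Z d → E d}
  {D2u : Z d → EuclideanSpace ℝ (Fin d × Fin d)}

/-- Increments of the dyadic mollifications with a centered kernel decay geometrically in `L_r`
over balls. -/
theorem MemMorrey12.exists_eLpNorm_increment_le (hp : 1 < p) (hq : 1 < q) (hr : p ≤ r)
    (hmem : MemMorrey12 p q β u ut Du D2u) {γ : ℕ} (hγ : γ = 0 ∨ γ = 1) {ζ₀ : Z d → ℝ}
    (hζ₀ : IsMollifier ζ₀) (hcen : IsCentered ζ₀) (x : E d) (R : ℝ) :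
    ∃ C : ℝ≥0, ∀ k : ℕ,
      eLpNorm (sliceDeriv γ u (scaledKernel ζ₀ ((1 / 2) ^ (k + 1))) -
        sliceDeriv γ u (scaledKernel ζ₀ ((1 / 2) ^ k))) (ENNReal.ofReal r)
        (volume.restrict (Metric.ball x R)) ≤
      C * ENNReal.ofReal ((1 / 2) ^ k) ^ (2 - γ - (d / p + 2 / q - d / r)) := by
  obtain ⟨C₀, hC₀⟩ := hζ₀.enorm_sliceDeriv_sub_le hζ₀
  obtain ⟨C, hC⟩ := exists_lintegral_add_le_rpow hp hq hr hmem.mem_ut.1 hmem.mem_D2u.1 γ C₀ x R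
  refine ⟨C, fun k => (eLpNorm_le_mul_lintegral_add (by linarith) _
    (measurable_cylMass hmem.mem_ut.1.1 ((1 / 2) ^ k))
    (measurable_cylMass hmem.mem_D2u.1.1 ((1 / 2) ^ k)) fun y => ?_).trans
    (hC _ (half_pow_pos k) (half_pow_le_one k))⟩
  exact hC₀ γ hγ (fun _ => ⟨hcen, hcen⟩) p q β u ut Du D2u hmem _ _ _ (half_pow_pos (k + 1))
    (by linarith [half_pow_eq k, half_pow_pos (k + 1)]) (half_pow_eq k).le (half_pow_pos k) le_rfl
    (by linarith [half_pow_pos k]) y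

/-- Below the critical exponent for `u` itself, `δ ‖D u^{(δ)}(0, ·)‖_{L_r}` tends to zero along the
dyadic scales, although `D u^{(δ)}(0, ·)` may be unbounded. -/
theorem MemMorrey12.tendsto_mul_eLpNorm_sliceDeriv_one (hp : 1 < p) (hq : 1 < q) (hr : p ≤ r)
    (hκ : d / p + 2 / q < 2 + d / r) (hmem : MemMorrey12 p q β u ut Du D2u) {ζ₀ : Z d → ℝ}
    (hζ₀ : IsMollifier ζ₀) (hcen : IsCentered ζ₀) (x : E d) (R : ℝ) :
    Tendsto (fun k : ℕ => ENNReal.ofReal ((1 / 2) ^ k) *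
      eLpNorm (sliceDeriv 1 u (scaledKernel ζ₀ ((1 / 2) ^ k))) (ENNReal.ofReal r)
        (volume.restrict (Metric.ball x R))) atTop (𝓝 0) := by
  have hu := hmem.weak_ut.1
  have hs : 1 ≤ ENNReal.ofReal r := by
    rw [← ENNReal.ofReal_one]; exact ENNReal.ofReal_le_ofReal (by linarith)
  set ν := volume.restrict (Metric.ball x R) with hν
  set V : ℕ → E d → DVal d 1 := fun k => sliceDeriv 1 u (scaledKernel ζ₀ ((1 / 2) ^ k)) with hV
  have hVc : ∀ k, Continuous (V k) := fun k => hζ₀.continuous_sliceDeriv hu 1 (half_pow_pos k)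
  obtain ⟨C₁, hC₁⟩ := hmem.exists_eLpNorm_increment_le hp hq hr (Or.inr rfl) hζ₀ hcen x R
  have hθ : 0 < 2 - (d / p + 2 / q - d / r) := by linarith
  refine tendsto_zero_of_le_half_add
    (ENNReal.mul_ne_top ENNReal.ofReal_ne_top (eLpNorm_continuous_ball_ne_top (hVc 0) _ x R))
    (half_rpow_lt_one hθ) (C := C₁) fun k => ?_
  have htri : eLpNorm (V (k + 1)) (ENNReal.ofReal r) ν ≤
      eLpNorm (V k) (ENNReal.ofReal r) ν + eLpNorm (V (k + 1) - V k) (ENNReal.ofReal r) ν :=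
    eLpNorm_le_add_eLpNorm_sub hs (hVc (k + 1)).aestronglyMeasurable (hVc k).aestronglyMeasurable
  have hhalfk : ENNReal.ofReal ((1 / 2) ^ (k + 1)) = 2⁻¹ * ENNReal.ofReal ((1 / 2) ^ k) := by
    rw [pow_succ, mul_comm, ENNReal.ofReal_mul (by norm_num), one_div,
      ENNReal.ofReal_inv_of_pos (by norm_num)]
    simp
  have hD0 : ENNReal.ofReal ((1 / 2) ^ k) ≠ 0 := by
    simpa only [Ne, ENNReal.ofReal_eq_zero, not_le] using half_pow_pos k
  rw [← ofReal_half_pow_rpow, hhalfk]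
  refine (mul_le_mul' le_rfl (htri.trans (add_le_add le_rfl (hC₁ k)))).trans ?_
  set D := ENNReal.ofReal ((1 / 2) ^ k) with hD
  have hpow : D * D ^ (2 - ((1 : ℕ) : ℝ) - (d / p + 2 / q - d / r)) =
      D ^ (2 - (d / p + 2 / q - d / r)) := by
    conv_lhs => rw [← ENNReal.rpow_one D, ← ENNReal.rpow_mul,
      ← ENNReal.rpow_add _ _ hD0 ENNReal.ofReal_ne_top]
    congr 1
    push_cast
    ring
  calc _ = 2⁻¹ * (D * eLpNorm (V k) (ENNReal.ofReal r) ν) +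
        2⁻¹ * (C₁ * (D * D ^ (2 - ((1 : ℕ) : ℝ) - (d / p + 2 / q - d / r)))) := by ring
    _ ≤ 2⁻¹ * (D * eLpNorm (V k) (ENNReal.ofReal r) ν) +
        1 * (C₁ * (D * D ^ (2 - ((1 : ℕ) : ℝ) - (d / p + 2 / q - d / r)))) := by
        gcongr
        norm_num
    _ = _ := by rw [hpow, one_mul]

/-- Every mollification is close to that with a centered kernel at the next larger dyadic scale. -/
theorem MemMorrey12.exists_dyadic_comparison (hp : 1 < p) (hq : 1 < q) (hr : p ≤ r)
    (hmem : MemMorrey12 p q β u ut Du D2u) {γ : ℕ} (hγ : γ = 0 ∨ γ = 1)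
    (hκ : d / p + 2 / q < 2 - (γ : ℝ) + d / r) {ζ ζ₀ : Z d → ℝ}
    (hζ : IsMollifier ζ) (hζ₀ : IsMollifier ζ₀) (hcen : IsCentered ζ₀) (x : E d) (R : ℝ) :
    ∃ Ψ : ℕ → ℝ≥0∞, Tendsto Ψ atTop (𝓝 0) ∧
      ∀ (k : ℕ) (ε : ℝ), (1 / 2) ^ (k + 1) ≤ ε → ε ≤ (1 / 2) ^ k →
        eLpNorm (sliceDeriv γ u (scaledKernel ζ ε) -
          sliceDeriv γ u (scaledKernel ζ₀ ((1 / 2) ^ k))) (ENNReal.ofReal r)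
          (volume.restrict (Metric.ball x R)) ≤ Ψ k := by
  have hu := hmem.weak_ut.1
  have hr1 : 1 ≤ r := by linarith
  have hr0 : 0 < r := by linarith
  have hθ : 0 < 2 - γ - (d / p + 2 / q - d / r) := by linarith
  rcases hγ with rfl | rfl
  · have hlim := hmem.tendsto_mul_eLpNorm_sliceDeriv_one hp hq hr (by simpa using hκ) hζ₀ hcen x R
    obtain ⟨C₃, hC₃⟩ := hζ.enorm_sliceDeriv_zero_sub_le hζ₀ hcen
    obtain ⟨C₄, hC₄⟩ := exists_lintegral_add_le_rpow hp hq hr hmem.mem_ut.1 hmem.mem_D2u.1 0 C₃ x R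
    have hlim' := (tendsto_const_mul_pow (half_rpow_lt_one hθ) C₄).add hlim
    rw [add_zero] at hlim'
    refine ⟨_, hlim', fun k ε h1 h2 => ?_⟩
    have hε : 0 < ε := (half_pow_pos (k + 1)).trans_le h1
    refine (eLpNorm_le_mul_lintegral_add_add hr1 _ (measurable_cylMass hmem.mem_ut.1.1 ((1 / 2) ^ k))
      (measurable_cylMass hmem.mem_D2u.1.1 ((1 / 2) ^ k))
      (hζ₀.continuous_sliceDeriv hu 1 (half_pow_pos k)).enorm.measurable
      (hC₃ p q β u ut Du D2u hmem ε _ hε h2 (by linarith [half_pow_eq k]))).trans ?_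
    rw [← eLpNorm_ofReal_eq hr0, ← ofReal_half_pow_rpow]
    refine add_le_add ?_ le_rfl
    have := hC₄ _ (half_pow_pos k) (half_pow_le_one k)
    simp only [Nat.cast_zero, add_zero] at this ⊢
    exact this
  · obtain ⟨C₃, hC₃⟩ := hζ.enorm_sliceDeriv_sub_le hζ₀
    obtain ⟨C₄, hC₄⟩ := exists_lintegral_add_le_rpow hp hq hr hmem.mem_ut.1 hmem.mem_D2u.1 1 C₃ x R
    refine ⟨_, tendsto_const_mul_pow (half_rpow_lt_one hθ) C₄, fun k ε h1 h2 => ?_⟩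
    have hε : 0 < ε := (half_pow_pos (k + 1)).trans_le h1
    rw [← ofReal_half_pow_rpow]
    refine (eLpNorm_le_mul_lintegral_add hr1 _ (measurable_cylMass hmem.mem_ut.1.1 ((1 / 2) ^ k))
      (measurable_cylMass hmem.mem_D2u.1.1 ((1 / 2) ^ k)) fun y => ?_).trans
      (hC₄ _ (half_pow_pos k) (half_pow_le_one k))
    exact hC₃ 1 (Or.inr rfl) (fun h => absurd h one_ne_zero) p q β u ut Du D2u hmem _ _ _
      hε h2 (by linarith [half_pow_eq k]) (half_pow_pos k) le_rfl
      (by linarith [half_pow_pos k]) y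

/-- Existence of the trace. The limit is constructed with one centered kernel, along the dyadic
scales; all other kernels and scales are compared with it. -/
theorem MemMorrey12.exists_trace {γ : ℕ} (hp : 1 < p) (hq : 1 < q)
    (hγ : γ = 0 ∨ γ = 1) (hr : p ≤ r) (hκ : d / p + 2 / q < 2 - (γ : ℝ) + d / r)
    (hmem : MemMorrey12 p q β u ut Du D2u) :
    ∃ g : E d → DVal d γ, StronglyMeasurable g ∧
      ∀ ζ : Z d → ℝ, IsMollifier ζ → IsTrace γ r ζ u g := by
  obtain ⟨ζ₀, hζ₀, hcen⟩ := exists_isMollifier d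
  have hu := hmem.weak_ut.1
  have hs : 1 ≤ ENNReal.ofReal r := by
    rw [← ENNReal.ofReal_one]; exact ENNReal.ofReal_le_ofReal (by linarith)
  have hθ : 0 < 2 - γ - (d / p + 2 / q - d / r) := by linarith
  set U : ℕ → E d → DVal d γ := fun k => sliceDeriv γ u (scaledKernel ζ₀ ((1 / 2) ^ k)) with hU
  have hUc : ∀ k, Continuous (U k) := fun k => hζ₀.continuous_sliceDeriv hu γ (half_pow_pos k)
  obtain ⟨g, hgm, hg⟩ := exists_limit_of_geometric hs hUc (half_rpow_lt_one hθ)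
    (half_rpow_ne_zero hθ) fun x R => by
      obtain ⟨C, hC⟩ := hmem.exists_eLpNorm_increment_le hp hq hr hγ hζ₀ hcen x R
      exact ⟨C, fun k => (hC k).trans_eq (by rw [ofReal_half_pow_rpow])⟩
  refine ⟨g, hgm, fun ζ hζ => ⟨fun x R => (hg x R).1, fun x R => ?_⟩⟩
  obtain ⟨C₂, hC₂⟩ := (hg x R).2
  obtain ⟨Ψ, hΨ, hle⟩ := hmem.exists_dyadic_comparison hp hq hr hγ hκ hζ hζ₀ hcen x R
  have hlim := hΨ.add (tendsto_const_mul_pow (half_rpow_lt_one hθ) C₂)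
  rw [add_zero] at hlim
  refine tendsto_of_dyadic_bound hlim fun k ε h1 h2 => ?_
  have hε : 0 < ε := (half_pow_pos (k + 1)).trans_le h1
  have hUε := hζ.continuous_sliceDeriv hu γ hε
  have e : (fun y => sliceDeriv γ u (scaledKernel ζ ε) y - g y) =
      (sliceDeriv γ u (scaledKernel ζ ε) - U k) + (U k - g) := by
    rw [sub_add_sub_cancel]; rfl
  change eLpNorm (fun y => sliceDeriv γ u (scaledKernel ζ ε) y - g y) _ _ ≤ _
  rw [e]
  exact (eLpNorm_add_le (hUε.sub (hUc k)).aestronglyMeasurable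
    ((hUc k).aestronglyMeasurable.sub hgm.aestronglyMeasurable) hs).trans
    (add_le_add (hle k ε h1 h2) (hC₂ k))

end

end Trace

/-! ### Mollifications in normalized `L_r` norms -/

section Averages

variable {d : ℕ}

/-- The uniform probability measure on the ball `B_ρ(x)`. -/
noncomputable def ballMeasure (x : E d) (ρ : ℝ) : Measure (E d) :=
  (volume.restrict (Metric.ball x ρ) univ)⁻¹ • volume.restrict (Metric.ball x ρ)

theorem laverage_ball_eq (f : E d → ℝ≥0∞) (x : E d) (ρ : ℝ) :
    ⨍⁻ y in Metric.ball x ρ, f y ∂volume = ∫⁻ y, f y ∂(ballMeasure x ρ) := rfl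

theorem eLpNorm_ballMeasure {F : Type*} [NormedAddCommGroup F] {r : ℝ} (hr : 0 < r) (g : E d → F)
    (x : E d) (ρ : ℝ) :
    eLpNorm g (ENNReal.ofReal r) (ballMeasure x ρ) =
      (⨍⁻ y in Metric.ball x ρ, ‖g y‖ₑ ^ r ∂volume) ^ (1 / r) :=
  eLpNorm_ofReal_eq hr _ _

/-- Size of the mollifications at scale `δ`, and of their dyadic increments, in normalized `L_r`
norms. With `κ = γ + d/p + 2/q - d/r`, the increments are smaller by `δ²` since they involve the
second order derivatives of `u` only. -/
theorem IsMollifier.exists_eLpNorm_ballMeasure_le {ζ : Z d → ℝ} (hζ : IsMollifier ζ)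
    (hcen : IsCentered ζ) :
    ∃ C : ℝ≥0, ∀ γ : ℕ, γ = 0 ∨ γ = 1 → ∀ p q β r : ℝ, 1 < p → 1 < q → p ≤ r → 0 ≤ β →
      ∀ (u ut : Z d → ℝ) (Du : Z d → E d) (D2u : Z d → EuclideanSpace ℝ (Fin d × Fin d)),
      MemMorrey12 p q β u ut Du D2u → ∀ δ : ℝ, 0 < δ → 3 * δ ≤ 1 →
      ∀ ρ : ℝ, 0 < ρ → ρ ≤ 1 / 4 → ∀ x : E d,
        eLpNorm (sliceDeriv γ u (scaledKernel ζ δ)) (ENNReal.ofReal r) (ballMeasure x ρ) ≤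
          C * ENNReal.ofReal (δ ^ (-(γ + (d / p + 2 / q - d / r)) : ℝ) *
            max ρ δ ^ (d / p + 2 / q - d / r - β)) * morreyNorm p q β u ∧
        eLpNorm (sliceDeriv γ u (scaledKernel ζ (δ / 2)) - sliceDeriv γ u (scaledKernel ζ δ))
            (ENNReal.ofReal r) (ballMeasure x ρ) ≤
          C * ENNReal.ofReal (δ ^ (2 - (γ + (d / p + 2 / q - d / r)) : ℝ) *
            max ρ δ ^ (d / p + 2 / q - d / r - β)) *
            (morreyNorm p q β ut + morreyNorm p q β D2u) := by
  obtain ⟨C₁, h₁⟩ := hζ.enorm_sliceDeriv_le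
  obtain ⟨C₂, h₂⟩ := hζ.enorm_sliceDeriv_sub_le hζ
  set K : ℝ≥0∞ := unitVol d * 12 ^ ((d : ℝ) + 2) with hK
  have hKtop : K ≠ ⊤ := ENNReal.mul_ne_top (unitVol_ne_top d) (by
    exact ENNReal.rpow_ne_top_of_nonneg (by positivity) (by norm_num))
  refine ⟨(C₁ + C₂) * K.toNNReal, fun γ hγ p q β r hp hq hr hβ u ut Du D2u hmem δ hδ hδ1 ρ hρ hρ1
    x => ?_⟩
  have hr1 : 1 ≤ r := by linarith
  have hm : 0 < max ρ δ := lt_max_of_lt_left hρ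
  have h0 : ENNReal.ofReal δ ≠ 0 := by simpa using hδ
  have hpow : ∀ a b : ℝ, ENNReal.ofReal (δ ^ (a + b) * max ρ δ ^ (d / p + 2 / q - d / r - β)) =
      ENNReal.ofReal δ ^ a * (ENNReal.ofReal δ ^ b *
        ENNReal.ofReal (max ρ δ) ^ (d / p + 2 / q - d / r - β)) := by
    intro a b
    rw [ENNReal.ofReal_mul (by positivity), ← ENNReal.ofReal_rpow_of_pos hδ,
      ← ENNReal.ofReal_rpow_of_pos hm, ENNReal.rpow_add _ _ h0 ENNReal.ofReal_ne_top, mul_assoc]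
  rw [ENNReal.coe_mul, ENNReal.coe_add, ENNReal.coe_toNNReal hKtop]
  constructor
  · refine (eLpNorm_le_mul_lintegral hr1 _ (measurable_cylMass hmem.mem.1.1 δ)
      (h₁ γ hγ u hmem.weak_ut.1 δ hδ)).trans ?_
    rw [← laverage_ball_eq]
    refine (mul_le_mul' le_rfl
      (laverage_cylMass_le hp hq hr hβ hmem.mem.1.1 hδ hδ1 hρ hρ1 x)).trans ?_
    rw [show (-(γ + (d / p + 2 / q - d / r)) : ℝ) =
      -(d + 2 + γ : ℝ) + (d + 2 - (d / p + 2 / q - d / r)) by ring, hpow, ← hK]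
    calc _ = C₁ * K * (ENNReal.ofReal δ ^ (-(d + 2 + γ : ℝ)) *
          (ENNReal.ofReal δ ^ (d + 2 - (d / p + 2 / q - d / r)) *
            ENNReal.ofReal (max ρ δ) ^ (d / p + 2 / q - d / r - β))) * morreyNorm p q β u := by
          ring
      _ ≤ _ := by
          gcongr
          exact le_self_add
  · refine (eLpNorm_le_mul_lintegral_add hr1 _ (measurable_cylMass hmem.mem_ut.1.1 δ)
      (measurable_cylMass hmem.mem_D2u.1.1 δ)
      (h₂ γ hγ (fun _ => ⟨hcen, hcen⟩) p q β u ut Du D2u hmem (δ / 2) δ δ (by linarith)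
        (by linarith) (by linarith) hδ le_rfl (by linarith))).trans ?_
    rw [← laverage_ball_eq, ← laverage_ball_eq]
    refine (mul_le_mul' le_rfl (add_le_add
      (laverage_cylMass_le hp hq hr hβ hmem.mem_ut.1.1 hδ hδ1 hρ hρ1 x)
      (laverage_cylMass_le hp hq hr hβ hmem.mem_D2u.1.1 hδ hδ1 hρ hρ1 x))).trans ?_
    rw [show (2 - (γ + (d / p + 2 / q - d / r)) : ℝ) =
      -(d + γ : ℝ) + (d + 2 - (d / p + 2 / q - d / r)) by ring, hpow, ← hK]
    calc _ = C₂ * K * (ENNReal.ofReal δ ^ (-(d + γ : ℝ)) *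
          (ENNReal.ofReal δ ^ (d + 2 - (d / p + 2 / q - d / r)) *
            ENNReal.ofReal (max ρ δ) ^ (d / p + 2 / q - d / r - β))) *
            (morreyNorm p q β ut + morreyNorm p q β D2u) := by
          ring
      _ ≤ _ := by
          gcongr
          exact le_add_self

theorem half_pow_mul_div_two (δ : ℝ) (k : ℕ) : δ * (1 / 2) ^ k / 2 = δ * (1 / 2) ^ (k + 1) := by
  rw [pow_succ]; ring

/-- Telescoping along the dyadic scales below `δ`. -/
theorem IsTrace.eLpNorm_le_tsum {γ : ℕ} {r : ℝ} (hr : 1 ≤ r) {ζ u : Z d → ℝ} (hζ : IsMollifier ζ)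
    (hu : LocallyIntegrable u) {g : E d → DVal d γ} (h : IsTrace γ r ζ u g) {δ : ℝ} (hδ : 0 < δ)
    {ρ : ℝ} (hρ : 0 < ρ) (x : E d) :
    eLpNorm g (ENNReal.ofReal r) (ballMeasure x ρ) ≤
      eLpNorm (sliceDeriv γ u (scaledKernel ζ δ)) (ENNReal.ofReal r) (ballMeasure x ρ) +
      ∑' k : ℕ, eLpNorm (sliceDeriv γ u (scaledKernel ζ (δ * (1 / 2) ^ k / 2)) -
        sliceDeriv γ u (scaledKernel ζ (δ * (1 / 2) ^ k))) (ENNReal.ofReal r)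
        (ballMeasure x ρ) := by
  have hs : 1 ≤ ENNReal.ofReal r := by
    rw [← ENNReal.ofReal_one]; exact ENNReal.ofReal_le_ofReal hr
  set ν := ballMeasure x ρ with hν
  set U : ℕ → E d → DVal d γ := fun k => sliceDeriv γ u (scaledKernel ζ (δ * (1 / 2) ^ k)) with hU
  have hδk : ∀ k : ℕ, 0 < δ * (1 / 2) ^ k := fun k => mul_pos hδ (half_pow_pos k)
  have hUm : ∀ k, AEStronglyMeasurable (U k) ν := fun k =>
    (hζ.continuous_sliceDeriv hu γ (hδk k)).aestronglyMeasurable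
  have hc : (volume.restrict (Metric.ball x ρ) univ)⁻¹ ≠ (⊤ : ℝ≥0∞) := by
    rw [ENNReal.inv_ne_top, Measure.restrict_apply_univ]
    exact (Metric.measure_ball_pos _ x hρ).ne'
  have hgm : AEStronglyMeasurable g ν := (h.1 x ρ).1.smul_measure _
  have hlim : Tendsto (fun m => eLpNorm (U m - g) (ENNReal.ofReal r) ν) atTop (𝓝 0) := by
    have h1 : Tendsto (fun m : ℕ => δ * (1 / 2) ^ m) atTop (𝓝[>] (0 : ℝ)) := by
      refine tendsto_nhdsWithin_iff.2 ⟨?_, Eventually.of_forall hδk⟩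
      simpa using (tendsto_pow_atTop_nhds_zero_of_lt_one (by norm_num : (0 : ℝ) ≤ 1 / 2)
        (by norm_num)).const_mul δ
    have h2 := (h.2 x ρ).comp h1
    have hfin : ((volume.restrict (Metric.ball x ρ) univ)⁻¹) ^ (1 / (ENNReal.ofReal r)).toReal ≠ ⊤ :=
      ENNReal.rpow_ne_top_of_nonneg ENNReal.toReal_nonneg hc
    have h3 := ENNReal.Tendsto.const_mul h2 (Or.inr hfin)
    rw [mul_zero] at h3
    refine h3.congr fun m => ?_
    rw [hν, ballMeasure, eLpNorm_smul_measure_of_ne_top ENNReal.ofReal_ne_top]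
    rfl
  have hle : ∀ m, eLpNorm g (ENNReal.ofReal r) ν ≤ eLpNorm (U 0) (ENNReal.ofReal r) ν +
      (∑' k : ℕ, eLpNorm (U (k + 1) - U k) (ENNReal.ofReal r) ν) +
        eLpNorm (U m - g) (ENNReal.ofReal r) ν := by
    intro m
    have h1 := eLpNorm_le_add_eLpNorm_sub hs hgm (hUm m)
    have h2 := eLpNorm_le_add_eLpNorm_sub hs (hUm m) (hUm 0)
    have h3 := (eLpNorm_sub_le_sum_Ico hs hUm m.zero_le).trans (ENNReal.sum_le_tsum _)
    rw [eLpNorm_sub_comm] at h1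
    exact h1.trans (add_le_add (h2.trans (add_le_add le_rfl h3)) le_rfl)
  have hlim' := hlim.const_add (eLpNorm (U 0) (ENNReal.ofReal r) ν +
      (∑' k : ℕ, eLpNorm (U (k + 1) - U k) (ENNReal.ofReal r) ν))
  rw [add_zero] at hlim'
  have := ge_of_tendsto' hlim' hle
  simp only [half_pow_mul_div_two]
  simpa only [hU, pow_zero, mul_one] using this

end Averages

/-! ### Powers of the two length scales -/

section Scales

/-- The power counting behind the interpolation inequality, with `ρ` the radius of the ball and
`δ` the scale of the mollification. -/
theorem rpow_mul_max_rpow_le {ρ δ β γ s μ : ℝ} (hρ : 0 < ρ) (hδ : 0 < δ) (hb : 0 ≤ β + γ - μ)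
    (hs : γ + s ≤ μ) :
    ρ ^ (β + γ - μ) * (δ ^ (-(γ + s)) * max ρ δ ^ (s - β)) ≤ δ ^ (-μ) := by
  have hm : 0 < max ρ δ := lt_max_of_lt_left hρ
  calc ρ ^ (β + γ - μ) * (δ ^ (-(γ + s)) * max ρ δ ^ (s - β))
      ≤ max ρ δ ^ (β + γ - μ) * (δ ^ (-(γ + s)) * max ρ δ ^ (s - β)) := by
        gcongr
        exact le_max_left _ _
    _ = δ ^ (-(γ + s)) * max ρ δ ^ (γ + s - μ) := by
        rw [show γ + s - μ = (β + γ - μ) + (s - β) by ring, Real.rpow_add hm]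
        ring
    _ ≤ δ ^ (-(γ + s)) * δ ^ (γ + s - μ) := by
        gcongr ?_ * ?_
        exact Real.rpow_le_rpow_of_nonpos hδ (le_max_right _ _) (by linarith)
    _ = δ ^ (-μ) := by
        rw [← Real.rpow_add hδ]
        ring_nf

theorem rpow_mul_sq_mul_max_rpow_le {ρ δ β γ s μ : ℝ} (hρ : 0 < ρ) (hδ : 0 < δ)
    (hb : 0 ≤ β + γ - μ) (hs : γ + s ≤ μ) :
    ρ ^ (β + γ - μ) * (δ ^ (2 - (γ + s)) * max ρ δ ^ (s - β)) ≤ δ ^ (2 - μ) := by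
  have h := mul_le_mul_of_nonneg_left (rpow_mul_max_rpow_le hρ hδ hb hs)
    (Real.rpow_nonneg hδ.le 2)
  rw [← Real.rpow_add hδ] at h
  calc ρ ^ (β + γ - μ) * (δ ^ (2 - (γ + s)) * max ρ δ ^ (s - β))
      = δ ^ (2 : ℝ) * (ρ ^ (β + γ - μ) * (δ ^ (-(γ + s)) * max ρ δ ^ (s - β))) := by
        rw [show 2 - (γ + s) = 2 + -(γ + s) by ring, Real.rpow_add hδ]
        ring
    _ ≤ δ ^ (2 + -μ) := h
    _ = _ := by ring_nf

theorem rpow_mul_max_rpow_le_div_of_le {ρ δ β γ s θ : ℝ} (hρ : 0 < ρ) (hδ : 0 < δ) (h : ρ ≤ δ)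
    (hθ : θ ≤ β + γ - 2) :
    ρ ^ (β + γ - 2) * (δ ^ (2 - (γ + s)) * max ρ δ ^ (s - β)) ≤ (ρ / δ) ^ θ := by
  rw [max_eq_right h, ← Real.rpow_add hδ, show 2 - (γ + s) + (s - β) = -(β + γ - 2) by ring,
    Real.rpow_neg hδ.le, ← div_eq_mul_inv, ← Real.div_rpow hρ.le hδ.le]
  exact Real.rpow_le_rpow_of_exponent_ge (by positivity) ((div_le_one hδ).2 h) hθ

theorem rpow_mul_max_rpow_le_div_of_ge {ρ δ β γ s θ : ℝ} (hρ : 0 < ρ) (hδ : 0 < δ) (h : δ ≤ ρ)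
    (hθ : θ ≤ 2 - (γ + s)) :
    ρ ^ (β + γ - 2) * (δ ^ (2 - (γ + s)) * max ρ δ ^ (s - β)) ≤ (δ / ρ) ^ θ := by
  rw [max_eq_left h, mul_left_comm, ← Real.rpow_add hρ,
    show β + γ - 2 + (s - β) = -(2 - (γ + s)) by ring,
    Real.rpow_neg hρ.le, ← div_eq_mul_inv, ← Real.div_rpow hδ.le hρ.le]
  exact Real.rpow_le_rpow_of_exponent_ge (by positivity) ((div_le_one hρ).2 h) hθ

/-- A two-sided geometric series, centred at the dyadic scale closest to `ρ`. -/
theorem tsum_ofReal_le_of_two_sided {ρ δ θ : ℝ} (hρ : 0 < ρ) (hρδ : ρ ≤ δ) (hθ : 0 < θ)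
    {T : ℝ → ℝ} (h₁ : ∀ η, 0 < η → ρ ≤ η → T η ≤ (ρ / η) ^ θ)
    (h₂ : ∀ η, 0 < η → η ≤ ρ → T η ≤ (η / ρ) ^ θ) :
    ∑' k : ℕ, ENNReal.ofReal (T (δ * (1 / 2) ^ k)) ≤
      2 * (1 - ENNReal.ofReal (1 / 2) ^ θ)⁻¹ := by
  have hδ : 0 < δ := hρ.trans_le hρδ
  set a := ENNReal.ofReal (1 / 2) ^ θ with ha
  obtain ⟨n, hn1, hn2⟩ := exists_nat_pow_near_of_lt_one (div_pos hρ hδ) ((div_le_one hδ).2 hρδ)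
    (by norm_num : (0 : ℝ) < 1 / 2) (by norm_num)
  rw [lt_div_iff₀ hδ] at hn1
  rw [div_le_iff₀ hδ] at hn2
  have hbound : ∀ (j : ℕ) (t : ℝ), 0 ≤ t → t ≤ (1 / 2) ^ j → ENNReal.ofReal (t ^ θ) ≤ a ^ j := by
    intro j t ht htj
    rw [← ENNReal.ofReal_rpow_of_nonneg ht hθ.le, ha, ← ofReal_half_pow_rpow]
    exact ENNReal.rpow_le_rpow (ENNReal.ofReal_le_ofReal htj) hθ.le
  have hcoarse : ∀ k, k ≤ n → ENNReal.ofReal (T (δ * (1 / 2) ^ k)) ≤ a ^ (n - k) := by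
    intro k hk
    have hη : 0 < δ * (1 / 2) ^ k := mul_pos hδ (half_pow_pos k)
    have hsplit : ((1 : ℝ) / 2) ^ n = (1 / 2) ^ (n - k) * (1 / 2) ^ k := by
      rw [← pow_add, Nat.sub_add_cancel hk]
    have hle : ρ ≤ δ * (1 / 2) ^ k := by
      refine hn2.trans ?_
      rw [mul_comm]
      gcongr ?_ * ?_
      exact pow_le_pow_of_le_one (by norm_num) (by norm_num) hk
    refine (ENNReal.ofReal_le_ofReal (h₁ _ hη hle)).trans (hbound _ _ (by positivity) ?_)
    rw [div_le_iff₀ hη]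
    calc ρ ≤ (1 / 2) ^ n * δ := hn2
      _ = _ := by rw [hsplit]; ring
  have hfine : ∀ j, ENNReal.ofReal (T (δ * (1 / 2) ^ (j + (n + 1)))) ≤ a ^ j := by
    intro j
    have hη : 0 < δ * (1 / 2) ^ (j + (n + 1)) := mul_pos hδ (half_pow_pos _)
    have hle' : δ * (1 / 2) ^ (j + (n + 1)) ≤ (1 / 2) ^ j * ρ := by
      calc δ * (1 / 2) ^ (j + (n + 1)) = (1 / 2) ^ j * ((1 / 2) ^ (n + 1) * δ) := by
            rw [pow_add]; ring
        _ ≤ _ := by gcongr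
    have hle : δ * (1 / 2) ^ (j + (n + 1)) ≤ ρ :=
      hle'.trans (mul_le_of_le_one_left hρ.le (half_pow_le_one j))
    refine (ENNReal.ofReal_le_ofReal (h₂ _ hη hle)).trans (hbound _ _ (by positivity) ?_)
    rwa [div_le_iff₀ hρ]
  set f : ℕ → ℝ≥0∞ := fun k => ENNReal.ofReal (T (δ * (1 / 2) ^ k)) with hf
  have hsum : ∑' k, f k = ∑ k ∈ Finset.range (n + 1), f k + ∑' j, f (j + (n + 1)) :=
    ((ENNReal.summable (f := fun j => f (j + (n + 1)))).sum_add_tsum_nat_add').symm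
  rw [hsum, two_mul]
  refine add_le_add ?_ ?_
  · calc ∑ k ∈ Finset.range (n + 1), f k
        ≤ ∑ k ∈ Finset.range (n + 1), a ^ (n + 1 - 1 - k) := by
          refine Finset.sum_le_sum fun k hk => ?_
          exact hcoarse k (Nat.lt_succ_iff.1 (Finset.mem_range.1 hk))
      _ = ∑ k ∈ Finset.range (n + 1), a ^ k := Finset.sum_range_reflect _ _
      _ ≤ ∑' k, a ^ k := ENNReal.sum_le_tsum _
      _ = _ := ENNReal.tsum_geometric a
  · calc ∑' j, f (j + (n + 1)) ≤ ∑' j, a ^ j :=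
          ENNReal.tsum_le_tsum hfine
      _ = _ := ENNReal.tsum_geometric a

end Scales

/-! ### Morrey norms of the trace -/

section Estimates

variable {d : ℕ}

theorem ellipticMorreyNorm_le_of_quarter {F : Type*} [NormedAddCommGroup F] {r b : ℝ} (hr : 1 ≤ r)
    {g : E d → F} (hg : StronglyMeasurable g) {K : ℝ≥0∞}
    (h : ∀ ρ, 0 < ρ → ρ ≤ 1 / 4 → ∀ x,
      ENNReal.ofReal (ρ ^ b) * eLpNorm g (ENNReal.ofReal r) (ballMeasure x ρ) ≤ K) :
    ellipticMorreyNorm r b g ≤ 2 ^ d * ENNReal.ofReal (4 ^ b) * K := by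
  refine iSup_le fun ρ => iSup_le fun hρ => iSup_le fun x => ?_
  obtain ⟨hρ0, hρ1⟩ := hρ
  have hq0 : 0 < ρ / 4 := by positivity
  have hpos : 0 < (ρ / 4) ^ b := Real.rpow_pos_of_pos hq0 b
  have h0 : ENNReal.ofReal ((ρ / 4) ^ b) ≠ 0 := by simpa using hpos
  have hc := laverage_rpow_le_quarter hr hρ0 x hg.enorm
    (c := (ENNReal.ofReal ((ρ / 4) ^ b))⁻¹ * K) fun y => by
      rw [← eLpNorm_ballMeasure (by linarith), mul_comm, ← div_eq_mul_inv,
        ENNReal.le_div_iff_mul_le (Or.inl h0) (Or.inl ENNReal.ofReal_ne_top), mul_comm]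
      exact h _ hq0 (by linarith) y
  refine (mul_le_mul' le_rfl hc).trans (le_of_eq ?_)
  have hsplit : ENNReal.ofReal (ρ ^ b) = ENNReal.ofReal (4 ^ b) * ENNReal.ofReal ((ρ / 4) ^ b) := by
    rw [← ENNReal.ofReal_mul (by positivity), ← Real.mul_rpow (by norm_num) hq0.le,
      mul_div_cancel₀ _ (by norm_num : (4 : ℝ) ≠ 0)]
  calc _ = 2 ^ d * ENNReal.ofReal (4 ^ b) *
        (ENNReal.ofReal ((ρ / 4) ^ b) * (ENNReal.ofReal ((ρ / 4) ^ b))⁻¹) * K := by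
        rw [hsplit]; ring
    _ = _ := by rw [ENNReal.mul_inv_cancel h0 ENNReal.ofReal_ne_top, mul_one]

theorem ofReal_mul_mul_le {a b c : ℝ} (ha : 0 ≤ a) (h : a * b ≤ c) (C X : ℝ≥0∞) :
    ENNReal.ofReal a * (C * ENNReal.ofReal b * X) ≤ C * ENNReal.ofReal c * X := by
  calc _ = C * ENNReal.ofReal (a * b) * X := by rw [ENNReal.ofReal_mul ha]; ring
    _ ≤ _ := by gcongr

theorem tsum_ofReal_rpow_dyadic {δ : ℝ} (hδ : 0 < δ) (θ : ℝ) :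
    ∑' k : ℕ, ENNReal.ofReal ((δ * (1 / 2) ^ k) ^ θ) =
      ENNReal.ofReal (δ ^ θ) * (1 - ENNReal.ofReal (1 / 2) ^ θ)⁻¹ := by
  rw [← ENNReal.tsum_geometric, ← ENNReal.tsum_mul_left]
  refine tsum_congr fun k => ?_
  rw [Real.mul_rpow hδ.le (half_pow_pos k).le, ENNReal.ofReal_mul (by positivity),
    ← ENNReal.ofReal_rpow_of_pos (half_pow_pos k), ofReal_half_pow_rpow]

theorem inv_one_sub_half_rpow_ne_top {θ : ℝ} (hθ : 0 < θ) :
    (1 - ENNReal.ofReal (1 / 2) ^ θ)⁻¹ ≠ ⊤ :=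
  ENNReal.inv_ne_top.2 (tsub_pos_of_lt (half_rpow_lt_one hθ)).ne'

/-- The trace on small balls, estimated by mollification at the scale `δ` and by the increments at
the smaller dyadic scales, with one constant for all exponents. -/
theorem exists_ofReal_mul_eLpNorm_trace_le (d : ℕ) :
    ∃ C : ℝ≥0, ∀ γ : ℕ, γ = 0 ∨ γ = 1 → ∀ p q β r : ℝ, 1 < p → 1 < q → p ≤ r → 0 ≤ β →
      ∀ (u ut : Z d → ℝ) (Du : Z d → E d) (D2u : Z d → EuclideanSpace ℝ (Fin d × Fin d)),
      MemMorrey12 p q β u ut Du D2u → ∀ g : E d → DVal d γ,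
      (∀ ζ, IsMollifier ζ → IsTrace γ r ζ u g) → ∀ δ : ℝ, 0 < δ → 3 * δ ≤ 1 →
      ∀ ρ : ℝ, 0 < ρ → ρ ≤ 1 / 4 → ∀ (x : E d) (b c : ℝ) (T : ℝ → ℝ),
        ρ ^ b * (δ ^ (-(γ + (d / p + 2 / q - d / r)) : ℝ) *
            max ρ δ ^ (d / p + 2 / q - d / r - β)) ≤ c →
        (∀ η, 0 < η → ρ ^ b * (η ^ (2 - (γ + (d / p + 2 / q - d / r)) : ℝ) *
            max ρ η ^ (d / p + 2 / q - d / r - β)) ≤ T η) →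
        ENNReal.ofReal (ρ ^ b) * eLpNorm g (ENNReal.ofReal r) (ballMeasure x ρ) ≤
          C * ENNReal.ofReal c * morreyNorm p q β u +
          C * (∑' k : ℕ, ENNReal.ofReal (T (δ * (1 / 2) ^ k))) *
            (morreyNorm p q β ut + morreyNorm p q β D2u) := by
  obtain ⟨ζ, hζ, hcen⟩ := exists_isMollifier d
  obtain ⟨C, hC⟩ := hζ.exists_eLpNorm_ballMeasure_le hcen
  refine ⟨C, fun γ hγ p q β r hp hq hr hβ u ut Du D2u hmem g hg δ hδ hδ1 ρ hρ hρ1 x b c T hc hT =>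
    ?_⟩
  have hb : 0 ≤ ρ ^ b := by positivity
  have hδk : ∀ k : ℕ, 0 < δ * (1 / 2) ^ k := fun k => mul_pos hδ (half_pow_pos k)
  refine (mul_le_mul' le_rfl ((hg ζ hζ).eLpNorm_le_tsum (by linarith) hζ hmem.weak_ut.1 hδ hρ
    x)).trans ?_
  rw [mul_add, ← ENNReal.tsum_mul_left, ← ENNReal.tsum_mul_left, ← ENNReal.tsum_mul_right]
  refine add_le_add ?_ (ENNReal.tsum_le_tsum fun k => ?_)
  · exact (mul_le_mul' le_rfl (hC γ hγ p q β r hp hq hr hβ u ut Du D2u hmem δ hδ hδ1 ρ hρ hρ1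
      x).1).trans (ofReal_mul_mul_le hb hc _ _)
  · have hle : 3 * (δ * (1 / 2) ^ k) ≤ 1 := by
      have := mul_le_of_le_one_right hδ.le (half_pow_le_one k)
      linarith
    exact (mul_le_mul' le_rfl (hC γ hγ p q β r hp hq hr hβ u ut Du D2u hmem _ (hδk k) hle ρ hρ hρ1
      x).2).trans (ofReal_mul_mul_le hb (hT _ (hδk k)) _ _)

/-- The interpolation inequality: mollification at the scale `ε^{1/(2-μ)} / 3`. -/
theorem exists_interpolation (d γ : ℕ) (hγ : γ = 0 ∨ γ = 1) {p q β μ : ℝ} (hp : 1 < p) (hq : 1 < q)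
    (hμ : μ < 2) (hβ0 : 0 ≤ β) (hβ : 2 - (γ : ℝ) < β) :
    ∃ N : ℝ≥0, ∀ r : ℝ, p ≤ r → (γ : ℝ) + d / p + 2 / q - d / r ≤ μ →
      ∀ (u ut : Z d → ℝ) (Du : Z d → E d) (D2u : Z d → EuclideanSpace ℝ (Fin d × Fin d)),
      MemMorrey12 p q β u ut Du D2u → ∀ g : E d → DVal d γ, StronglyMeasurable g →
      (∀ ζ, IsMollifier ζ → IsTrace γ r ζ u g) → ∀ ε : ℝ, 0 < ε → ε ≤ 1 →
        ellipticMorreyNorm r (β + γ - μ) g ≤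
          N * ENNReal.ofReal ε * (morreyNorm p q β ut + morreyNorm p q β D2u) +
          N * ENNReal.ofReal (ε ^ (-μ / (2 - μ))) * morreyNorm p q β u := by
  obtain ⟨C, hC⟩ := exists_ofReal_mul_eLpNorm_trace_le d
  have hθ : 0 < 2 - μ := by linarith
  set S : ℝ≥0∞ := (1 - ENNReal.ofReal (1 / 2) ^ (2 - μ))⁻¹ with hS
  have hStop : S ≠ ⊤ := inv_one_sub_half_rpow_ne_top hθ
  set Q : ℝ≥0∞ := 2 ^ d * ENNReal.ofReal (4 ^ (β + γ - μ)) with hQ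
  have hQtop : Q ≠ ⊤ := ENNReal.mul_ne_top (by simp) ENNReal.ofReal_ne_top
  set N : ℝ≥0∞ := Q * (C * (ENNReal.ofReal (3 ^ μ) + S)) with hN
  have hNtop : N ≠ ⊤ := ENNReal.mul_ne_top hQtop (ENNReal.mul_ne_top ENNReal.coe_ne_top
    (ENNReal.add_ne_top.2 ⟨ENNReal.ofReal_ne_top, hStop⟩))
  refine ⟨N.toNNReal, fun r hr hκ u ut Du D2u hmem g hgm hg ε hε hε1 => ?_⟩
  rw [ENNReal.coe_toNNReal hNtop]
  set τ : ℝ := ε ^ (1 / (2 - μ)) with hτ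
  have hτ0 : 0 < τ := Real.rpow_pos_of_pos hε _
  have hτ1 : τ ≤ 1 := Real.rpow_le_one hε.le hε1 (by positivity)
  have hδ : 0 < τ / 3 := by positivity
  have hs : (γ : ℝ) + (d / p + 2 / q - d / r) ≤ μ := by linarith
  have hb : 0 ≤ β + γ - μ := by linarith
  have e1 : (τ / 3) ^ (-μ) = 3 ^ μ * ε ^ (-μ / (2 - μ)) := by
    rw [Real.div_rpow hτ0.le (by norm_num), Real.rpow_neg (by norm_num : (0 : ℝ) ≤ 3), hτ,
      ← Real.rpow_mul hε.le, div_inv_eq_mul, mul_comm]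
    congr 2
    ring
  have e2 : (τ / 3) ^ (2 - μ) ≤ ε := by
    calc (τ / 3) ^ (2 - μ) ≤ τ ^ (2 - μ) :=
          Real.rpow_le_rpow hδ.le (by linarith) hθ.le
      _ = ε := by
          rw [hτ, ← Real.rpow_mul hε.le, one_div_mul_cancel hθ.ne', Real.rpow_one]
  have key : ∀ ρ, 0 < ρ → ρ ≤ 1 / 4 → ∀ x, ENNReal.ofReal (ρ ^ (β + γ - μ)) *
      eLpNorm g (ENNReal.ofReal r) (ballMeasure x ρ) ≤
        C * ENNReal.ofReal (3 ^ μ * ε ^ (-μ / (2 - μ))) * morreyNorm p q β u +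
          C * (ENNReal.ofReal ε * S) * (morreyNorm p q β ut + morreyNorm p q β D2u) := by
    intro ρ hρ hρ1 x
    refine (hC γ hγ p q β r hp hq hr hβ0 u ut Du D2u hmem g hg (τ / 3) hδ (by linarith) ρ hρ hρ1 x
      (β + γ - μ) _ (fun η => η ^ (2 - μ)) (rpow_mul_max_rpow_le hρ hδ hb hs)
      fun η hη => rpow_mul_sq_mul_max_rpow_le hρ hη hb hs).trans ?_
    rw [tsum_ofReal_rpow_dyadic hδ, e1]
    gcongr
  refine (ellipticMorreyNorm_le_of_quarter (by linarith) hgm key).trans ?_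
  rw [← hQ, mul_add, add_comm, ENNReal.ofReal_mul (by positivity)]
  refine add_le_add ?_ ?_
  · calc _ = Q * (C * S) * ENNReal.ofReal ε * (morreyNorm p q β ut + morreyNorm p q β D2u) := by
          ring
      _ ≤ _ := by
          gcongr
          exact mul_le_mul' le_rfl (mul_le_mul' le_rfl le_add_self)
  · calc _ = Q * (C * ENNReal.ofReal (3 ^ μ)) * ENNReal.ofReal (ε ^ (-μ / (2 - μ))) *
          morreyNorm p q β u := by
          ring
      _ ≤ _ := by
          gcongr
          exact mul_le_mul' le_rfl (mul_le_mul' le_rfl le_self_add)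

/-- The scale invariant estimate. At the exponent `β + γ - 2` the scales `δ` with `δ ≤ ρ` contribute
`(δ/ρ)^{2-κ}` and those with `ρ ≤ δ` contribute `(ρ/δ)^{β+γ-2}`, so that the sum over all dyadic
scales is bounded uniformly in `ρ`. -/
theorem exists_ellipticMorreyNorm_trace_le (d γ : ℕ) (hγ : γ = 0 ∨ γ = 1) {p q β μ : ℝ}
    (hp : 1 < p) (hq : 1 < q) (hμ : μ < 2) (hβ0 : 0 ≤ β) (hβ : 2 - (γ : ℝ) < β) :
    ∃ N : ℝ≥0, ∀ r : ℝ, p ≤ r → (γ : ℝ) + d / p + 2 / q - d / r ≤ μ →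
      ∀ (u ut : Z d → ℝ) (Du : Z d → E d) (D2u : Z d → EuclideanSpace ℝ (Fin d × Fin d)),
      MemMorrey12 p q β u ut Du D2u → ∀ g : E d → DVal d γ, StronglyMeasurable g →
      (∀ ζ, IsMollifier ζ → IsTrace γ r ζ u g) →
        ellipticMorreyNorm r (β + γ - 2) g ≤ N * morrey12Norm p q β u ut Du D2u := by
  obtain ⟨C, hC⟩ := exists_ofReal_mul_eLpNorm_trace_le d
  set θ : ℝ := min (β + γ - 2) (2 - μ) with hθdef
  have hθ : 0 < θ := lt_min (by linarith) (by linarith)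
  set S : ℝ≥0∞ := 2 * (1 - ENNReal.ofReal (1 / 2) ^ θ)⁻¹ with hS
  have hStop : S ≠ ⊤ := ENNReal.mul_ne_top (by norm_num) (inv_one_sub_half_rpow_ne_top hθ)
  set Q : ℝ≥0∞ := 2 ^ d * ENNReal.ofReal (4 ^ (β + γ - 2)) with hQ
  have hQtop : Q ≠ ⊤ := ENNReal.mul_ne_top (by simp) ENNReal.ofReal_ne_top
  set c : ℝ := (1 / 3) ^ (-2 : ℝ) with hc
  set N : ℝ≥0∞ := Q * (C * (ENNReal.ofReal c + S)) with hN
  have hNtop : N ≠ ⊤ := ENNReal.mul_ne_top hQtop (ENNReal.mul_ne_top ENNReal.coe_ne_top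
    (ENNReal.add_ne_top.2 ⟨ENNReal.ofReal_ne_top, hStop⟩))
  refine ⟨N.toNNReal, fun r hr hκ u ut Du D2u hmem g hgm hg => ?_⟩
  rw [ENNReal.coe_toNNReal hNtop]
  have hs : (γ : ℝ) + (d / p + 2 / q - d / r) ≤ μ := by linarith
  have key : ∀ ρ, 0 < ρ → ρ ≤ 1 / 4 → ∀ x, ENNReal.ofReal (ρ ^ (β + γ - 2)) *
      eLpNorm g (ENNReal.ofReal r) (ballMeasure x ρ) ≤
        C * ENNReal.ofReal c * morreyNorm p q β u +
          C * S * (morreyNorm p q β ut + morreyNorm p q β D2u) := by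
    intro ρ hρ hρ1 x
    refine (hC γ hγ p q β r hp hq hr hβ0 u ut Du D2u hmem g hg (1 / 3) (by norm_num) (by norm_num)
      ρ hρ hρ1 x (β + γ - 2) c (fun η => ρ ^ (β + γ - 2) *
        (η ^ (2 - (γ + (d / p + 2 / q - d / r)) : ℝ) * max ρ η ^ (d / p + 2 / q - d / r - β)))
      (rpow_mul_max_rpow_le hρ (by norm_num) (by linarith) (by linarith))
      fun η _ => le_rfl).trans ?_
    gcongr
    exact tsum_ofReal_le_of_two_sided hρ (by linarith) hθ
      (fun η hη h => rpow_mul_max_rpow_le_div_of_le hρ hη h (min_le_left _ _))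
      (fun η hη h => rpow_mul_max_rpow_le_div_of_ge hρ hη h
        ((min_le_right _ _).trans (by linarith)))
  refine (ellipticMorreyNorm_le_of_quarter (by linarith) hgm key).trans ?_
  rw [← hQ, hN, mul_assoc Q, mul_assoc (C : ℝ≥0∞), mul_assoc (C : ℝ≥0∞), mul_assoc (C : ℝ≥0∞),
    ← mul_add, add_mul]
  refine mul_le_mul' le_rfl (mul_le_mul' le_rfl (add_le_add ?_ ?_)) <;>
    refine mul_le_mul' le_rfl ?_ <;> unfold morrey12Norm
  · exact le_self_add.trans (le_self_add.trans le_self_add)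
  · rw [add_comm (morreyNorm p q β ut)]
    exact add_le_add le_add_self le_rfl

theorem morrey12Norm_lt_top {p q β : ℝ} {u ut : Z d → ℝ} {Du : Z d → E d}
    {D2u : Z d → EuclideanSpace ℝ (Fin d × Fin d)} (h : MemMorrey12 p q β u ut Du D2u) :
    morrey12Norm p q β u ut Du D2u < ⊤ :=
  ENNReal.add_lt_top.2 ⟨ENNReal.add_lt_top.2 ⟨ENNReal.add_lt_top.2 ⟨h.mem.2, h.mem_Du.2⟩,
    h.mem_D2u.2⟩, h.mem_ut.2⟩

/-- Both estimates for a fixed order `γ` of differentiation, with a constant independent of `r`. -/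
theorem exists_trace_estimates (d γ : ℕ) (hγ : γ = 0 ∨ γ = 1) {p q : ℝ} (β : ℝ) {μ : ℝ}
    (hp : 1 < p) (hq : 1 < q) (hμ : μ < 2) :
    ∃ N : ℝ≥0, 2 - (γ : ℝ) < β → ∀ r : ℝ, p ≤ r → (γ : ℝ) + d / p + 2 / q - d / r ≤ μ →
      ∀ (u ut : Z d → ℝ) (Du : Z d → E d) (D2u : Z d → EuclideanSpace ℝ (Fin d × Fin d)),
      MemMorrey12 p q β u ut Du D2u → ∀ g : E d → DVal d γ, StronglyMeasurable g →
      (∀ ζ, IsMollifier ζ → IsTrace γ r ζ u g) →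
        (∀ ε : ℝ, 0 < ε → ε ≤ 1 → ellipticMorreyNorm r (β + γ - μ) g ≤
          N * ENNReal.ofReal ε * (morreyNorm p q β ut + morreyNorm p q β D2u) +
          N * ENNReal.ofReal (ε ^ (-μ / (2 - μ))) * morreyNorm p q β u) ∧
        ellipticMorreyNorm r (β + γ - 2) g ≤ N * morrey12Norm p q β u ut Du D2u := by
  by_cases hβ : 2 - (γ : ℝ) < β
  · have hγ1 : (γ : ℝ) ≤ 1 := by rcases hγ with rfl | rfl <;> norm_num
    have hβ0 : 0 ≤ β := by linarith
    obtain ⟨N₁, h₁⟩ := exists_interpolation d γ hγ hp hq hμ hβ0 hβ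
    obtain ⟨N₂, h₂⟩ := exists_ellipticMorreyNorm_trace_le d γ hγ hp hq hμ hβ0 hβ
    refine ⟨N₁ + N₂, fun _ r hr hκ u ut Du D2u hmem g hgm hg => ⟨fun ε hε hε1 => ?_, ?_⟩⟩
    · refine (h₁ r hr hκ u ut Du D2u hmem g hgm hg ε hε hε1).trans ?_
      rw [ENNReal.coe_add]
      gcongr <;> exact le_self_add
    · refine (h₂ r hr hκ u ut Du D2u hmem g hgm hg).trans ?_
      rw [ENNReal.coe_add]
      gcongr
      exact le_add_self
  · exact ⟨0, fun h => absurd h hβ⟩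

end Estimates

end ParabolicMorrey

theorem theorem6 (d : ℕ) (p q β μ : ℝ) (hp : 1 < p) (hq : 1 < q) (hμ : μ < 2) :
    ∃ N : ℝ≥0, ∀ (γ : ℕ) (r : ℝ), γ ∈ ({0, 1} : Set ℕ) → p ≤ r →
      2 - (γ : ℝ) < β → β ≤ d / p + 2 / q → d / p + 2 / q < 2 - (γ : ℝ) + d / r →
      (γ : ℝ) + d / p + 2 / q - d / r ≤ μ →
      ∀ (u ut : ParabolicMorrey.Z d → ℝ) (Du : ParabolicMorrey.Z d → ParabolicMorrey.E d)
        (D2u : ParabolicMorrey.Z d → EuclideanSpace ℝ (Fin d × Fin d)),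
        ParabolicMorrey.MemMorrey12 p q β u ut Du D2u →
        ∃ g : ParabolicMorrey.E d → ParabolicMorrey.DVal d γ,
          (∀ ζ : ParabolicMorrey.Z d → ℝ, ParabolicMorrey.IsMollifier ζ →
            ParabolicMorrey.IsTrace γ r ζ u g ∧
            ∀ g' : ParabolicMorrey.E d → ParabolicMorrey.DVal d γ,
              ParabolicMorrey.IsTrace γ r ζ u g' → g' =ᵐ[volume] g) ∧
          ParabolicMorrey.MemEllipticMorrey r (β + γ - μ) g ∧
          ParabolicMorrey.MemEllipticMorrey r (β + γ - 2) g ∧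
          (∀ ε : ℝ, 0 < ε → ε ≤ 1 →
            ParabolicMorrey.ellipticMorreyNorm r (β + γ - μ) g ≤
              N * ENNReal.ofReal ε *
                  (ParabolicMorrey.morreyNorm p q β ut + ParabolicMorrey.morreyNorm p q β D2u) +
                N * ENNReal.ofReal (ε ^ (-μ / (2 - μ))) * ParabolicMorrey.morreyNorm p q β u) ∧
          ParabolicMorrey.ellipticMorreyNorm r (β + γ - 2) g ≤
            N * ParabolicMorrey.morrey12Norm p q β u ut Du D2u := by
  obtain ⟨N₀, h₀⟩ := ParabolicMorrey.exists_trace_estimates d 0 (Or.inl rfl) β hp hq hμ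
  obtain ⟨N₁, h₁⟩ := ParabolicMorrey.exists_trace_estimates d 1 (Or.inr rfl) β hp hq hμ
  refine ⟨N₀ + N₁, fun γ r hγ hr hβ _ hκ hκμ u ut Du D2u hmem => ?_⟩
  have hγ' : γ = 0 ∨ γ = 1 := by simpa using hγ
  obtain ⟨g, hgm, hg⟩ := hmem.exists_trace hp hq hγ' hr hκ
  obtain ⟨ζ, hζ, -⟩ := ParabolicMorrey.exists_isMollifier d
  have hest : (∀ ε : ℝ, 0 < ε → ε ≤ 1 → ParabolicMorrey.ellipticMorreyNorm r (β + γ - μ) g ≤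
      ↑(N₀ + N₁) * ENNReal.ofReal ε *
          (ParabolicMorrey.morreyNorm p q β ut + ParabolicMorrey.morreyNorm p q β D2u) +
        ↑(N₀ + N₁) * ENNReal.ofReal (ε ^ (-μ / (2 - μ))) * ParabolicMorrey.morreyNorm p q β u) ∧
      ParabolicMorrey.ellipticMorreyNorm r (β + γ - 2) g ≤
        ↑(N₀ + N₁) * ParabolicMorrey.morrey12Norm p q β u ut Du D2u := by
    rw [ENNReal.coe_add]
    rcases hγ' with rfl | rfl
    · obtain ⟨h1, h2⟩ := h₀ hβ r hr hκμ u ut Du D2u hmem g hgm hg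
      refine ⟨fun ε hε hε1 => (h1 ε hε hε1).trans ?_, h2.trans ?_⟩ <;> gcongr <;>
        exact le_self_add
    · obtain ⟨h1, h2⟩ := h₁ hβ r hr hκμ u ut Du D2u hmem g hgm hg
      refine ⟨fun ε hε hε1 => (h1 ε hε hε1).trans ?_, h2.trans ?_⟩ <;> gcongr <;>
        exact le_add_self
  refine ⟨g, fun ζ hζ => ⟨hg ζ hζ, fun g' hg' =>
    (hg ζ hζ).ae_eq (by linarith) hζ hmem.weak_ut.1 hg'⟩, ⟨(hg ζ hζ).1, ?_⟩, ⟨(hg ζ hζ).1, ?_⟩,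
    hest.1, hest.2⟩
  · refine (hest.1 1 one_pos le_rfl).trans_lt (ENNReal.add_lt_top.2 ⟨?_, ?_⟩)
    · exact ENNReal.mul_lt_top (ENNReal.mul_lt_top ENNReal.coe_lt_top ENNReal.ofReal_lt_top)
        (ENNReal.add_lt_top.2 ⟨hmem.mem_ut.2, hmem.mem_D2u.2⟩)
    · exact ENNReal.mul_lt_top (ENNReal.mul_lt_top ENNReal.coe_lt_top ENNReal.ofReal_lt_top)
        hmem.mem.2
  · exact hest.2.trans_lt
      (ENNReal.mul_lt_top ENNReal.coe_lt_top (ParabolicMorrey.morrey12Norm_lt_top hmem))
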